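/- Let $\nu$ be Lebesgue measure on $\mathbb{R}^2$ and let $D(a)$ be the closed disk of radius $a$ centered at the origin. Let $\alpha>1$ and $r_1\in(0,\infty]$, with $r_1<\infty$ if $\alpha\le 3$. Let $Y$ be a random compact subset of $\mathbb{R}^2$ such that, for some constants $0<a_1<a_2$, almost surely $D(a_1)\subset Y\subset D(a_2)$, and such that $\nu(\partial Y)=0$ almost surely. For $0<r_0<r_1$ let $R$ be independent of $Y$ with density $\eta\, r^{-\alpha}\mathbf 1(r_0\le r\le r_1)$, where $\eta=\eta(r_0,r_1)$ is the normalizing constant. The dead leaves model $M(r_0,r_1)$ is defined as follows. Let $\{(x_i,t_i)\}$ be a homogeneous Poisson point process of intensity one on $\mathbb{R}^2\times\mathbb{R}$ and let $(X_i)$ be i.i.d. random closed sets, distributed as $RY$ and independent of $\{(x_i,t_i)\}$. Then $M(r_0,r_1)$ is the collection of the visible parts $$V_i=(x_i+X_i)\setminus\bigcup_{t_j\in(t_i,0)}\bigl(x_j+\mathrm{int}\,X_j\bigr),\qquad t_i\le 0,$$ and $\partial M=\bigcup_i\partial V_i$. Let $C_0$ be any real random field on $\mathbb{R}^2$ and let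 $(C_i)_i$ be independent copies of $C_0$, independent of $\{(x_i,t_i,X_i)\}$. The colored dead leaves process $I(C_0,r_0,r_1)$ has the value $C_i(\mathbf x)$ at $\mathbf x\notin\partial M$, where $i$ is the (almost surely unique) index such that $\mathbf x\in\mathrm{int}\,V_i$, and the value $0$ at $\mathbf x\in\partial M$. Then: 1. There is a random process $I(C_0,0,r_1)$ on $\mathbb{R}^2$ such that $I(C_0,r_0,r_1)\to I(C_0,0,r_1)$ in the sense of finite-dimensional distributions as $r_0\to0$: for all $n$ and all $\mathbf x_1,\dots,\mathbf x_n\in\mathbb{R}^2$, the vector of the values of $I(C_0,r_0,r_1)$ at $\mathbf x_1,\dots,\mathbf x_n$ converges in distribution to the vector of the values of $I(C_0,0,r_1)$ at these points. 2. For all $n$ and all non-empty compact sets $K_1,\dots,K_n\subset\mathbb{R}^2$, the probability $$Q^{(n)}_{r_0}(K_1,\dots,K_n)=\Pr\bigl(\exists\, t_{i_1}<\dots<t_{i_n}\le 0 \text{ such that } K_j\subset \mathrm{int}\,V_{i_j}\text{ for } j=1,\dots,n\bigr)$$ converges as $r_0\to0$. -/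

import Mathlib

open MeasureTheory ProbabilityTheory Filter Topology TopologicalSpace
open scoped Pointwise ENNReal NNReal

namespace DeadLeaves

/-- The Euclidean plane. -/
abbrev Plane : Type := EuclideanSpace ℝ (Fin 2)

/-- The `σ`-algebra on the space of closed subsets of the plane that is generated by the events
`{F | F ∩ K = ∅}` with `K` compact (it is the Borel `σ`-algebra of the hit-or-miss topology).
A random closed set is a random variable with values in this measurable space. -/
instance closedsMeasurableSpace : MeasurableSpace (Closeds Plane) :=
  MeasurableSpace.generateFrom
    {S | ∃ K : Set Plane, IsCompact K ∧ S = {F : Closeds Plane | (F : Set Plane) ∩ K = ∅}}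

/-- The homothetic `r F = {r y | y ∈ F}` of a closed set. -/
def scaleSet (r : ℝ) (F : Closeds Plane) : Closeds Plane :=
  ⟨r • (F : Set Plane), F.isClosed.smul₀ r⟩

theorem measurableSet_miss {K : Set Plane} (hK : IsCompact K) :
    MeasurableSet {F : Closeds Plane | (F : Set Plane) ∩ K = ∅} :=
  MeasurableSpace.measurableSet_generateFrom ⟨K, hK, rfl⟩

theorem measurableSet_empty_closed : MeasurableSet {F : Closeds Plane | (F : Set Plane) = ∅} := by
  have : {F : Closeds Plane | (F : Set Plane) = ∅} =
      ⋂ n : ℕ, {F : Closeds Plane | (F : Set Plane) ∩ Metric.closedBall 0 (n : ℝ) = ∅} := by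
    ext F
    simp only [Set.mem_ofPred_eq, Set.mem_iInter]
    constructor
    · intro h n
      rw [h, Set.empty_inter]
    · intro h
      by_contra hne
      obtain ⟨y, hy⟩ := Set.nonempty_iff_ne_empty.mpr hne
      obtain ⟨n, hn⟩ := exists_nat_ge ‖y‖
      have : y ∈ (F : Set Plane) ∩ Metric.closedBall 0 (n : ℝ) := ⟨hy, by simpa using hn⟩
      rw [h n] at this
      exact this
  rw [this]
  exact MeasurableSet.iInter fun n => measurableSet_miss (isCompact_closedBall _ _)

/-- The homothetic of a random closed set by a random factor is a random closed set. -/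
theorem measurable_scaleSet :
    Measurable (fun p : ℝ × Closeds Plane => scaleSet p.1 p.2) := by
  refine measurable_generateFrom ?_
  rintro _ ⟨K, hK, rfl⟩
  -- the compact set of all `s⁻¹ k` with `s` between two numbers and `k ∈ K`
  let J : ℚ × ℚ → Set Plane := fun q =>
    (fun z : ℝ × Plane => z.1⁻¹ • z.2) '' (Set.Icc (q.1 : ℝ) q.2 ×ˢ K)
  have hJ : ∀ q : ℚ × ℚ, (0 : ℝ) ∉ Set.Icc (q.1 : ℝ) q.2 → IsCompact (J q) := by
    intro q hq
    refine (isCompact_Icc.prod hK).image_of_continuousOn ?_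
    refine ContinuousOn.smul (ContinuousOn.inv₀ continuousOn_fst ?_) continuousOn_snd
    rintro ⟨s, k⟩ ⟨hs, -⟩ h0
    exact hq (h0 ▸ hs)
  have key : (fun p : ℝ × Closeds Plane => scaleSet p.1 p.2) ⁻¹'
        {F : Closeds Plane | (F : Set Plane) ∩ K = ∅} =
      (({0} : Set ℝ) ×ˢ {F : Closeds Plane | (F : Set Plane) = ∅ ∨ (0 : Plane) ∉ K}) ∪
      ⋃ q : ℚ × ℚ, ⋃ _ : (0 : ℝ) ∉ Set.Icc (q.1 : ℝ) q.2,
        (Set.Icc (q.1 : ℝ) q.2) ×ˢ {F : Closeds Plane | (F : Set Plane) ∩ J q = ∅} := by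
    ext ⟨r, F⟩
    have hsc : (scaleSet r F : Set Plane) = r • (F : Set Plane) := rfl
    simp only [Set.mem_preimage, Set.mem_ofPred_eq, hsc, Set.mem_union, Set.mem_prod,
      Set.mem_singleton_iff, Set.mem_iUnion, exists_prop]
    constructor
    · intro h
      by_cases hr : r = 0
      · left
        refine ⟨hr, ?_⟩
        by_contra! hcon
        obtain ⟨hF, h0⟩ := hcon
        obtain ⟨y, hy⟩ := hF
        have : (0 : Plane) ∈ r • (F : Set Plane) ∩ K :=
          ⟨⟨y, hy, by simp [hr]⟩, h0⟩
        rw [h] at this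
        exact this
      · right
        -- the good factors form a neighbourhood of `r`
        have hnhds : ∀ᶠ s in 𝓝 r, ∀ k ∈ K, s⁻¹ • k ∉ (F : Set Plane) := by
          refine hK.eventually_forall_of_forall_eventually ?_
          intro k hk
          have hc : ContinuousAt (fun z : ℝ × Plane => z.1⁻¹ • z.2) (r, k) :=
            ContinuousAt.smul (continuousAt_fst.inv₀ hr) continuousAt_snd
          refine hc.eventually (F.isClosed.isOpen_compl.mem_nhds ?_)
          intro hmem
          have : k ∈ r • (F : Set Plane) ∩ K :=
            ⟨⟨r⁻¹ • k, hmem, by simp [smul_smul, hr]⟩, hk⟩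
          rw [h] at this
          exact this
        have hne : ∀ᶠ s in 𝓝 r, s ≠ 0 := eventually_ne_nhds hr
        obtain ⟨ε, hε, hball⟩ := Metric.eventually_nhds_iff.mp (hnhds.and hne)
        obtain ⟨a, ha1, ha2⟩ := exists_rat_btwn (show r - ε < r by linarith)
        obtain ⟨b, hb1, hb2⟩ := exists_rat_btwn (show r < r + ε by linarith)
        have hin : ∀ s ∈ Set.Icc (a : ℝ) b, dist s r < ε := by
          rintro s ⟨h1, h2⟩
          rw [Real.dist_eq, abs_lt]
          constructor <;> linarith
        refine ⟨(a, b), ?_, ⟨ha2.le, hb1.le⟩, ?_⟩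
        · intro h0
          exact (hball (hin 0 h0)).2 rfl
        · rw [Set.eq_empty_iff_forall_notMem]
          rintro _ ⟨hyF, ⟨s, k⟩, ⟨hs, hk⟩, rfl⟩
          exact (hball (hin s hs)).1 k hk hyF
    · rintro (⟨rfl, h⟩ | ⟨q, hq, hrq, h⟩)
      · rw [Set.eq_empty_iff_forall_notMem]
        rintro _ ⟨⟨y, hy, rfl⟩, hK0⟩
        rcases h with h | h
        · rw [h] at hy
          exact hy
        · exact h (by simpa using hK0)
      · have hr : r ≠ 0 := by
          rintro rfl
          exact hq hrq
        rw [Set.eq_empty_iff_forall_notMem]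
        rintro _ ⟨⟨y, hy, rfl⟩, hk⟩
        have : y ∈ (F : Set Plane) ∩ J q :=
          ⟨hy, ⟨(r, r • y), ⟨hrq, hk⟩, by simp [smul_smul, hr]⟩⟩
        rw [h] at this
        exact this
  rw [key]
  refine MeasurableSet.union ?_ ?_
  · refine (measurableSet_singleton _).prod ?_
    exact measurableSet_empty_closed.union (MeasurableSet.const _)
  · refine MeasurableSet.iUnion fun q => MeasurableSet.iUnion fun hq => ?_
    exact measurableSet_Icc.prod (measurableSet_miss (hJ q hq))

/-- The range `[r₀, r₁]` of the sizes (`[r₀, ∞)` if `r₁ = ∞`). -/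
def sizeRange (r₀ : ℝ) (r₁ : EReal) : Set ℝ := {r | r₀ ≤ r ∧ (r : EReal) ≤ r₁}

/-- The law on `ℝ` with density `η r ^ (-α)` on `[r₀, r₁]` and `0` elsewhere, where `η` is the
normalizing constant. -/
noncomputable def sizeLaw (α r₀ : ℝ) (r₁ : EReal) : Measure ℝ :=
  (volume.restrict (sizeRange r₀ r₁)).withDensity
    (fun r => ENNReal.ofReal ((∫ u in sizeRange r₀ r₁, u ^ (-α))⁻¹ * r ^ (-α)))

/-- The law of the grain `R Y`, where `Y` has law `μY` and `R` is independent of `Y` and has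
law `sizeLaw α r₀ r₁`. -/
noncomputable def scaledGrainLaw (α r₀ : ℝ) (r₁ : EReal) (μY : Measure (Closeds Plane)) :
    Measure (Closeds Plane) :=
  ((sizeLaw α r₀ r₁).prod μY).map (fun p => scaleSet p.1 p.2)

/-- The number of points of the sequence `z` that fall in `B`. -/
noncomputable def pointCount {Ω E : Type*} (z : ℕ → Ω → E) (B : Set E) (ω : Ω) : ℕ∞ :=
  {i | z i ω ∈ B}.encard

/-- The random points `z 0, z 1, …` form a Poisson point process with intensity measure `Λ`: the
number of points in a set of finite intensity `Λ B` is a Poisson variable of parameter `Λ B`,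
and the numbers of points in pairwise disjoint sets are independent. -/
structure IsPoissonPointProcess {Ω E : Type*} [MeasurableSpace Ω] [MeasurableSpace E]
    (P : Measure Ω) (Λ : Measure E) (z : ℕ → Ω → E) : Prop where
  measurable : ∀ i, Measurable (z i)
  poisson : ∀ B : Set E, MeasurableSet B → Λ B ≠ ∞ →
    P.map (pointCount z B) = (poissonMeasure (Λ B).toNNReal).map (fun k : ℕ => (k : ℕ∞))
  indep : ∀ (m : ℕ) (B : Fin m → Set E), (∀ k, MeasurableSet (B k)) →
    Pairwise (fun k l => Disjoint (B k) (B l)) → iIndepFun (fun k => pointCount z (B k)) P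

/-- The visible part `V_i` of the leaf `x_i + X_i` that falls at the time `t_i ≤ 0`: the leaf
minus the translated interiors `x_j + int X_j` of the leaves that fall during `(t_i, 0)`. Only
the leaves fallen until the time `0` are used, so `V_i` is empty if `t_i > 0`. -/
def visiblePart (x : ℕ → Plane) (t : ℕ → ℝ) (X : ℕ → Closeds Plane) (i : ℕ) : Set Plane :=
  {p | t i ≤ 0 ∧ p ∈ x i +ᵥ (X i : Set Plane) ∧
    ∀ j, t i < t j → t j < 0 → p ∉ x j +ᵥ interior (X j : Set Plane)}

/-- The boundary of a tessellation: the union of the boundaries of its sets. -/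
def tessBoundary (F : ℕ → Set Plane) : Set Plane := ⋃ i, frontier (F i)

open Classical in
/-- The tessellation `F`, colored by the fields `c i`: the value at a point `p` outside the
boundary is `c i p`, where `i` is the unique index such that `p` is in the interior of `F i`, and
the value on the boundary is `0`. -/
noncomputable def coloredTess (F : ℕ → Set Plane) (c : ℕ → Plane → ℝ) (p : Plane) : ℝ :=
  if p ∈ tessBoundary F then 0 else c (sInf {i | p ∈ interior (F i)}) p

/-- The data of a dead leaves model whose grain has law `μ`: the points `(x_i, t_i)` form a
homogeneous Poisson point process of intensity one in `ℝ² × ℝ`, and the random closed sets `X_i`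
are i.i.d. of law `μ` and independent of these points. The model is then the collection of the
visible parts. -/
structure IsDeadLeaves {Ω : Type*} [MeasurableSpace Ω] (P : Measure Ω)
    (μ : Measure (Closeds Plane)) (x : ℕ → Ω → Plane) (t : ℕ → Ω → ℝ)
    (X : ℕ → Ω → Closeds Plane) : Prop where
  poisson : IsPoissonPointProcess P (volume : Measure (Plane × ℝ)) (fun i ω => (x i ω, t i ω))
  grain_measurable : ∀ i, Measurable (X i)
  grain_law : ∀ i, P.map (X i) = μ
  grain_iIndep : iIndepFun X P
  points_indep_grains :
    IndepFun (fun ω (i : ℕ) => (x i ω, t i ω)) (fun ω (i : ℕ) => X i ω) P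

/-- The data of a colored dead leaves model: in addition, random fields `C_i` on the plane that
are independent copies of a field of law `γ`, and independent of the dead leaves model. -/
structure IsColoredDeadLeaves {Ω : Type*} [MeasurableSpace Ω] (P : Measure Ω)
    (μ : Measure (Closeds Plane)) (γ : Measure (Plane → ℝ)) (x : ℕ → Ω → Plane) (t : ℕ → Ω → ℝ)
    (X : ℕ → Ω → Closeds Plane) (C : ℕ → Ω → Plane → ℝ) : Prop
    extends IsDeadLeaves P μ x t X where
  color_measurable : ∀ i, Measurable (C i)
  color_law : ∀ i, P.map (C i) = γ
  color_iIndep : iIndepFun C P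
  leaves_indep_colors :
    IndepFun (fun ω (i : ℕ) => ((x i ω, t i ω), X i ω)) (fun ω (i : ℕ) => C i ω) P

/-- The colored dead leaves process. -/
noncomputable def coloredDeadLeaves {Ω : Type*} (x : ℕ → Ω → Plane) (t : ℕ → Ω → ℝ)
    (X : ℕ → Ω → Closeds Plane) (C : ℕ → Ω → Plane → ℝ) (p : Plane) (ω : Ω) : ℝ :=
  coloredTess (visiblePart (fun i => x i ω) (fun i => t i ω) (fun i => X i ω))
    (fun i => C i ω) p

/-- The probability `Q⁽ⁿ⁾(K₁, …, Kₙ)` that there are `t_{i₁} < … < t_{iₙ} ≤ 0` such that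
`K_j` lies in the interior of the visible part `V_{i_j}` for all `j`. -/
noncomputable def Qfun {Ω : Type*} [MeasurableSpace Ω] (P : Measure Ω) (x : ℕ → Ω → Plane)
    (t : ℕ → Ω → ℝ) (X : ℕ → Ω → Closeds Plane) {n : ℕ} (K : Fin n → Set Plane) : ℝ :=
  P.real {ω | ∃ i : Fin n → ℕ, StrictMono (fun j => t (i j) ω) ∧ (∀ j, t (i j) ω ≤ 0) ∧
    ∀ j, K j ⊆
      interior (visiblePart (fun k => x k ω) (fun k => t k ω) (fun k => X k ω) (i j))}

/-- The admissible smallest sizes `r₀ ∈ (0, r₁)`. -/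
abbrev SmallSize (r₁ : EReal) : Type := {r₀ : ℝ // 0 < r₀ ∧ (r₀ : EReal) < r₁}

/-- The filter of the limits `r₀ → 0` with `r₀ ∈ (0, r₁)`. -/
def smallSizeToZero (r₁ : EReal) : Filter (SmallSize r₁) := comap Subtype.val (𝓝 (0 : ℝ))

end DeadLeaves

open DeadLeaves

/-!
The visible leaves are found by exploring the leaves backwards from the time `0`. Only the
leaves that hit `K₀ ∪ … ∪ Kₙ₋₁` matter: `K₀, …, Kₙ₋₁` show in this order, each inside one visible
part, if the last leaf that hits the union covers `Kₙ₋₁` and misses `K₀, …, Kₙ₋₂`, the last leaf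
before it that hits `K₀ ∪ … ∪ Kₙ₋₂` covers `Kₙ₋₂` and misses `K₀, …, Kₙ₋₃`, and so on. Such a
sequence of leaves is a `Chain`. The marked points form a Poisson process with intensity
`κ ⊗ dt`, where `κ = volume ⊗ μ` is a measure on the translated leaves. The last leaf that hits
the union is therefore distributed as `κ` conditioned on the leaves that do, and it is independent
of the earlier ones, so that the probability is the product of the ratios
`κ (stepSet K j) / κ (hitSet (K₀ ∪ … ∪ Kⱼ))` (`IsMarkedPoisson.measure_chain`,
`IsDeadLeaves.measure_exists_visible`).

Each ratio is a quotient of integrals over the sizes `r ∈ [r₀, r₁]`; the normalizing constant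
cancels. As `r₀ → 0`, either the denominator stays bounded, and both integrals converge, or it
diverges, and only the small sizes matter. In the second case the quotient converges to the limit,
as `r → 0`, of the quotient of the integrands (`exists_tendsto_lintegral_ratio`). That limit exists:
a small grain covers `Kⱼ` only if `Kⱼ` is a point, while a finite union of the sets is hit at a rate
that is the sum of the equal rates of its points, and an infinite union at a rate of larger order
(`exists_leafRate_ratio`). This proves the convergence of `Qfun` (`exists_tendsto_Qfun`).

For the colored process, almost surely each of finitely many points lies in the interior of exactly
one visible part and on no boundary. The points are thereby partitioned into blocks, which are
ordered by the times of their leaves; the probability of an ordered partition is `Qfun` of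
its blocks. Given the partition the colors are those of independent fields, one for each
block. The law of the values is then a mixture of fixed laws with weights `Qfun`
(`IsColoredDeadLeaves.map_coloredDeadLeaves_apply`) and converges on every measurable set. The
limits form a projective family, and the Kolmogorov extension theorem (`exists_isProjectiveLimit`)
gives the limit process.
-/

namespace DeadLeaves

/-! ### Poisson point processes: mean measure and void probabilities -/

section Poisson

theorem toENNReal_pointCount {Ω E : Type*} (z : ℕ → Ω → E) (B : Set E) (ω : Ω) :
    (pointCount z B ω : ℝ≥0∞) = ∑' i, (z i ⁻¹' B).indicator 1 ω := by
  rw [pointCount, ← ENNReal.tsum_set_one, tsum_subtype {i | z i ω ∈ B} (fun _ => (1 : ℝ≥0∞))]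
  rfl

variable {Ω E M : Type*} [MeasurableSpace Ω] [MeasurableSpace E] [MeasurableSpace M]
  {P : Measure Ω} {Λ : Measure E} {z : ℕ → Ω → E}

theorem measurable_pointCount (hz : ∀ i, Measurable (z i)) {B : Set E} (hB : MeasurableSet B) :
    Measurable (pointCount z B) := by
  have h : Measurable (fun ω => (pointCount z B ω : ℝ≥0∞)) := by
    simp_rw [toENNReal_pointCount]
    exact Measurable.tsum fun i => measurable_one.indicator (hz i hB)
  refine measurable_to_countable' fun k => ?_
  have : pointCount z B ⁻¹' {k} = (fun ω => (pointCount z B ω : ℝ≥0∞)) ⁻¹' {(k : ℝ≥0∞)} := by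
    ext ω
    simp
  rw [this]
  exact h (measurableSet_singleton _)

theorem lintegral_pointCount (hz : ∀ i, Measurable (z i)) {B : Set E} (hB : MeasurableSet B) :
    ∫⁻ ω, (pointCount z B ω : ℝ≥0∞) ∂P = ∑' i, P.map (z i) B := by
  simp_rw [toENNReal_pointCount]
  rw [lintegral_tsum fun i => (measurable_one.indicator (hz i hB)).aemeasurable]
  refine tsum_congr fun i => ?_
  rw [lintegral_indicator_one (hz i hB), Measure.map_apply (hz i) hB]

theorem lintegral_natCast_poissonMeasure (r : ℝ≥0) :
    ∫⁻ k, (k : ℝ≥0∞) ∂poissonMeasure r = r := by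
  have hs : ∀ k : ℕ, (k : ℝ≥0∞) * poissonMeasure r {k} =
      ENNReal.ofReal (k * (Real.exp (-r) * r ^ k / k.factorial)) := by
    intro k
    rw [poissonMeasure_singleton, ENNReal.ofReal_mul (by positivity), ENNReal.ofReal_natCast]
  rw [lintegral_countable', tsum_congr hs]
  have hsum : HasSum (fun k : ℕ => (k : ℝ) * (Real.exp (-r) * r ^ k / k.factorial)) r := by
    rw [← hasSum_nat_add_iff' 1]
    have := (hasSum_one_poissonMeasure r).mul_left (r : ℝ)
    simp only [Finset.range_one, Finset.sum_singleton, Nat.cast_zero, zero_mul, sub_zero]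
    rw [mul_one] at this
    refine this.congr_fun fun k => ?_
    rw [Nat.factorial_succ]
    push_cast
    field_simp
    ring
  rw [← ENNReal.ofReal_tsum_of_nonneg (fun k => by positivity) hsum.summable, hsum.tsum_eq,
    ENNReal.ofReal_coe_nnreal]

/-- The generating function of the Poisson law at `1 - c`. -/
theorem lintegral_pow_poissonMeasure (r : ℝ≥0) {c : ℝ≥0∞} (hc : c ≤ 1) :
    ∫⁻ k, (1 - c) ^ k ∂poissonMeasure r = ENNReal.ofReal (Real.exp (-(r * c.toReal))) := by
  have hc' : c.toReal ≤ 1 := by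
    simpa using ENNReal.toReal_mono ENNReal.one_ne_top hc
  have h1 : (1 - c) = ENNReal.ofReal (1 - c.toReal) := by
    rw [ENNReal.ofReal_sub _ ENNReal.toReal_nonneg, ENNReal.ofReal_one,
      ENNReal.ofReal_toReal (ne_top_of_le_ne_top ENNReal.one_ne_top hc)]
  have hs : ∀ k : ℕ, (1 - c) ^ k * poissonMeasure r {k} =
      ENNReal.ofReal (Real.exp (-r) * ((r * (1 - c.toReal)) ^ k / k.factorial)) := by
    intro k
    rw [poissonMeasure_singleton, h1, ← ENNReal.ofReal_pow (by linarith),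
      ← ENNReal.ofReal_mul (by have : 0 ≤ 1 - c.toReal := by linarith
                               positivity)]
    congr 1
    rw [mul_pow]
    ring
  have hsum : HasSum (fun k : ℕ => Real.exp (-r) * ((r * (1 - c.toReal)) ^ k / k.factorial))
      (Real.exp (-(r * c.toReal))) := by
    have := (NormedSpace.expSeries_div_hasSum_exp ((r : ℝ) * (1 - c.toReal))).mul_left
      (Real.exp (-r))
    rw [← Real.exp_eq_exp_ℝ, ← Real.exp_add] at this
    rwa [show -(r : ℝ) + r * (1 - c.toReal) = -(r * c.toReal) by ring] at this
  rw [lintegral_countable', tsum_congr hs, ← ENNReal.ofReal_tsum_of_nonneg _ hsum.summable,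
    hsum.tsum_eq]
  intro k
  have : 0 ≤ 1 - c.toReal := by linarith
  positivity

namespace IsPoissonPointProcess

theorem lintegral_comp_pointCount (h : IsPoissonPointProcess P Λ z) {B : Set E}
    (hB : MeasurableSet B) (hΛ : Λ B ≠ ∞) (f : ℕ∞ → ℝ≥0∞) :
    ∫⁻ ω, f (pointCount z B ω) ∂P = ∫⁻ k : ℕ, f k ∂poissonMeasure (Λ B).toNNReal := by
  rw [← lintegral_map (f := f) (by fun_prop) (measurable_pointCount h.measurable hB),
    h.poisson B hB hΛ, lintegral_map (by fun_prop) (by fun_prop)]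

/-- The mean measure of a Poisson point process is its intensity. -/
theorem sum_map_eq [SigmaFinite Λ] (h : IsPoissonPointProcess P Λ z) :
    Measure.sum (fun i => P.map (z i)) = Λ := by
  have key : ∀ B, MeasurableSet B → Λ B ≠ ∞ → Measure.sum (fun i => P.map (z i)) B = Λ B := by
    intro B hB hΛ
    rw [Measure.sum_apply _ hB, ← lintegral_pointCount h.measurable hB,
      h.lintegral_comp_pointCount hB hΛ (fun k => (k : ℝ≥0∞))]
    simp only [ENat.toENNReal_coe]
    rw [lintegral_natCast_poissonMeasure, ENNReal.coe_toNNReal hΛ]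
  ext B hB
  have hU : B = ⋃ n, B ∩ spanningSets Λ n := by
    rw [← Set.inter_iUnion, iUnion_spanningSets, Set.inter_univ]
  have hmono : Monotone fun n => B ∩ spanningSets Λ n := fun m n hmn =>
    Set.inter_subset_inter_right _ (monotone_spanningSets Λ hmn)
  rw [hU, hmono.measure_iUnion, hmono.measure_iUnion]
  refine iSup_congr fun n => key _ (hB.inter (measurableSet_spanningSets Λ n)) ?_
  exact ((measure_mono Set.inter_subset_right).trans_lt (measure_spanningSets_lt_top Λ n)).ne

theorem tsum_lintegral [SigmaFinite Λ] (h : IsPoissonPointProcess P Λ z) {f : E → ℝ≥0∞}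
    (hf : Measurable f) : ∑' i, ∫⁻ ω, f (z i ω) ∂P = ∫⁻ e, f e ∂Λ := by
  conv_rhs => rw [← h.sum_map_eq, lintegral_sum_measure]
  exact tsum_congr fun i => (lintegral_map hf (h.measurable i)).symm

theorem ae_finite [SigmaFinite Λ] (h : IsPoissonPointProcess P Λ z) {B : Set E}
    (hB : MeasurableSet B) (hΛ : Λ B ≠ ∞) : ∀ᵐ ω ∂P, {i | z i ω ∈ B}.Finite := by
  refine ae_finite_setOfPred_mem (s := fun i => z i ⁻¹' B) ?_
  have := h.tsum_lintegral (f := B.indicator 1) (measurable_one.indicator hB)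
  rw [lintegral_indicator_one hB] at this
  convert hΛ using 1
  rw [← this]
  refine tsum_congr fun i => ?_
  rw [← lintegral_indicator_one (h.measurable i hB)]
  rfl

/-- The generating functional of a Poisson point process at a simple function: it is a product
of the generating functions of independent Poisson variables. -/
theorem tendsto_lintegral_prod_simple [IsProbabilityMeasure P] [SigmaFinite Λ]
    (h : IsPoissonPointProcess P Λ z)
    {m : ℕ} (A : Fin m → Set E) (hA : ∀ k, MeasurableSet (A k))
    (hdisj : Pairwise fun k l => Disjoint (A k) (A l)) (hΛ : ∀ k, Λ (A k) ≠ ∞)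
    (c : Fin m → ℝ≥0∞) (hc : ∀ k, c k ≤ 1) :
    Tendsto (fun N => ∫⁻ ω, ∏ i ∈ Finset.range N,
        (1 - ∑ k, (A k).indicator (fun _ => c k) (z i ω)) ∂P) atTop
      (𝓝 (ENNReal.ofReal (Real.exp (-(∑ k, c k * Λ (A k)).toReal)))) := by
  classical
  have hfac : ∀ e, (1 - ∑ k, (A k).indicator (fun _ => c k) e) =
      ∏ k, (if e ∈ A k then 1 - c k else 1) := by
    intro e
    by_cases he : ∃ k, e ∈ A k
    · obtain ⟨k, hk⟩ := he
      have hne : ∀ l, l ≠ k → e ∉ A l := fun l hl hel =>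
        Set.disjoint_left.mp (hdisj hl) hel hk
      rw [Finset.sum_eq_single k, Finset.prod_eq_single k]
      · simp [hk]
      · intro l _ hl
        simp [hne l hl]
      · simp
      · intro l _ hl
        simp [hne l hl]
      · simp
    · push Not at he
      simp [he]
  have hlim : ∀ᵐ ω ∂P, Tendsto (fun N => ∏ i ∈ Finset.range N,
      (1 - ∑ k, (A k).indicator (fun _ => c k) (z i ω))) atTop
      (𝓝 (∏ k, (1 - c k) ^ (pointCount z (A k) ω).toNat)) := by
    have hfin : ∀ᵐ ω ∂P, ∀ k, {i | z i ω ∈ A k}.Finite :=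
      ae_all_iff.mpr fun k => h.ae_finite (hA k) (hΛ k)
    filter_upwards [hfin] with ω hω
    simp_rw [hfac]
    have : ∀ N, ∏ i ∈ Finset.range N, ∏ k, (if z i ω ∈ A k then 1 - c k else 1) =
        ∏ k, ∏ i ∈ Finset.range N, (if z i ω ∈ A k then 1 - c k else 1) :=
      fun N => Finset.prod_comm
    simp_rw [this]
    refine tendsto_const_nhds.congr' ?_
    choose b hb using fun k => (hω k).bddAbove
    filter_upwards [eventually_all.mpr fun k => eventually_gt_atTop (b k)] with N hN
    refine Finset.prod_congr rfl fun k _ => ?_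
    rw [Finset.prod_ite, Finset.prod_const_one, mul_one, Finset.prod_const]
    congr 1
    have : {i | z i ω ∈ A k} = ((Finset.range N).filter fun i => z i ω ∈ A k : Finset ℕ) := by
      ext i
      simp only [Set.mem_ofPred_eq, Finset.coe_filter, Finset.mem_range, iff_and_self]
      exact fun hi => (hb k hi).trans_lt (hN k)
    rw [pointCount, this, Set.encard_coe_eq_coe_finsetCard]
    rfl
  have hmeas : ∀ i, Measurable fun ω => (1 - ∑ k, (A k).indicator (fun _ => c k) (z i ω)) := by
    intro i
    refine measurable_const.sub (Finset.measurable_sum _ fun k _ => ?_)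
    exact (measurable_const.indicator (hA k)).comp (h.measurable i)
  have hval : ∫⁻ ω, ∏ k, (1 - c k) ^ (pointCount z (A k) ω).toNat ∂P =
      ENNReal.ofReal (Real.exp (-(∑ k, c k * Λ (A k)).toReal)) := by
    have hind := (h.indep m A hA hdisj).comp (fun k (n : ℕ∞) => (1 - c k) ^ n.toNat)
      (fun k => by fun_prop)
    have := lintegral_prod_eq_prod_lintegral_of_indepFun Finset.univ _ hind
      (fun k => (Measurable.of_discrete (f := fun n : ℕ∞ => (1 - c k) ^ n.toNat)).comp
        (measurable_pointCount h.measurable (hA k)))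
    simp only [Function.comp_def] at this
    rw [this]
    have hk : ∀ k, ∫⁻ ω, (1 - c k) ^ (pointCount z (A k) ω).toNat ∂P =
        ENNReal.ofReal (Real.exp (-(c k * Λ (A k)).toReal)) := by
      intro k
      rw [h.lintegral_comp_pointCount (hA k) (hΛ k) (fun n => (1 - c k) ^ n.toNat)]
      simp only [ENat.toNat_natCast]
      rw [lintegral_pow_poissonMeasure _ (hc k), ENNReal.toReal_mul, mul_comm]
      rfl
    simp_rw [hk]
    rw [← ENNReal.ofReal_prod_of_nonneg (fun _ _ => (Real.exp_pos _).le), ← Real.exp_sum,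
      ENNReal.toReal_sum, Finset.sum_neg_distrib]
    exact fun k _ => ENNReal.mul_ne_top (ne_top_of_le_ne_top ENNReal.one_ne_top (hc k)) (hΛ k)
  rw [← hval]
  refine tendsto_lintegral_of_dominated_convergence (fun _ => 1) ?_ ?_ ?_ hlim
  · exact fun N => Finset.measurable_prod _ fun i _ => hmeas i
  · exact fun N => ae_of_all _ fun ω => Finset.prod_le_one' fun i _ => tsub_le_self
  · simp

theorem tendsto_lintegral_prod_simpleFunc [IsProbabilityMeasure P] [SigmaFinite Λ]
    (h : IsPoissonPointProcess P Λ z) (s : SimpleFunc E ℝ≥0∞) (hs : ∀ e, s e ≤ 1)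
    (hΛ : ∫⁻ e, s e ∂Λ ≠ ∞) :
    Tendsto (fun N => ∫⁻ ω, ∏ i ∈ Finset.range N, (1 - s (z i ω)) ∂P) atTop
      (𝓝 (ENNReal.ofReal (Real.exp (-(∫⁻ e, s e ∂Λ).toReal)))) := by
  classical
  set S := s.range.filter (· ≠ 0) with hS
  let v : Fin S.card → ℝ≥0∞ := fun k => S.equivFin.symm k
  have hvS : ∀ k, v k ∈ S := fun k => (S.equivFin.symm k).2
  have hv0 : ∀ k, v k ≠ 0 := fun k => (Finset.mem_filter.mp (hvS k)).2
  have hvinj : Function.Injective v := Subtype.val_injective.comp S.equivFin.symm.injective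
  have hsum : ∀ e, ∑ k, (s ⁻¹' {v k}).indicator (fun _ => v k) e = s e := by
    intro e
    by_cases he : s e = 0
    · rw [he]
      refine Finset.sum_eq_zero fun k _ => ?_
      refine Set.indicator_of_notMem ?_ _
      simp only [Set.mem_preimage, Set.mem_singleton_iff, he]
      exact (hv0 k).symm
    · have heS : s e ∈ S := Finset.mem_filter.mpr ⟨SimpleFunc.mem_range_self s e, he⟩
      have hk : v (S.equivFin ⟨s e, heS⟩) = s e := by simp [v]
      rw [Finset.sum_eq_single (S.equivFin ⟨s e, heS⟩)]
      · rw [Set.indicator_of_mem, hk]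
        exact hk.symm
      · intro l _ hl
        refine Set.indicator_of_notMem ?_ _
        simp only [Set.mem_preimage, Set.mem_singleton_iff]
        intro h'
        exact hl (hvinj (by rw [hk, h']))
      · simp
  have hint : ∑ k, v k * Λ (s ⁻¹' {v k}) = ∫⁻ e, s e ∂Λ := by
    simp_rw [← hsum]
    rw [lintegral_finsetSum _ fun k _ => measurable_const.indicator (s.measurableSet_fiber _)]
    exact Finset.sum_congr rfl fun k _ => by
      rw [lintegral_indicator_const (s.measurableSet_fiber _)]
  have := h.tendsto_lintegral_prod_simple (fun k => s ⁻¹' {v k})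
    (fun k => s.measurableSet_fiber _) ?_ ?_ v ?_
  · simpa only [hsum, hint] using this
  · intro k l hkl
    refine Set.disjoint_left.mpr fun e h1 h2 => hkl (hvinj ?_)
    rw [← Set.mem_singleton_iff.mp h1, ← Set.mem_singleton_iff.mp h2]
  · intro k htop
    apply hΛ
    rw [← hint]
    refine ENNReal.sum_eq_top.mpr ⟨k, Finset.mem_univ _, ?_⟩
    rw [htop, ENNReal.mul_top (hv0 k)]
  · intro k
    obtain ⟨e, he⟩ := SimpleFunc.mem_range.mp (Finset.mem_filter.mp (hvS k)).1
    exact he ▸ hs e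

theorem _root_.ENNReal.prod_le_prod_add_sum_tsub {ι : Type*} (s : Finset ι) (a b : ι → ℝ≥0∞)
    (ha : ∀ i ∈ s, a i ≤ 1) (hb : ∀ i ∈ s, b i ≤ 1) :
    ∏ i ∈ s, a i ≤ ∏ i ∈ s, b i + ∑ i ∈ s, (a i - b i) := by
  classical
  induction s using Finset.induction_on with
  | empty => simp
  | insert j s hj ih =>
    rw [Finset.prod_insert hj, Finset.prod_insert hj, Finset.sum_insert hj]
    have ih' := ih (fun i hi => ha i (Finset.mem_insert_of_mem hi))
      (fun i hi => hb i (Finset.mem_insert_of_mem hi))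
    have haj := ha j (Finset.mem_insert_self _ _)
    have hB : ∏ i ∈ s, b i ≤ 1 := Finset.prod_le_one' fun i hi => hb i (Finset.mem_insert_of_mem hi)
    calc a j * ∏ i ∈ s, a i ≤ a j * (∏ i ∈ s, b i + ∑ i ∈ s, (a i - b i)) := by gcongr
      _ = a j * ∏ i ∈ s, b i + a j * ∑ i ∈ s, (a i - b i) := mul_add _ _ _
      _ ≤ (b j + (a j - b j)) * ∏ i ∈ s, b i + 1 * ∑ i ∈ s, (a i - b i) := by
        gcongr
        exact le_add_tsub
      _ = b j * ∏ i ∈ s, b i + (a j - b j) * ∏ i ∈ s, b i + ∑ i ∈ s, (a i - b i) := by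
        rw [add_mul, one_mul]
      _ ≤ b j * ∏ i ∈ s, b i + (a j - b j) * 1 + ∑ i ∈ s, (a i - b i) := by gcongr
      _ = _ := by rw [mul_one, add_assoc]

/-- The generating functional of a Poisson point process. Products are compared through
`|∏ aᵢ - ∏ bᵢ| ≤ ∑ |aᵢ - bᵢ|`, so that the functional is Lipschitz for the norm of `L¹(Λ)` and
the formula extends from simple functions. -/
theorem tendsto_lintegral_prod [IsProbabilityMeasure P] [SigmaFinite Λ]
    (h : IsPoissonPointProcess P Λ z) {f : E → ℝ≥0∞} (hf : Measurable f) (hf1 : ∀ e, f e ≤ 1)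
    (hΛ : ∫⁻ e, f e ∂Λ ≠ ∞) :
    Tendsto (fun N => ∫⁻ ω, ∏ i ∈ Finset.range N, (1 - f (z i ω)) ∂P) atTop
      (𝓝 (ENNReal.ofReal (Real.exp (-(∫⁻ e, f e ∂Λ).toReal)))) := by
  set Φ : (E → ℝ≥0∞) → ℕ → ℝ≥0∞ := fun g N => ∫⁻ ω, ∏ i ∈ Finset.range N, (1 - g (z i ω)) ∂P
    with hΦ
  have hanti : Antitone (Φ f) := by
    refine antitone_nat_of_succ_le fun N => lintegral_mono fun ω => ?_
    rw [Finset.prod_range_succ]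
    exact mul_le_of_le_one_right' tsub_le_self
  set s : ℕ → SimpleFunc E ℝ≥0∞ := fun m => SimpleFunc.eapprox f m
  have hsf : ∀ m e, s m e ≤ f e := fun m e => by
    rw [← SimpleFunc.iSup_eapprox_apply hf e]
    exact le_iSup (fun m => SimpleFunc.eapprox f m e) m
  have hint : Tendsto (fun m => ∫⁻ e, s m e ∂Λ) atTop (𝓝 (∫⁻ e, f e ∂Λ)) := by
    refine lintegral_tendsto_of_tendsto_of_monotone (fun m => (s m).measurable.aemeasurable) ?_ ?_
    · exact ae_of_all _ fun e m n hmn => SimpleFunc.monotone_eapprox f hmn e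
    · refine ae_of_all _ fun e => ?_
      rw [← SimpleFunc.iSup_eapprox_apply hf e]
      exact tendsto_atTop_iSup fun m n hmn => SimpleFunc.monotone_eapprox f hmn e
  have hsΛ : ∀ m, ∫⁻ e, s m e ∂Λ ≠ ∞ := fun m =>
    ne_top_of_le_ne_top hΛ (lintegral_mono (hsf m))
  have hsim : ∀ m, Tendsto (Φ (s m)) atTop
      (𝓝 (ENNReal.ofReal (Real.exp (-(∫⁻ e, s m e ∂Λ).toReal)))) := fun m =>
    h.tendsto_lintegral_prod_simpleFunc (s m) (fun e => (hsf m e).trans (hf1 e)) (hsΛ m)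
  have hle : ∀ m N, Φ f N ≤ Φ (s m) N := fun m N => lintegral_mono fun ω =>
    Finset.prod_le_prod' fun i _ => tsub_le_tsub_left (hsf m _) _
  have hge : ∀ m N, Φ (s m) N ≤ Φ f N + (∫⁻ e, f e ∂Λ - ∫⁻ e, s m e ∂Λ) := by
    intro m N
    have hmf : Measurable fun e => f e - s m e := hf.sub (s m).measurable
    calc Φ (s m) N ≤ ∫⁻ ω, (∏ i ∈ Finset.range N, (1 - f (z i ω)) +
          ∑ i ∈ Finset.range N, (f (z i ω) - s m (z i ω))) ∂P := by
          refine lintegral_mono fun ω => ?_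
          refine (ENNReal.prod_le_prod_add_sum_tsub _ _ (fun i => 1 - f (z i ω))
            (fun i _ => tsub_le_self) (fun i _ => tsub_le_self)).trans ?_
          refine add_le_add le_rfl (Finset.sum_le_sum fun i _ => ?_)
          rw [tsub_le_iff_left]
          exact tsub_le_tsub_add_tsub (a := 1) (b := f (z i ω)) (c := s m (z i ω))
      _ = Φ f N + ∑ i ∈ Finset.range N, ∫⁻ ω, (f (z i ω) - s m (z i ω)) ∂P := by
          rw [lintegral_add_left, lintegral_finsetSum]
          · exact fun i _ => hmf.comp (h.measurable i)
          · exact Finset.measurable_prod _ fun i _ =>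
              measurable_const.sub (hf.comp (h.measurable i))
      _ ≤ Φ f N + ∑' i, ∫⁻ ω, (f (z i ω) - s m (z i ω)) ∂P := by
          gcongr
          exact ENNReal.sum_le_tsum _
      _ = _ := by
          rw [h.tsum_lintegral hmf, lintegral_sub (s m).measurable (hsΛ m)
            (ae_of_all _ (hsf m))]
  have hinf : Tendsto (Φ f) atTop (𝓝 (⨅ N, Φ f N)) := tendsto_atTop_iInf hanti
  have hlim : Tendsto (fun m => ENNReal.ofReal (Real.exp (-(∫⁻ e, s m e ∂Λ).toReal))) atTop
      (𝓝 (ENNReal.ofReal (Real.exp (-(∫⁻ e, f e ∂Λ).toReal)))) :=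
    ENNReal.tendsto_ofReal ((Real.continuous_exp.tendsto _).comp
      ((ENNReal.tendsto_toReal hΛ).comp hint).neg)
  have h1 : ⨅ N, Φ f N ≤ ENNReal.ofReal (Real.exp (-(∫⁻ e, f e ∂Λ).toReal)) :=
    ge_of_tendsto' hlim fun m => le_of_tendsto_of_tendsto' hinf (hsim m) (hle m)
  have h2 : ENNReal.ofReal (Real.exp (-(∫⁻ e, f e ∂Λ).toReal)) ≤ ⨅ N, Φ f N := by
    have hsub : Tendsto (fun m => (⨅ N, Φ f N) + (∫⁻ e, f e ∂Λ - ∫⁻ e, s m e ∂Λ)) atTop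
        (𝓝 ((⨅ N, Φ f N) + (∫⁻ e, f e ∂Λ - ∫⁻ e, f e ∂Λ))) :=
      (ENNReal.Tendsto.sub tendsto_const_nhds hint (Or.inl hΛ)).const_add _
    rw [tsub_self, add_zero] at hsub
    exact le_of_tendsto_of_tendsto' hlim hsub fun m =>
      le_of_tendsto_of_tendsto' (hsim m) (hinf.add_const _) (hge m)
  rw [le_antisymm h2 h1]
  exact hinf

/-- Void probabilities of an independently marked Poisson point process. Given the points, the
marks are independent, and the probability that no marked point falls in `B` is a value of the
generating functional. -/
theorem measure_void_marked [IsProbabilityMeasure P] [SigmaFinite Λ]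
    (h : IsPoissonPointProcess P Λ z) {X : ℕ → Ω → M} {μ : Measure M} [IsProbabilityMeasure μ]
    (hX : ∀ i, Measurable (X i)) (hlaw : ∀ i, P.map (X i) = μ) (hind : iIndepFun X P)
    (hzX : IndepFun (fun ω (i : ℕ) => z i ω) (fun ω (i : ℕ) => X i ω) P)
    {B : Set (E × M)} (hB : MeasurableSet B) (hΛ : (Λ.prod μ) B ≠ ∞) :
    P {ω | ∀ i, (z i ω, X i ω) ∉ B} =
      ENNReal.ofReal (Real.exp (-((Λ.prod μ) B).toReal)) := by
  have hzm : Measurable fun ω (i : ℕ) => z i ω := measurable_pi_iff.mpr h.measurable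
  have hXm : Measurable fun ω (i : ℕ) => X i ω := measurable_pi_iff.mpr hX
  have hjoint : P.map (fun ω => ((fun i => z i ω), (fun i => X i ω))) =
      (P.map fun ω (i : ℕ) => z i ω).prod (Measure.infinitePi fun _ : ℕ => μ) := by
    rw [(indepFun_iff_map_prod_eq_prod_map_map hzm.aemeasurable hXm.aemeasurable).mp hzX,
      (iIndepFun_iff_map_fun_eq_infinitePi_map₀ hXm.aemeasurable).mp hind]
    simp_rw [hlaw]
  have hstep : ∀ N : ℕ, P {ω | ∀ i ∈ Finset.range N, (z i ω, X i ω) ∉ B} =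
      ∫⁻ ω, ∏ i ∈ Finset.range N, (1 - μ (Prod.mk (z i ω) ⁻¹' B)) ∂P := by
    intro N
    set S : Set ((ℕ → E) × (ℕ → M)) := {q | ∀ i ∈ Finset.range N, (q.1 i, q.2 i) ∉ B} with hS
    have hSm : MeasurableSet S := by
      have : S = ⋂ i ∈ Finset.range N, {q | (q.1 i, q.2 i) ∈ Bᶜ} := by
        ext q
        simp [hS]
      rw [this]
      refine Finset.measurableSet_biInter _ fun i _ => ?_
      have hm : Measurable fun q : (ℕ → E) × (ℕ → M) => (q.1 i, q.2 i) := by fun_prop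
      exact hm hB.compl
    have h1 : P {ω | ∀ i ∈ Finset.range N, (z i ω, X i ω) ∉ B} =
        P.map (fun ω => ((fun i => z i ω), (fun i => X i ω))) S := by
      rw [Measure.map_apply (hzm.prodMk hXm) hSm]
      rfl
    have hsec : Measurable fun e => μ (Prod.mk e ⁻¹' B) := measurable_measure_prodMk_left hB
    rw [h1, hjoint, Measure.prod_apply hSm, lintegral_map (measurable_measure_prodMk_left hSm) hzm]
    refine lintegral_congr fun ω => ?_
    have : Prod.mk (fun i => z i ω) ⁻¹' S =
        Set.pi (Finset.range N : Finset ℕ) fun i => (Prod.mk (z i ω) ⁻¹' B)ᶜ := by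
      ext b
      simp [hS, Set.mem_pi]
    rw [this, Measure.infinitePi_pi]
    · refine Finset.prod_congr rfl fun i _ => ?_
      rw [prob_compl_eq_one_sub (measurable_prodMk_left hB)]
    · exact fun i _ => (measurable_prodMk_left hB).compl
  have hlim := h.tendsto_lintegral_prod (f := fun e => μ (Prod.mk e ⁻¹' B))
    (measurable_measure_prodMk_left hB) (fun e => prob_le_one) (by rwa [← Measure.prod_apply hB])
  rw [← Measure.prod_apply hB] at hlim
  refine tendsto_nhds_unique ?_ hlim
  simp_rw [← hstep]
  have hinter : {ω | ∀ i, (z i ω, X i ω) ∉ B} =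
      ⋂ N : ℕ, {ω | ∀ i ∈ Finset.range N, (z i ω, X i ω) ∉ B} := by
    ext ω
    simp only [Set.mem_ofPred_eq, Set.mem_iInter, Finset.mem_range]
    exact ⟨fun h N i _ => h i, fun h i => h (i + 1) i (Nat.lt_succ_self i)⟩
  rw [hinter]
  refine tendsto_measure_iInter_atTop (fun N => ?_) ?_ ⟨0, measure_ne_top _ _⟩
  · have : {ω | ∀ i ∈ Finset.range N, (z i ω, X i ω) ∉ B} =
        ⋂ i ∈ Finset.range N, (fun ω => (z i ω, X i ω)) ⁻¹' Bᶜ := by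
      ext ω
      simp
    rw [this]
    exact (Finset.measurableSet_biInter _ fun i _ =>
      ((h.measurable i).prodMk (hX i)) hB.compl).nullMeasurableSet
  · exact fun m n hmn ω hω i hi => hω i (Finset.range_mono hmn hi)

/-- The mean measure of an independently marked Poisson point process. -/
theorem tsum_measure_marked [IsProbabilityMeasure P] [SigmaFinite Λ]
    (h : IsPoissonPointProcess P Λ z) {X : ℕ → Ω → M} {μ : Measure M} [IsProbabilityMeasure μ]
    (hX : ∀ i, Measurable (X i)) (hlaw : ∀ i, P.map (X i) = μ)
    (hzX : IndepFun (fun ω (i : ℕ) => z i ω) (fun ω (i : ℕ) => X i ω) P)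
    {B : Set (E × M)} (hB : MeasurableSet B) :
    ∑' i, P {ω | (z i ω, X i ω) ∈ B} = (Λ.prod μ) B := by
  have hi : ∀ i, P {ω | (z i ω, X i ω) ∈ B} = ((P.map (z i)).prod μ) B := by
    intro i
    have hind : IndepFun (z i) (X i) P :=
      hzX.comp (measurable_pi_apply i) (measurable_pi_apply i)
    rw [← hlaw i, ← (indepFun_iff_map_prod_eq_prod_map_map (h.measurable i).aemeasurable
      (hX i).aemeasurable).mp hind, Measure.map_apply ((h.measurable i).prodMk (hX i)) hB]
    rfl
  simp_rw [hi]
  rw [← Measure.sum_apply _ hB, ← Measure.prod_sum_left, h.sum_map_eq]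

end IsPoissonPointProcess

theorem poissonMeasure_two_le (r : ℝ≥0) :
    poissonMeasure r {k | 2 ≤ k} ≤ ENNReal.ofReal (r ^ 2) := by
  have hc : {k : ℕ | 2 ≤ k} = ({0, 1} : Set ℕ)ᶜ := by
    ext k
    simp only [Set.mem_ofPred_eq, Set.mem_compl_iff, Set.mem_insert_iff, Set.mem_singleton_iff]
    omega
  have h01 : (poissonMeasure r).real {0, 1} = Real.exp (-r) * (1 + r) := by
    rw [Set.insert_eq, measureReal_union (by simp) (measurableSet_singleton _),
      poissonMeasure_real_singleton, poissonMeasure_real_singleton]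
    simp
    ring
  rw [hc, ← ofReal_measureReal, probReal_compl_eq_one_sub (Set.toFinite _).measurableSet, h01]
  refine ENNReal.ofReal_le_ofReal ?_
  have h1 := Real.add_one_le_exp (-(r : ℝ))
  nlinarith [r.2]

/-- The times of a Poisson point process with intensity `κ ⊗ dt` are almost surely distinct: two
points with equal times lie in a common slot of duration `1 / m`, and the expected number of such
slots with at least two points tends to `0`. -/
theorem IsPoissonPointProcess.ae_injective_snd [IsProbabilityMeasure P] {κ : Measure E}
    [SigmaFinite κ] {z : ℕ → Ω → E × ℝ} (h : IsPoissonPointProcess P (κ.prod volume) z) :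
    ∀ᵐ ω ∂P, ∀ i j, i ≠ j → (z i ω).2 ≠ (z j ω).2 := by
  set Bad : ℕ → Set Ω := fun n => {ω | ∃ i j, i ≠ j ∧ (z i ω).2 = (z j ω).2 ∧
    (z i ω).1 ∈ spanningSets κ n ∧ (z j ω).1 ∈ spanningSets κ n ∧
    (z i ω).2 ∈ Set.Ico (-n : ℝ) n} with hBad
  suffices hz : ∀ n, P (Bad n) = 0 by
    have := measure_iUnion_null hz
    rw [← compl_mem_ae_iff] at this
    filter_upwards [this] with ω hω i j hij heq
    apply hω
    obtain ⟨n1, hn1⟩ := Set.mem_iUnion.mp ((iUnion_spanningSets κ).symm ▸ Set.mem_univ (z i ω).1)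
    obtain ⟨n2, hn2⟩ := Set.mem_iUnion.mp ((iUnion_spanningSets κ).symm ▸ Set.mem_univ (z j ω).1)
    obtain ⟨n3, hn3⟩ := exists_nat_gt |(z i ω).2|
    have hmono := monotone_spanningSets κ
    refine Set.mem_iUnion.mpr ⟨max n1 (max n2 n3), i, j, hij, heq,
      hmono (le_max_left _ _) hn1, hmono ((le_max_left _ _).trans (le_max_right _ _)) hn2, ?_⟩
    have hle : (n3 : ℝ) ≤ (max n1 (max n2 n3) : ℕ) := by
      exact_mod_cast (le_max_right _ _).trans (le_max_right _ _)
    obtain ⟨h1, h2⟩ := abs_lt.mp hn3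
    constructor <;> linarith
  intro n
  set a := (κ (spanningSets κ n)).toReal with ha
  have hfin := (measure_spanningSets_lt_top κ n).ne
  have hbound : ∀ m : ℕ, 0 < m → P (Bad n) ≤ ENNReal.ofReal (2 * n * a ^ 2 / m) := by
    intro m hm
    have hm' : (0 : ℝ) < m := by exact_mod_cast hm
    -- the period `[-n, n)` is divided into `2 n m` slots
    set slot : ℕ → Set ℝ := fun k => Set.Ico (-n + k / m : ℝ) (-n + (k + 1) / m) with hslot
    have hcov : Bad n ⊆ ⋃ k ∈ Finset.range (2 * n * m),
        {ω | 2 ≤ pointCount z (spanningSets κ n ×ˢ slot k) ω} := by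
      rintro ω ⟨i, j, hij, heq, hi, hj, hti⟩
      set k := ⌊((z i ω).2 + n) * m⌋₊ with hk
      have hnn : 0 ≤ ((z i ω).2 + n) * m := mul_nonneg (by linarith [hti.1]) hm'.le
      have hin : (z i ω).2 ∈ slot k := by
        constructor
        · have := Nat.floor_le hnn
          rw [← hk, ← div_le_iff₀ hm'] at this
          linarith
        · have := Nat.lt_floor_add_one (((z i ω).2 + n) * m)
          rw [← hk, ← lt_div_iff₀ hm'] at this
          linarith
      refine Set.mem_biUnion (x := k) ?_ ?_
      · rw [Finset.coe_range, Set.mem_Iio, Nat.floor_lt hnn]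
        push_cast
        have := hti.2
        nlinarith
      · change 2 ≤ pointCount z (spanningSets κ n ×ˢ slot k) ω
        have : 1 < pointCount z (spanningSets κ n ×ˢ slot k) ω :=
          Set.one_lt_encard_iff.mpr ⟨i, j, ⟨hi, hin⟩, ⟨hj, heq ▸ hin⟩, hij⟩
        exact Order.add_one_le_of_lt this
    have hslotm : ∀ k, (κ.prod volume) (spanningSets κ n ×ˢ slot k) = ENNReal.ofReal (a / m) := by
      intro k
      rw [Measure.prod_prod, hslot, Real.volume_Ico, ← ENNReal.ofReal_toReal hfin, ← ha,
        ← ENNReal.ofReal_mul ENNReal.toReal_nonneg]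
      congr 1
      field_simp
      ring
    have hP : ∀ k, P {ω | 2 ≤ pointCount z (spanningSets κ n ×ˢ slot k) ω} ≤
        ENNReal.ofReal ((a / m) ^ 2) := by
      intro k
      have hmB : MeasurableSet (spanningSets κ n ×ˢ slot k) :=
        (measurableSet_spanningSets κ n).prod measurableSet_Ico
      have hne : (κ.prod volume) (spanningSets κ n ×ˢ slot k) ≠ ∞ := by
        rw [hslotm]
        exact ENNReal.ofReal_ne_top
      have h1 : P {ω | 2 ≤ pointCount z (spanningSets κ n ×ˢ slot k) ω} =
          P.map (pointCount z (spanningSets κ n ×ˢ slot k)) {k | 2 ≤ k} := by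
        rw [Measure.map_apply (measurable_pointCount h.measurable hmB) (by measurability)]
        rfl
      rw [h1, h.poisson _ hmB hne, Measure.map_apply (by fun_prop) (by measurability)]
      have h2 : (fun k : ℕ => (k : ℕ∞)) ⁻¹' {k | 2 ≤ k} = {k | 2 ≤ k} := by
        ext k
        simp only [Set.mem_preimage, Set.mem_ofPred_eq]
        exact_mod_cast Iff.rfl
      rw [h2]
      refine (poissonMeasure_two_le _).trans_eq ?_
      rw [hslotm]
      congr 2
      exact ENNReal.toReal_ofReal (by positivity)
    calc P (Bad n) ≤ ∑ k ∈ Finset.range (2 * n * m),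
          P {ω | 2 ≤ pointCount z (spanningSets κ n ×ˢ slot k) ω} :=
          (measure_mono hcov).trans (measure_biUnion_finset_le _ _)
      _ ≤ ∑ _k ∈ Finset.range (2 * n * m), ENNReal.ofReal ((a / m) ^ 2) :=
          Finset.sum_le_sum fun k _ => hP k
      _ = ENNReal.ofReal (2 * n * a ^ 2 / m) := by
          rw [Finset.sum_const, Finset.card_range, nsmul_eq_mul, ← ENNReal.ofReal_natCast,
            ← ENNReal.ofReal_mul (by positivity)]
          congr 1
          push_cast
          field_simp
  have hlim : Tendsto (fun m : ℕ => ENNReal.ofReal (2 * n * a ^ 2 / m)) atTop (𝓝 0) := by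
    have := (tendsto_const_div_atTop_nhds_zero_nat (2 * n * a ^ 2 : ℝ))
    simpa using ENNReal.tendsto_ofReal this
  exact le_antisymm (ge_of_tendsto hlim ((eventually_gt_atTop 0).mono hbound)) zero_le

end Poisson

/-! ### Chains of leaves in a time-homogeneous Poisson process -/

section Chain

variable {Ω L : Type*}

/-- The properties of a Poisson process of marked times with intensity `κ ⊗ dt` that are used
below: its void probabilities, its mean measure, and the absence of simultaneous points. -/
structure IsMarkedPoisson [MeasurableSpace Ω] [MeasurableSpace L] (P : Measure Ω)
    (κ : Measure L) (c : ℕ → Ω → L × ℝ) : Prop where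
  measurable : ∀ i, Measurable (c i)
  void : ∀ B : Set (L × ℝ), MeasurableSet B → (κ.prod volume) B ≠ ∞ →
    P {ω | ∀ i, c i ω ∉ B} = ENNReal.ofReal (Real.exp (-((κ.prod volume) B).toReal))
  mean : ∀ B : Set (L × ℝ), MeasurableSet B → ∑' i, P {ω | c i ω ∈ B} = (κ.prod volume) B
  injective : ∀ᵐ ω ∂P, ∀ i j, i ≠ j → (c i ω).2 ≠ (c j ω).2

/-- `Chain W U c n b` holds if, looking backwards from the time `b`, the first point of the
configuration `c` with mark in `U (n - 1)` has its mark in `W (n - 1)`, from this point on the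
first point with mark in `U (n - 2)` has its mark in `W (n - 2)`, and so on. -/
def Chain (W U : ℕ → Set L) (c : ℕ → L × ℝ) : ℕ → ℝ → Prop
  | 0, _ => True
  | n + 1, b => ∃ i, (c i).2 < b ∧ (c i).1 ∈ W n ∧
      (∀ k, (c i).2 < (c k).2 → (c k).2 < b → (c k).1 ∉ U n) ∧ Chain W U c n (c i).2

variable {W U : ℕ → Set L}

theorem measurableSet_chain [MeasurableSpace L] (hW : ∀ n, MeasurableSet (W n))
    (hU : ∀ n, MeasurableSet (U n)) (n : ℕ) :
    MeasurableSet {q : (ℕ → L × ℝ) × ℝ | Chain W U q.1 n q.2} := by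
  induction n with
  | zero => simp [Chain]
  | succ n ih =>
    simp only [Chain, Set.ofPred_exists, Set.ofPred_and, Set.ofPred_forall]
    have ht : ∀ i, Measurable fun q : (ℕ → L × ℝ) × ℝ => (q.1 i).2 := fun i => by fun_prop
    have hl : ∀ i, Measurable fun q : (ℕ → L × ℝ) × ℝ => (q.1 i).1 := fun i => by fun_prop
    refine MeasurableSet.iUnion fun i => ((measurableSet_lt (ht i) measurable_snd).inter
      ((hl i (hW n)).inter (MeasurableSet.inter (MeasurableSet.iInter fun k => ?_) ?_)))
    · have : {q : (ℕ → L × ℝ) × ℝ | (q.1 i).2 < (q.1 k).2 → (q.1 k).2 < q.2 → (q.1 k).1 ∉ U n} =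
          ({q | (q.1 i).2 < (q.1 k).2} ∩ ({q | (q.1 k).2 < q.2} ∩ {q | (q.1 k).1 ∈ U n}))ᶜ := by
        ext q
        simp
      rw [this]
      exact ((measurableSet_lt (ht i) (ht k)).inter
        ((measurableSet_lt (ht k) measurable_snd).inter (hl k (hU n)))).compl
    · have hm : Measurable fun q : (ℕ → L × ℝ) × ℝ => (q.1, (q.1 i).2) := by fun_prop
      exact hm ih

/-- A period without points with marks in the sets `U l` can be skipped. -/
theorem chain_congr {c : ℕ → L × ℝ} (hWU : ∀ n, W n ⊆ U n) {n : ℕ} {b b' : ℝ} (hb : b' ≤ b)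
    (hno : ∀ l < n, ∀ j, b' ≤ (c j).2 → (c j).2 < b → (c j).1 ∉ U l) :
    Chain W U c n b ↔ Chain W U c n b' := by
  cases n with
  | zero => rfl
  | succ n =>
    have hno' := hno n (Nat.lt_succ_self n)
    constructor
    · rintro ⟨i, hi, hiW, hk, hc⟩
      refine ⟨i, ?_, hiW, fun k h1 h2 => hk k h1 (h2.trans_le hb), hc⟩
      by_contra! h
      exact hno' i h hi (hWU n hiW)
    · rintro ⟨i, hi, hiW, hk, hc⟩
      refine ⟨i, hi.trans_le hb, hiW, fun k h1 h2 => ?_, hc⟩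
      rcases lt_or_ge (c k).2 b' with h | h
      · exact hk k h1 h
      · exact hno' k h h2

/-- The points of the slot number `k` before `b`, of duration `δ`, with mark in `A`, together with
all later points before `b` with mark in `B`. -/
def slotSet (A B : Set L) (b δ : ℝ) (k : ℕ) : Set (L × ℝ) :=
  A ×ˢ Set.Ico (b - (k + 1) * δ) (b - k * δ) ∪ B ×ˢ Set.Ico (b - k * δ) b

/-- Discretization of a chain: when `δ` is small, the last point before `b` with mark in `U n` is
the only one in its slot. -/
theorem eventually_slot_iff_chain {c : ℕ → L × ℝ} (hWU : ∀ n, W n ⊆ U n) (hmono : Monotone U)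
    {n : ℕ} {b : ℝ} (hinj : ∀ i j, i ≠ j → (c i).2 ≠ (c j).2)
    (hfin : ∀ T : ℝ, {i | (c i).1 ∈ U n ∧ (c i).2 ∈ Set.Ico T b}.Finite)
    (hne : ∃ i, (c i).1 ∈ U n ∧ (c i).2 < b) :
    ∀ᶠ δ : ℝ in 𝓝[>] 0, (∃ k : ℕ, ((∀ i, c i ∉ slotSet (U n \ W n) (U n) b δ k) ∧
      ¬ ∀ i, c i ∉ slotSet (U n) (U n) b δ k) ∧ Chain W U c n (b - (k + 1) * δ)) ↔
      Chain W U c (n + 1) b := by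
  obtain ⟨i0, hi0U, hi0b⟩ := hne
  obtain ⟨m, ⟨hmU, hm0, hmb⟩, hmax⟩ :=
    Set.exists_max_image _ (fun i => (c i).2) (hfin (c i0).2) ⟨i0, hi0U, le_rfl, hi0b⟩
  replace hmax : ∀ j, (c j).1 ∈ U n → (c j).2 < b → (c j).2 ≤ (c m).2 := by
    intro j hj hjb
    rcases le_total (c i0).2 (c j).2 with h | h
    · exact hmax j ⟨hj, h, hjb⟩
    · exact h.trans hm0
  have hgap : ∀ᶠ δ : ℝ in 𝓝[>] 0, ∀ j, (c j).1 ∈ U n → (c j).2 < b → j ≠ m →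
      (c j).2 < (c m).2 - δ := by
    have h1 : ∀ᶠ δ : ℝ in 𝓝[>] 0, ∀ j ∈ {i | (c i).1 ∈ U n ∧ (c i).2 ∈ Set.Ico ((c m).2 - 1) b},
        j ≠ m → (c j).2 < (c m).2 - δ := by
      refine (eventually_all_finite (hfin _)).mpr fun j hj => ?_
      by_cases hjm : j = m
      · simp [hjm]
      have hlt : (c j).2 < (c m).2 := lt_of_le_of_ne (hmax j hj.1 hj.2.2) (hinj j m hjm)
      filter_upwards [Ioo_mem_nhdsGT (sub_pos.mpr hlt)] with δ hδ _
      linarith [hδ.2]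
    filter_upwards [h1, Ioo_mem_nhdsGT (zero_lt_one (α := ℝ))] with δ h1 hδ j hjU hjb hjm
    rcases le_or_gt ((c m).2 - 1) (c j).2 with h | h
    · exact h1 j ⟨hjU, h, hjb⟩ hjm
    · linarith [hδ.2]
  filter_upwards [hgap, self_mem_nhdsWithin] with δ hgap hδ
  replace hδ : 0 < δ := hδ
  constructor
  · rintro ⟨k, ⟨hvoid, hnvoid⟩, hc⟩
    have hslot : b - (k + 1) * δ ≤ (c m).2 := by
      push Not at hnvoid
      obtain ⟨j, ⟨hjU, hj⟩ | ⟨hjU, hj⟩⟩ := hnvoid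
      · exact hj.1.trans (hmax j hjU (by have := hj.2; nlinarith [k.cast_nonneg (α := ℝ)]))
      · exact le_trans (by nlinarith) (hj.1.trans (hmax j hjU hj.2))
    have hslot' : (c m).2 < b - k * δ := by
      by_contra! h
      exact hvoid m (Or.inr ⟨hmU, h, hmb⟩)
    refine ⟨m, hmb, ?_, fun j h1 h2 hj => (hmax j hj h2).not_gt h1, ?_⟩
    · by_contra hW
      exact hvoid m (Or.inl ⟨⟨hmU, hW⟩, hslot, hslot'⟩)
    · refine (chain_congr hWU hslot fun l hl j h1 h2 hj => ?_).mpr hc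
      have := hgap j (hmono hl.le hj) (h2.trans hmb) (by rintro rfl; exact h2.false)
      linarith
  · rintro ⟨i, hib, hiW, hk, hc⟩
    obtain rfl : i = m := by
      by_contra him
      exact hk m (lt_of_le_of_ne (hmax i (hWU n hiW) hib) (hinj i m him)) hmb hmU
    obtain ⟨k, hk1, hk2⟩ : ∃ k : ℕ, k * δ < b - (c i).2 ∧ b - (c i).2 ≤ (k + 1) * δ := by
      have hpos : 0 < (b - (c i).2) / δ := div_pos (by linarith) hδ
      refine ⟨⌈(b - (c i).2) / δ⌉₊ - 1, ?_, ?_⟩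
      · rw [← lt_div_iff₀ hδ]
        exact Nat.lt_ceil.mp (Nat.sub_lt (Nat.ceil_pos.mpr hpos) one_pos)
      · rw [← div_le_iff₀ hδ, Nat.cast_sub (Nat.ceil_pos.mpr hpos)]
        simpa using Nat.le_ceil ((b - (c i).2) / δ)
    refine ⟨k, ⟨?_, ?_⟩, ?_⟩
    · rintro j (⟨hjU, hj1, hj2⟩ | ⟨hjU, hj1, hj2⟩)
      · have hji : j ≠ i := by
          rintro rfl
          exact hjU.2 hiW
        have hjb : (c j).2 < b := by nlinarith [k.cast_nonneg (α := ℝ)]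
        have := hgap j hjU.1 hjb hji
        linarith
      · have := hmax j hjU hj2
        linarith
    · intro hv
      exact hv i (Or.inl ⟨hmU, by linarith, by linarith⟩)
    · refine (chain_congr hWU (by linarith) fun l hl j h1 h2 hj => ?_).mp hc
      have := hgap j (hmono hl.le hj) (h2.trans hmb) (by rintro rfl; exact h2.false)
      linarith

/-- The ratio is the conditional probability, given that a slot of duration `δ` contains a point
with mark in `U`, that it contains none with mark in `U \ W`, when the measures of `U` and `W ⊆ U`
are `u` and `w`. -/
theorem tendsto_slot_ratio {u w : ℝ} (hu : 0 < u) :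
    Tendsto (fun δ => (Real.exp (-((u - w) * δ)) - Real.exp (-(u * δ))) / (1 - Real.exp (-(u * δ))))
      (𝓝[>] 0) (𝓝 (w / u)) := by
  have hder : ∀ a : ℝ, Tendsto (fun δ : ℝ => (1 - Real.exp (-(a * δ))) / δ) (𝓝[>] 0) (𝓝 a) := by
    intro a
    have h1 : HasDerivAt (fun δ : ℝ => 1 - Real.exp (-(a * δ))) a 0 := by
      have h2 : HasDerivAt (fun δ : ℝ => -(a * δ)) (-a) 0 := by
        simpa using (hasDerivAt_id (0 : ℝ)).const_mul (-a)
      simpa using (h2.exp).const_sub 1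
    have := h1.tendsto_slope_zero_right
    refine this.congr fun δ => ?_
    simp [div_eq_inv_mul]
  have h := ((hder u).sub (hder (u - w))).div (hder u) hu.ne'
  rw [sub_sub_cancel] at h
  refine h.congr' ?_
  filter_upwards [self_mem_nhdsWithin] with δ hδ
  have hδ' : δ ≠ 0 := ne_of_gt hδ
  simp only [Pi.div_apply]
  rw [← sub_div, div_div_div_cancel_right₀ hδ']
  ring_nf

namespace IsMarkedPoisson

variable [MeasurableSpace Ω] [MeasurableSpace L] {P : Measure Ω} {κ : Measure L}
  {c : ℕ → Ω → L × ℝ}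

theorem measurableSet_void (h : IsMarkedPoisson P κ c) {B : Set (L × ℝ)} (hB : MeasurableSet B) :
    MeasurableSet {ω | ∀ i, c i ω ∉ B} := by
  rw [Set.ofPred_forall]
  exact MeasurableSet.iInter fun i => h.measurable i hB.compl

theorem void_union (h : IsMarkedPoisson P κ c) {B B' : Set (L × ℝ)} (hB : MeasurableSet B)
    (hB' : MeasurableSet B') (hd : Disjoint B B') (hf : (κ.prod volume) B ≠ ∞)
    (hf' : (κ.prod volume) B' ≠ ∞) :
    P {ω | ∀ i, c i ω ∉ B ∪ B'} = P {ω | ∀ i, c i ω ∉ B} * P {ω | ∀ i, c i ω ∉ B'} := by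
  have hm := measure_union (μ := κ.prod volume) hd hB'
  have hne : (κ.prod volume) (B ∪ B') ≠ ∞ := by
    rw [hm]
    exact ENNReal.add_ne_top.mpr ⟨hf, hf'⟩
  rw [h.void _ (hB.union hB') hne, h.void _ hB hf, h.void _ hB' hf', hm,
    ENNReal.toReal_add hf hf', ← ENNReal.ofReal_mul (Real.exp_pos _).le, ← Real.exp_add]
  congr 2
  ring

theorem ae_finite (h : IsMarkedPoisson P κ c) {B : Set (L × ℝ)} (hB : MeasurableSet B)
    (hf : (κ.prod volume) B ≠ ∞) : ∀ᵐ ω ∂P, {i | c i ω ∈ B}.Finite := by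
  refine ae_finite_setOfPred_mem (s := fun i => {ω | c i ω ∈ B}) ?_
  rwa [h.mean B hB]

theorem ae_forall_notMem (h : IsMarkedPoisson P κ c) {B : Set (L × ℝ)} (hB : MeasurableSet B)
    (hf : (κ.prod volume) B = 0) : ∀ᵐ ω ∂P, ∀ i, c i ω ∉ B := by
  rw [ae_all_iff]
  intro i
  have := h.mean B hB
  rw [hf, ENNReal.tsum_eq_zero] at this
  exact measure_eq_zero_iff_ae_notMem.mp (this i)

theorem ae_finite_window (h : IsMarkedPoisson P κ c) {A : Set L} (hA : MeasurableSet A)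
    (hf : κ A ≠ ∞) (b : ℝ) :
    ∀ᵐ ω ∂P, ∀ T : ℝ, {i | (c i ω).1 ∈ A ∧ (c i ω).2 ∈ Set.Ico T b}.Finite := by
  have : ∀ᵐ ω ∂P, ∀ N : ℕ, {i | c i ω ∈ A ×ˢ Set.Ico (-N : ℝ) b}.Finite := by
    rw [ae_all_iff]
    intro N
    refine h.ae_finite (hA.prod measurableSet_Ico) ?_
    rw [Measure.prod_prod]
    exact ENNReal.mul_ne_top hf (by simp)
  filter_upwards [this] with ω hω T
  obtain ⟨N, hN⟩ := exists_nat_gt (-T)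
  refine (hω N).subset ?_
  rintro i ⟨h1, h2, h3⟩
  exact ⟨h1, by linarith, h3⟩

theorem ae_exists_lt (h : IsMarkedPoisson P κ c) {A : Set L} (hA : MeasurableSet A)
    (hf : κ A ≠ ∞) (h0 : κ A ≠ 0) (b : ℝ) :
    ∀ᵐ ω ∂P, ∃ i, (c i ω).1 ∈ A ∧ (c i ω).2 < b := by
  have hpos : 0 < (κ A).toReal := ENNReal.toReal_pos h0 hf
  have hle : ∀ N : ℕ, P {ω | ¬ ∃ i, (c i ω).1 ∈ A ∧ (c i ω).2 < b} ≤
      ENNReal.ofReal (Real.exp (-((κ A).toReal * N))) := by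
    intro N
    have hm : (κ.prod volume) (A ×ˢ Set.Ico (b - N) b) = κ A * N := by
      rw [Measure.prod_prod, Real.volume_Ico]
      simp
    have hne : (κ.prod volume) (A ×ˢ Set.Ico (b - N) b) ≠ ∞ := by
      rw [hm]
      exact ENNReal.mul_ne_top hf (ENNReal.natCast_ne_top N)
    have hv := h.void _ (hA.prod measurableSet_Ico) hne
    rw [hm, ENNReal.toReal_mul, ENNReal.toReal_natCast] at hv
    rw [← hv]
    refine measure_mono fun ω hω i hi => hω ⟨i, hi.1, hi.2.2⟩
  have hlim : Tendsto (fun N : ℕ => ENNReal.ofReal (Real.exp (-((κ A).toReal * N)))) atTop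
      (𝓝 0) := by
    rw [← ENNReal.ofReal_zero]
    exact ENNReal.tendsto_ofReal (Real.tendsto_exp_neg_atTop_nhds_zero.comp
      (tendsto_natCast_atTop_atTop.const_mul_atTop hpos))
  exact le_antisymm (ge_of_tendsto' hlim hle) zero_le

/-- The probability of a chain, jointly with an event `F` that is independent of the points before
the time `b`. The product structure comes from the slots: the chain of length `n + 1` starts in the
slot that contains the last point with mark in `U n`, and the points of this slot and of the later
ones are independent of the rest of the chain. -/
theorem measure_inter_chain [IsProbabilityMeasure P] (h : IsMarkedPoisson P κ c)
    (hW : ∀ n, MeasurableSet (W n)) (hU : ∀ n, MeasurableSet (U n)) (hWU : ∀ n, W n ⊆ U n)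
    (hmono : Monotone U) (hf : ∀ n, κ (U n) ≠ ∞) (h0 : ∀ n, κ (U n) ≠ 0) (n : ℕ) :
    ∀ (b : ℝ) (F : Set Ω), MeasurableSet F →
      (∀ B, MeasurableSet B → B ⊆ {q | q.2 < b} → (κ.prod volume) B ≠ ∞ →
        P (F ∩ {ω | ∀ i, c i ω ∉ B}) = P F * P {ω | ∀ i, c i ω ∉ B}) →
      P (F ∩ {ω | Chain W U (fun i => c i ω) n b}) =
        P F * ∏ j ∈ Finset.range n, κ (W j) / κ (U j) := by
  have hchm : ∀ n b, MeasurableSet {ω | Chain W U (fun i => c i ω) n b} := by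
    intro n b
    have hm : Measurable fun ω => ((fun i => c i ω), b) :=
      (measurable_pi_iff.mpr h.measurable).prodMk measurable_const
    exact hm (measurableSet_chain hW hU n)
  induction n with
  | zero => simp [Chain]
  | succ n ih =>
    intro b F hF hFind
    set u := (κ (U n)).toReal with hu
    set w := (κ (W n)).toReal with hw
    have hfW : κ (W n) ≠ ∞ := ne_top_of_le_ne_top (hf n) (measure_mono (hWU n))
    have hu0 : 0 < u := ENNReal.toReal_pos (h0 n) (hf n)
    have hwu : w ≤ u := ENNReal.toReal_mono (hf n) (measure_mono (hWU n))
    have hw0 : 0 ≤ w := ENNReal.toReal_nonneg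
    have hUW : κ (U n \ W n) = ENNReal.ofReal (u - w) := by
      rw [measure_sdiff (hWU n) (hW n).nullMeasurableSet hfW, ENNReal.ofReal_sub _ hw0,
        ENNReal.ofReal_toReal (hf n), ENNReal.ofReal_toReal hfW]
    have hUu : κ (U n) = ENNReal.ofReal u := (ENNReal.ofReal_toReal (hf n)).symm
    -- the measures of the sets of points that define the events of the slots
    have hslot : ∀ (A : Set L) (a δ : ℝ) (k : ℕ), MeasurableSet A → κ A = ENNReal.ofReal a →
        0 ≤ a → 0 < δ → MeasurableSet (slotSet A (U n) b δ k) ∧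
        (κ.prod volume) (slotSet A (U n) b δ k) = ENNReal.ofReal (a * δ + u * (k * δ)) := by
      intro A a δ k hA ha ha0 hδ
      refine ⟨(hA.prod measurableSet_Ico).union ((hU n).prod measurableSet_Ico), ?_⟩
      rw [slotSet, measure_union _ ((hU n).prod measurableSet_Ico), Measure.prod_prod,
        Measure.prod_prod, Real.volume_Ico, Real.volume_Ico, ha, hUu,
        ← ENNReal.ofReal_mul ha0, ← ENNReal.ofReal_mul hu0.le,
        ← ENNReal.ofReal_add (by ring_nf; positivity) (by ring_nf; positivity)]
      · congr 1
        ring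
      · refine Set.disjoint_left.mpr ?_
        rintro q ⟨-, hq⟩ ⟨-, hq'⟩
        exact absurd hq.2 (not_lt.mpr hq'.1)
    -- the slot `k` contains the last point with mark in `U n`, and the marks in `U n` of its points
    -- are all in `W n`
    set A : ℝ → ℕ → Set Ω := fun δ k => {ω | ∀ i, c i ω ∉ slotSet (U n \ W n) (U n) b δ k} \
      {ω | ∀ i, c i ω ∉ slotSet (U n) (U n) b δ k} with hAdef
    have hAm : ∀ δ k, 0 < δ → MeasurableSet (A δ k) := fun δ k hδ =>
      (h.measurableSet_void (hslot _ _ δ k ((hU n).diff (hW n)) hUW (by linarith) hδ).1).diff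
        (h.measurableSet_void (hslot _ _ δ k (hU n) hUu hu0.le hδ).1)
    have hsub : ∀ δ k, 0 < δ → slotSet (U n \ W n) (U n) b δ k ⊆ slotSet (U n) (U n) b δ k :=
      fun δ k hδ => Set.union_subset_union_left _ (Set.prod_mono Set.sdiff_subset le_rfl)
    have hltb : ∀ (A : Set L) δ k, 0 < δ → slotSet A (U n) b δ k ⊆ {q | q.2 < b} := by
      rintro A δ k hδ q (⟨-, hq⟩ | ⟨-, hq⟩)
      · have := hq.2
        have : (0 : ℝ) ≤ k * δ := by positivity
        simp only [Set.mem_ofPred_eq]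
        linarith [hq.2]
      · exact hq.2
    -- the event of a slot is independent of the points before the slot
    have hAind : ∀ (δ : ℝ) (k : ℕ), 0 < δ → ∀ B, MeasurableSet B →
        B ⊆ {q | q.2 < b - (k + 1) * δ} → (κ.prod volume) B ≠ ∞ →
        P (F ∩ A δ k ∩ {ω | ∀ i, c i ω ∉ B}) =
          P F * (P {ω | ∀ i, c i ω ∉ slotSet (U n \ W n) (U n) b δ k} -
            P {ω | ∀ i, c i ω ∉ slotSet (U n) (U n) b δ k}) * P {ω | ∀ i, c i ω ∉ B} := by
      intro δ k hδ B hB hBlt hBf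
      obtain ⟨hm1, he1⟩ := hslot _ _ δ k ((hU n).diff (hW n)) hUW (by linarith) hδ
      obtain ⟨hm2, he2⟩ := hslot _ _ δ k (hU n) hUu hu0.le hδ
      have hkδ : (0 : ℝ) ≤ k * δ := by positivity
      have hdisj : ∀ A : Set L, Disjoint (slotSet A (U n) b δ k) B := by
        intro A
        refine Set.disjoint_left.mpr ?_
        rintro q (⟨-, hq⟩ | ⟨-, hq⟩) hqB
        · exact absurd (hBlt hqB) (not_lt.mpr hq.1)
        · have h1 : q.2 < b - (k + 1) * δ := hBlt hqB
          have := hq.1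
          linarith
      have hone : ∀ A : Set L, MeasurableSet (slotSet A (U n) b δ k) →
          (κ.prod volume) (slotSet A (U n) b δ k) ≠ ∞ →
          P (F ∩ {ω | ∀ i, c i ω ∉ slotSet A (U n) b δ k ∪ B}) =
            P F * P {ω | ∀ i, c i ω ∉ slotSet A (U n) b δ k} * P {ω | ∀ i, c i ω ∉ B} := by
        intro A hm hfin
        rw [hFind _ (hm.union hB) (Set.union_subset (hltb A δ k hδ) ?_),
          h.void_union hm hB (hdisj A) hfin hBf, mul_assoc]
        · rw [measure_union (hdisj A) hB]
          exact ENNReal.add_ne_top.mpr ⟨hfin, hBf⟩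
        · intro q hq
          have h1 : q.2 < b - (k + 1) * δ := hBlt hq
          change q.2 < b
          linarith
      have hset : F ∩ A δ k ∩ {ω | ∀ i, c i ω ∉ B} =
          (F ∩ {ω | ∀ i, c i ω ∉ slotSet (U n \ W n) (U n) b δ k ∪ B}) \
          (F ∩ {ω | ∀ i, c i ω ∉ slotSet (U n) (U n) b δ k ∪ B}) := by
        ext ω
        simp only [hAdef, Set.mem_inter_iff, Set.mem_sdiff, Set.mem_ofPred_eq, Set.mem_union,
          not_or, forall_and]
        tauto
      rw [hset, measure_sdiff _ _ (measure_ne_top _ _), hone _ hm1 (by simp [he1]),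
        hone _ hm2 (by simp [he2]), ← ENNReal.sub_mul (fun _ _ => measure_ne_top _ _),
        ← ENNReal.mul_sub (fun _ _ => measure_ne_top _ _)]
      · refine Set.inter_subset_inter_right _ fun ω hω i hi => hω i ?_
        exact Set.union_subset_union_left _ (hsub δ k hδ) hi
      · exact (hF.inter (h.measurableSet_void (hm2.union hB))).nullMeasurableSet
    have hAP : ∀ δ k, 0 < δ → P (F ∩ A δ k) =
        P F * ENNReal.ofReal (Real.exp (-(u * δ)) ^ k *
          (Real.exp (-((u - w) * δ)) - Real.exp (-(u * δ)))) := by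
      intro δ k hδ
      obtain ⟨hm1, he1⟩ := hslot _ _ δ k ((hU n).diff (hW n)) hUW (by linarith) hδ
      obtain ⟨hm2, he2⟩ := hslot _ _ δ k (hU n) hUu hu0.le hδ
      have h1 := hAind δ k hδ ∅ MeasurableSet.empty (Set.empty_subset _) (by simp)
      simp only [Set.mem_empty_iff_false, not_false_eq_true, implies_true, Set.ofPred_true,
        Set.inter_univ, measure_univ, mul_one] at h1
      have hwu' : 0 ≤ u - w := by linarith
      rw [h1, h.void _ hm1 (by simp [he1]), h.void _ hm2 (by simp [he2]), he1, he2,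
        ← ENNReal.ofReal_sub _ (Real.exp_pos _).le, ENNReal.toReal_ofReal (by positivity),
        ENNReal.toReal_ofReal (by positivity), ← Real.exp_nat_mul, mul_sub, ← Real.exp_add,
        ← Real.exp_add]
      congr 4 <;> ring
    have hAdisj : ∀ δ, 0 < δ → Pairwise fun j k => Disjoint (A δ j) (A δ k) := by
      intro δ hδ
      have hlt : ∀ j k : ℕ, j < k → Disjoint (A δ j) (A δ k) := by
        intro j k hjk
        refine Set.disjoint_left.mpr ?_
        rintro ω ⟨-, hj⟩ ⟨hk, -⟩
        refine hj fun i hi => hk i ?_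
        have hjk' : ((j : ℝ) + 1) * δ ≤ k * δ := by
          have : (j : ℝ) + 1 ≤ k := by exact_mod_cast hjk
          gcongr
        have hj0 : (0 : ℝ) ≤ j * δ := by positivity
        rcases hi with ⟨hiU, h1, h2⟩ | ⟨hiU, h1, h2⟩
        · exact Or.inr ⟨hiU, by linarith, by linarith⟩
        · exact Or.inr ⟨hiU, by linarith, h2⟩
      intro j k hjk
      rcases lt_or_gt_of_ne hjk with h | h
      · exact hlt j k h
      · exact (hlt k j h).symm
    set E : ℝ → Set Ω := fun δ => ⋃ k : ℕ, A δ k ∩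
      {ω | Chain W U (fun i => c i ω) n (b - (k + 1) * δ)} with hE
    have hEm : ∀ δ, 0 < δ → MeasurableSet (E δ) := fun δ hδ =>
      MeasurableSet.iUnion fun k => (hAm δ k hδ).inter (hchm _ _)
    have hEP : ∀ δ, 0 < δ → P (F ∩ E δ) = P F * ENNReal.ofReal
        ((Real.exp (-((u - w) * δ)) - Real.exp (-(u * δ))) / (1 - Real.exp (-(u * δ)))) *
        ∏ j ∈ Finset.range n, κ (W j) / κ (U j) := by
      intro δ hδ
      rw [hE, Set.inter_iUnion, measure_iUnion]
      · have hk : ∀ k : ℕ, P (F ∩ (A δ k ∩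
            {ω | Chain W U (fun i => c i ω) n (b - (k + 1) * δ)})) =
            P F * ENNReal.ofReal (Real.exp (-(u * δ)) ^ k *
            (Real.exp (-((u - w) * δ)) - Real.exp (-(u * δ)))) *
            ∏ j ∈ Finset.range n, κ (W j) / κ (U j) := by
          intro k
          rw [← Set.inter_assoc, ih _ (F ∩ A δ k) (hF.inter (hAm δ k hδ)), hAP δ k hδ]
          intro B hB hBlt hBf
          rw [hAind δ k hδ B hB hBlt hBf]
          have h1 := hAind δ k hδ ∅ MeasurableSet.empty (Set.empty_subset _) (by simp)
          simp only [Set.mem_empty_iff_false, not_false_eq_true, implies_true, Set.ofPred_true,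
            Set.inter_univ, measure_univ, mul_one] at h1
          rw [h1]
        simp_rw [hk]
        have hq1 : Real.exp (-(u * δ)) < 1 := by
          rw [Real.exp_lt_one_iff]
          nlinarith
        have hnum : 0 ≤ Real.exp (-((u - w) * δ)) - Real.exp (-(u * δ)) := by
          rw [sub_nonneg, Real.exp_le_exp]
          nlinarith
        have hgeo := (hasSum_geometric_of_lt_one (Real.exp_pos _).le hq1).mul_right
          (Real.exp (-((u - w) * δ)) - Real.exp (-(u * δ)))
        rw [ENNReal.tsum_mul_right, ENNReal.tsum_mul_left,
          ← ENNReal.ofReal_tsum_of_nonneg (fun k => by positivity) hgeo.summable, hgeo.tsum_eq,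
          inv_mul_eq_div]
      · intro j k hjk
        exact (hAdisj δ hδ hjk).mono (Set.inter_subset_right.trans Set.inter_subset_left)
          (Set.inter_subset_right.trans Set.inter_subset_left)
      · exact fun k => hF.inter ((hAm δ k hδ).inter (hchm _ _))
    set d : ℕ → ℝ := fun m => 1 / ((m : ℝ) + 1) with hd
    have hd0 : ∀ m, 0 < d m := fun m => Nat.one_div_pos_of_nat
    have hdlim : Tendsto d atTop (𝓝[>] 0) :=
      tendsto_nhdsWithin_iff.mpr ⟨tendsto_one_div_add_atTop_nhds_zero_nat,
        Eventually.of_forall hd0⟩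
    have hlim1 : Tendsto (fun m => P (F ∩ E (d m))) atTop
        (𝓝 (P (F ∩ {ω | Chain W U (fun i => c i ω) (n + 1) b}))) := by
      refine tendsto_measure_of_ae_tendsto_indicator_of_isFiniteMeasure _
        (hF.inter (hchm _ _)) (fun m => hF.inter (hEm _ (hd0 m))) ?_
      filter_upwards [h.injective, h.ae_finite_window (hU n) (hf n) b,
        h.ae_exists_lt (hU n) (hf n) (h0 n) b] with ω h1 h2 h3
      have := hdlim.eventually (eventually_slot_iff_chain (c := fun i => c i ω) hWU hmono h1 h2 h3)
      filter_upwards [this] with m hm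
      simp only [Set.mem_inter_iff]
      refine and_congr_right fun _ => ?_
      rw [Set.mem_ofPred_eq, ← hm, hE, Set.mem_iUnion]
      rfl
    have hlim2 : Tendsto (fun m => P (F ∩ E (d m))) atTop (𝓝 (P F * ENNReal.ofReal (w / u) *
        ∏ j ∈ Finset.range n, κ (W j) / κ (U j))) := by
      simp_rw [hEP _ (hd0 _)]
      refine ENNReal.Tendsto.mul_const (ENNReal.Tendsto.const_mul (ENNReal.tendsto_ofReal
        ((tendsto_slot_ratio hu0).comp hdlim)) (Or.inr (measure_ne_top _ _))) (Or.inr ?_)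
      refine ENNReal.prod_ne_top fun j _ => (ENNReal.div_lt_top ?_ (h0 j)).ne
      exact ne_top_of_le_ne_top (hf j) (measure_mono (hWU j))
    rw [tendsto_nhds_unique hlim1 hlim2, Finset.prod_range_succ, ENNReal.ofReal_div_of_pos hu0,
      ENNReal.ofReal_toReal (hf n), ENNReal.ofReal_toReal hfW, mul_assoc,
      mul_comm (κ (W n) / κ (U n))]

theorem measure_chain [IsProbabilityMeasure P] (h : IsMarkedPoisson P κ c)
    (hW : ∀ n, MeasurableSet (W n)) (hU : ∀ n, MeasurableSet (U n)) (hWU : ∀ n, W n ⊆ U n)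
    (hmono : Monotone U) (hf : ∀ n, κ (U n) ≠ ∞) (h0 : ∀ n, κ (U n) ≠ 0) (n : ℕ) (b : ℝ) :
    P {ω | Chain W U (fun i => c i ω) n b} = ∏ j ∈ Finset.range n, κ (W j) / κ (U j) := by
  simpa using h.measure_inter_chain hW hU hWU hmono hf h0 n b Set.univ MeasurableSet.univ
    (by simp)

end IsMarkedPoisson

end Chain

/-! ### Leaves that hit or cover a compact set -/

section Leaves

/-- The translated leaves `(x, F)` for which the closure of the interior of `x + F` hits `K`. A leaf
of this kind is what prevents an older leaf from showing `K` in the interior of its visible part. -/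
def hitSet (K : Set Plane) : Set (Plane × Closeds Plane) :=
  {q | ∃ p ∈ K, p - q.1 ∈ closure (interior (q.2 : Set Plane))}

/-- The translated leaves `(x, F)` for which the interior of `x + F` contains `K`. -/
def coverSet (K : Set Plane) : Set (Plane × Closeds Plane) :=
  {q | ∀ p ∈ K, p - q.1 ∈ interior (q.2 : Set Plane)}

/-- The translated leaves `(x, F)` for which `p` lies on the boundary of `x + F`. -/
def boundarySet (p : Plane) : Set (Plane × Closeds Plane) :=
  {q | p - q.1 ∈ frontier (q.2 : Set Plane)}

theorem measurableSet_mem (y : Plane) :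
    MeasurableSet {F : Closeds Plane | y ∈ (F : Set Plane)} := by
  have : {F : Closeds Plane | y ∈ (F : Set Plane)} =
      {F : Closeds Plane | (F : Set Plane) ∩ {y} = ∅}ᶜ := by
    ext F
    simp
  rw [this]
  exact (measurableSet_miss isCompact_singleton).compl

theorem measurableSet_open_subset {O : Set Plane} (hO : IsOpen O) :
    MeasurableSet {F : Closeds Plane | O ⊆ (F : Set Plane)} := by
  have : {F : Closeds Plane | O ⊆ (F : Set Plane)} =
      ⋂ n : ℕ, {F : Closeds Plane | denseSeq Plane n ∈ O → denseSeq Plane n ∈ (F : Set Plane)} := by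
    ext F
    simp only [Set.mem_ofPred_eq, Set.mem_iInter]
    refine ⟨fun h n hn => h hn, fun h => ?_⟩
    have h1 : O ⊆ closure (O ∩ Set.range (denseSeq Plane)) :=
      (denseRange_denseSeq Plane).open_subset_closure_inter hO
    refine h1.trans (closure_minimal ?_ F.isClosed)
    rintro _ ⟨hn, n, rfl⟩
    exact h n hn
  rw [this]
  refine MeasurableSet.iInter fun n => ?_
  by_cases hn : denseSeq Plane n ∈ O
  · simpa [hn] using measurableSet_mem _
  · simp [hn]

theorem mem_interior_iff_countableBasis {S : Set Plane} {y : Plane} :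
    y ∈ interior S ↔ ∃ B : countableBasis Plane, y ∈ B.1 ∧ B.1 ⊆ S := by
  rw [mem_interior_iff_mem_nhds, (isBasis_countableBasis Plane).mem_nhds_iff]
  constructor
  · rintro ⟨B, hB, hy, hBS⟩
    exact ⟨⟨B, hB⟩, hy, hBS⟩
  · rintro ⟨B, hy, hBS⟩
    exact ⟨B.1, B.2, hy, hBS⟩

theorem measurableSet_coverSet {K : Set Plane} (hK : IsCompact K) : MeasurableSet (coverSet K) := by
  -- by compactness, finitely many basic open subsets of `F` suffice
  have hkey : coverSet K = ⋃ s : Finset (countableBasis Plane),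
      {x : Plane | ∀ p ∈ K, p - x ∈ ⋃ B ∈ s, B.1} ×ˢ
        {F : Closeds Plane | ∀ B ∈ s, B.1 ⊆ (F : Set Plane)} := by
    ext ⟨x, F⟩
    simp only [coverSet, Set.mem_ofPred_eq, Set.mem_iUnion, Set.mem_prod]
    constructor
    · intro h
      have hcov : K ⊆ ⋃ B : {B : countableBasis Plane // B.1 ⊆ (F : Set Plane)},
          (fun p => p - x) ⁻¹' B.1.1 := by
        intro p hp
        obtain ⟨B, hy, hB⟩ := mem_interior_iff_countableBasis.mp (h p hp)
        exact Set.mem_iUnion.mpr ⟨⟨B, hB⟩, hy⟩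
      obtain ⟨s, hs⟩ := hK.elim_finite_subcover _
        (fun B => ((isBasis_countableBasis Plane).isOpen B.1.2).preimage (by fun_prop)) hcov
      classical
      refine ⟨s.image Subtype.val, fun p hp => ?_, fun B hB => ?_⟩
      · obtain ⟨B, hB, hpB⟩ := Set.mem_iUnion₂.mp (hs hp)
        exact ⟨B.1, Finset.mem_image_of_mem _ hB, hpB⟩
      · obtain ⟨B', -, rfl⟩ := Finset.mem_image.mp hB
        exact B'.2
    · rintro ⟨s, hs, hF⟩ p hp
      obtain ⟨B, hB, hpB⟩ := hs p hp
      exact mem_interior_iff_countableBasis.mpr ⟨B, hpB, hF B hB⟩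
  rw [hkey]
  have : Countable (countableBasis Plane) := (countable_countableBasis Plane).to_subtype
  refine MeasurableSet.iUnion fun s => MeasurableSet.prod ?_ ?_
  · refine IsOpen.measurableSet (isOpen_iff_eventually.mpr fun x hx => ?_)
    refine hK.eventually_forall_of_forall_eventually fun p hp => ?_
    have hO : IsOpen (⋃ B ∈ s, (B : Set Plane)) :=
      isOpen_biUnion fun B _ => (isBasis_countableBasis Plane).isOpen B.2
    have hc : Continuous fun z : Plane × Plane => z.2 - z.1 := by fun_prop
    exact hc.continuousAt.eventually (hO.mem_nhds (hx p hp))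
  · simp only [Set.ofPred_forall]
    exact Finset.measurableSet_biInter s fun B _ =>
      measurableSet_open_subset ((isBasis_countableBasis Plane).isOpen B.2)

theorem measurableSet_mem_interior (y : Plane) :
    MeasurableSet {F : Closeds Plane | y ∈ interior (F : Set Plane)} := by
  have : {F : Closeds Plane | y ∈ interior (F : Set Plane)} =
      Prod.mk (0 : Plane) ⁻¹' coverSet {y} := by
    ext F
    simp [coverSet]
  rw [this]
  exact measurable_prodMk_left (measurableSet_coverSet isCompact_singleton)

theorem measurableSet_hitSet {K : Set Plane} (hK : IsCompact K) : MeasurableSet (hitSet K) := by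
  -- a compact and a closed set meet if they come arbitrarily close
  have hkey : hitSet K = ⋂ m : ℕ, ⋃ n : ℕ,
      {x : Plane | denseSeq Plane n + x ∈ Metric.thickening (1 / ((m : ℝ) + 1)) K} ×ˢ
        {F : Closeds Plane | denseSeq Plane n ∈ interior (F : Set Plane)} := by
    ext ⟨x, F⟩
    simp only [hitSet, Set.mem_ofPred_eq, Set.mem_iInter, Set.mem_iUnion, Set.mem_prod]
    constructor
    · rintro ⟨p, hp, hpF⟩ m
      have hm : (0 : ℝ) < 1 / ((m : ℝ) + 1) := Nat.one_div_pos_of_nat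
      obtain ⟨y, hyb, hyF⟩ := mem_closure_iff.mp hpF (Metric.ball (p - x) (1 / ((m : ℝ) + 1)))
        Metric.isOpen_ball (Metric.mem_ball_self hm)
      obtain ⟨_, ⟨h1, h2⟩, n, rfl⟩ := (denseRange_denseSeq Plane).inter_open_nonempty _
        (Metric.isOpen_ball.inter isOpen_interior) ⟨y, hyb, hyF⟩
      refine ⟨n, Metric.mem_thickening_iff.mpr ⟨p, hp, ?_⟩, h2⟩
      rw [Metric.mem_ball, dist_eq_norm] at h1
      rw [dist_eq_norm]
      convert h1 using 2
      abel
    · intro h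
      by_contra! hcon
      have hdisj : Disjoint K ((fun p => p - x) ⁻¹' closure (interior (F : Set Plane))) :=
        Set.disjoint_left.mpr hcon
      obtain ⟨δ, hδ, hd⟩ := hdisj.exists_thickenings hK (isClosed_closure.preimage (by fun_prop))
      obtain ⟨m, hm⟩ := exists_nat_one_div_lt hδ
      obtain ⟨n, h1, h2⟩ := h m
      refine Set.disjoint_left.mp hd (Metric.thickening_mono hm.le _ h1)
        (Metric.self_subset_thickening hδ _ ?_)
      simpa using subset_closure h2
  rw [hkey]
  refine MeasurableSet.iInter fun m => MeasurableSet.iUnion fun n => MeasurableSet.prod ?_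
    (measurableSet_mem_interior _)
  exact (Metric.isOpen_thickening.preimage (by fun_prop)).measurableSet

theorem measurableSet_boundarySet (p : Plane) : MeasurableSet (boundarySet p) := by
  have hmem : MeasurableSet {q : Plane × Closeds Plane | p - q.1 ∈ (q.2 : Set Plane)} := by
    have hkey : {q : Plane × Closeds Plane | p - q.1 ∈ (q.2 : Set Plane)}ᶜ =
        ⋃ n : ℕ, ⋃ m : ℕ,
          {x : Plane | p - x ∈ Metric.ball (denseSeq Plane n) (1 / ((m : ℝ) + 1))} ×ˢ
          {F : Closeds Plane | (F : Set Plane) ∩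
            Metric.closedBall (denseSeq Plane n) (1 / ((m : ℝ) + 1)) = ∅} := by
      ext ⟨x, F⟩
      simp only [Set.mem_compl_iff, Set.mem_ofPred_eq, Set.mem_iUnion, Set.mem_prod]
      constructor
      · intro h
        obtain ⟨ε, hε, hb⟩ := Metric.isOpen_iff.mp F.isClosed.isOpen_compl _ h
        obtain ⟨m, hm⟩ := exists_nat_one_div_lt (half_pos hε)
        obtain ⟨n, hn⟩ := (denseRange_denseSeq Plane).exists_dist_lt (p - x)
          (Nat.one_div_pos_of_nat (α := ℝ) (n := m))
        refine ⟨n, m, hn, ?_⟩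
        rw [Set.eq_empty_iff_forall_notMem]
        rintro y ⟨hyF, hy⟩
        refine hb ?_ hyF
        rw [Metric.mem_ball]
        have h1 := Metric.mem_closedBall.mp hy
        have h2 := dist_triangle y (denseSeq Plane n) (p - x)
        rw [dist_comm (denseSeq Plane n)] at h2
        linarith
      · rintro ⟨n, m, h1, h2⟩ h
        rw [Set.eq_empty_iff_forall_notMem] at h2
        exact h2 _ ⟨h, Metric.ball_subset_closedBall h1⟩
    rw [← MeasurableSet.compl_iff, hkey]
    refine MeasurableSet.iUnion fun n => MeasurableSet.iUnion fun m => MeasurableSet.prod ?_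
      (measurableSet_miss (isCompact_closedBall _ _))
    exact (Metric.isOpen_ball.preimage (by fun_prop)).measurableSet
  have : boundarySet p = {q | p - q.1 ∈ (q.2 : Set Plane)} \ coverSet {p} := by
    ext q
    simp [boundarySet, coverSet, q.2.isClosed.frontier_eq]
  rw [this]
  exact hmem.diff (measurableSet_coverSet isCompact_singleton)

theorem coverSet_subset_hitSet {K : Set Plane} (hK : K.Nonempty) : coverSet K ⊆ hitSet K := by
  obtain ⟨p, hp⟩ := hK
  exact fun q hq => ⟨p, hp, subset_closure (hq p hp)⟩

theorem hitSet_mono {K K' : Set Plane} (h : K ⊆ K') : hitSet K ⊆ hitSet K' := by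
  rintro q ⟨p, hp, hq⟩
  exact ⟨p, h hp, hq⟩

theorem hitSet_iUnion {ι : Sort*} (K : ι → Set Plane) : hitSet (⋃ i, K i) = ⋃ i, hitSet (K i) := by
  ext q
  simp only [hitSet, Set.mem_iUnion, Set.mem_ofPred_eq]
  constructor
  · rintro ⟨p, ⟨i, hp⟩, hq⟩
    exact ⟨i, p, hp, hq⟩
  · rintro ⟨i, p, hp, hq⟩
    exact ⟨p, ⟨i, hp⟩, hq⟩

end Leaves

/-! ### Visible parts and chains -/

section Visible

theorem mem_vadd_iff_sub_mem {S : Set Plane} {x p : Plane} : p ∈ x +ᵥ S ↔ p - x ∈ S := by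
  rw [Set.mem_vadd_set_iff_neg_vadd_mem, vadd_eq_add, neg_add_eq_sub]

/-- Only finitely many leaves hit a given disk during a given bounded period before `0`. -/
def LocallyFiniteLeaves (x : ℕ → Plane) (t : ℕ → ℝ) (X : ℕ → Closeds Plane) : Prop :=
  ∀ R T : ℝ, {j | (x j, X j) ∈ hitSet (Metric.closedBall 0 R) ∧ t j ∈ Set.Ico T 0}.Finite

/-- Near `p` only finitely many leaves matter, and each of them stays away from `p` as soon as the
closure of its interior does not contain `p`. -/
theorem mem_interior_visiblePart {x : ℕ → Plane} {t : ℕ → ℝ} {X : ℕ → Closeds Plane}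
    (hlf : LocallyFiniteLeaves x t X) (i : ℕ) (p : Plane) :
    p ∈ interior (visiblePart x t X i) ↔ t i ≤ 0 ∧ p - x i ∈ interior (X i : Set Plane) ∧
      ∀ j, t i < t j → t j < 0 → p - x j ∉ closure (interior (X j : Set Plane)) := by
  constructor
  · intro hp
    obtain ⟨O, hOV, hO, hpO⟩ := mem_interior.mp hp
    have hopen : ∀ j, IsOpen ((fun y => y + x j) ⁻¹' O) := fun j => hO.preimage (by fun_prop)
    refine ⟨(hOV hpO).1, ?_, fun j hij hj hcl => ?_⟩
    · refine mem_interior.mpr ⟨(fun y => y + x i) ⁻¹' O, fun y hy => ?_, hopen i, by simpa⟩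
      have := (hOV hy).2.1
      rw [mem_vadd_iff_sub_mem, add_sub_cancel_right] at this
      exact this
    · obtain ⟨y, hyO, hy⟩ := mem_closure_iff.mp hcl _ (hopen j) (by simpa)
      have := (hOV hyO).2.2 j hij hj
      rw [mem_vadd_iff_sub_mem, add_sub_cancel_right] at this
      exact this hy
  · rintro ⟨hi, hp, hj⟩
    have hc : ∀ j, Continuous fun y : Plane => y - x j := fun j => by fun_prop
    rw [mem_interior_iff_mem_nhds]
    have h1 : ∀ᶠ y in 𝓝 p, y - x i ∈ interior (X i : Set Plane) :=
      (hc i).continuousAt.eventually (isOpen_interior.mem_nhds hp)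
    have h2 : ∀ᶠ y in 𝓝 p, y ∈ Metric.closedBall (0 : Plane) (‖p‖ + 1) := by
      have : Metric.ball (0 : Plane) (‖p‖ + 1) ∈ 𝓝 p :=
        Metric.isOpen_ball.mem_nhds (by simp)
      exact mem_of_superset this Metric.ball_subset_closedBall
    have h3 : ∀ᶠ y in 𝓝 p, ∀ j ∈ {j | (x j, X j) ∈ hitSet (Metric.closedBall 0 (‖p‖ + 1)) ∧
        t j ∈ Set.Ico (t i) 0}, t i < t j → y - x j ∉ closure (interior (X j : Set Plane)) := by
      refine (eventually_all_finite (hlf _ _)).mpr fun j hjm => ?_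
      by_cases hij : t i < t j
      · have := (hc j).continuousAt.eventually
          (isClosed_closure.isOpen_compl.mem_nhds (hj j hij hjm.2.2))
        filter_upwards [this] with y hy _
        exact hy
      · simp [hij]
    filter_upwards [h1, h2, h3] with y hy1 hy2 hy3
    refine ⟨hi, mem_vadd_iff_sub_mem.mpr (interior_subset hy1), fun j hij hj0 hy => ?_⟩
    rw [mem_vadd_iff_sub_mem] at hy
    exact hy3 j ⟨⟨y, hy2, subset_closure hy⟩, hij.le, hj0⟩ hij (subset_closure hy)

theorem subset_interior_visiblePart {x : ℕ → Plane} {t : ℕ → ℝ} {X : ℕ → Closeds Plane}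
    (hlf : LocallyFiniteLeaves x t X) {K : Set Plane} (hK : K.Nonempty) (i : ℕ) :
    K ⊆ interior (visiblePart x t X i) ↔ t i ≤ 0 ∧ (x i, X i) ∈ coverSet K ∧
      ∀ j, t i < t j → t j < 0 → (x j, X j) ∉ hitSet K := by
  have : ∀ p, p ∈ interior (visiblePart x t X i) ↔ _ := mem_interior_visiblePart hlf i
  simp only [Set.subset_def, this, coverSet, hitSet, Set.mem_ofPred_eq, not_exists, not_and]
  constructor
  · intro h
    obtain ⟨p, hp⟩ := hK
    exact ⟨(h p hp).1, fun q hq => (h q hq).2.1, fun j h1 h2 q hq => (h q hq).2.2 j h1 h2⟩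
  · rintro ⟨h1, h2, h3⟩ p hp
    exact ⟨h1, h2 p hp, fun j hj1 hj2 => h3 j hj1 hj2 p hp⟩

/-- The indices along a chain, in the order of their times. -/
theorem chain_iff_exists {L : Type*} (D H : ℕ → Set L) (c : ℕ → L × ℝ)
    (hinj : ∀ i j, i ≠ j → (c i).2 ≠ (c j).2) (n : ℕ) (b : ℝ) :
    Chain (fun n => D n \ ⋃ l < n, H l) (fun n => ⋃ l ≤ n, H l) c n b ↔
      ∃ i : Fin n → ℕ, StrictMono (fun j => (c (i j)).2) ∧ (∀ j, (c (i j)).2 < b) ∧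
        (∀ j : Fin n, (c (i j)).1 ∈ D j) ∧
        ∀ (j : Fin n) (k : ℕ), (c (i j)).2 < (c k).2 → (c k).2 < b → (c k).1 ∉ H j := by
  induction n generalizing b with
  | zero =>
    simp only [Chain, true_iff]
    exact ⟨Fin.elim0, fun j => j.elim0, fun j => j.elim0, fun j => j.elim0, fun j => j.elim0⟩
  | succ n ih =>
    constructor
    · rintro ⟨i, hib, ⟨hiD, hiH⟩, hU, hc⟩
      obtain ⟨i', hmono, hlt, hD, hH⟩ := (ih _).mp hc
      simp only [Set.mem_iUnion, not_exists] at hiH hU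
      refine ⟨Fin.snoc i' i, ?_, ?_, ?_, ?_⟩
      · intro j k hjk
        induction k using Fin.lastCases with
        | last =>
          induction j using Fin.lastCases with
          | last => exact absurd hjk (lt_irrefl _)
          | cast j => simpa using hlt j
        | cast k =>
          induction j using Fin.lastCases with
          | last => exact absurd hjk (not_lt.mpr (Fin.le_last _))
          | cast j => simpa using hmono (Fin.castSucc_lt_castSucc_iff.mp hjk)
      · intro j
        induction j using Fin.lastCases with
        | last => simpa using hib
        | cast j => simpa using (hlt j).trans hib
      · intro j
        induction j using Fin.lastCases with
        | last => simpa using hiD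
        | cast j => simpa using hD j
      · intro j k
        induction j using Fin.lastCases with
        | last => simpa using fun h1 h2 => hU k h1 h2 n le_rfl
        | cast j =>
          simp only [Fin.snoc_castSucc, Fin.val_castSucc]
          intro h1 h2
          rcases lt_trichotomy (c k).2 (c i).2 with h | h | h
          · exact hH j k h1 h
          · obtain rfl : k = i := by
              by_contra hne
              exact hinj k i hne h
            exact hiH j j.2
          · exact hU k h h2 j j.2.le
    · rintro ⟨i, hmono, hlt, hD, hH⟩
      have hlast : ∀ j : Fin n, (c (i j.castSucc)).2 < (c (i (Fin.last n))).2 := fun j =>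
        hmono (Fin.castSucc_lt_last j)
      refine ⟨i (Fin.last n), hlt _, ⟨by simpa using hD (Fin.last n), ?_⟩, ?_, ?_⟩
      · simp only [Set.mem_iUnion, not_exists]
        exact fun l hl => hH (Fin.castSucc ⟨l, hl⟩) _ (hlast ⟨l, hl⟩) (hlt _)
      · intro k h1 h2
        simp only [Set.mem_iUnion, not_exists]
        intro l hl
        exact hH ⟨l, Nat.lt_succ_of_le hl⟩ k (lt_of_le_of_lt (hmono.monotone (Fin.le_last _)) h1) h2
      · refine (ih _).mpr ⟨fun j => i j.castSucc, fun j k hjk => hmono (by simpa), hlast,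
          fun j => hD j.castSucc, fun j k h1 h2 => ?_⟩
        exact hH j.castSucc k h1 (h2.trans (hlt _))

end Visible

/-! ### The law of the visible parts -/

section VisibleLaw

variable {Ω : Type*} [MeasurableSpace Ω] {P : Measure Ω} {μ : Measure (Closeds Plane)}
  {x : ℕ → Ω → Plane} {t : ℕ → Ω → ℝ} {X : ℕ → Ω → Closeds Plane}

/-- The marked points of the model, as a configuration of translated leaves and times. -/
def leafConfig (x : ℕ → Ω → Plane) (t : ℕ → Ω → ℝ) (X : ℕ → Ω → Closeds Plane) (i : ℕ) (ω : Ω) :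
    (Plane × Closeds Plane) × ℝ := ((x i ω, X i ω), t i ω)

theorem IsDeadLeaves.isProbabilityMeasure [IsProbabilityMeasure P] (h : IsDeadLeaves P μ x t X) :
    IsProbabilityMeasure μ :=
  h.grain_law 0 ▸ Measure.isProbabilityMeasure_map (h.grain_measurable 0).aemeasurable

theorem measurePreserving_swapMark {A B C : Type*} [MeasurableSpace A] [MeasurableSpace B]
    [MeasurableSpace C] (a : Measure A) (b : Measure B) (m : Measure C) [SFinite a] [SFinite b]
    [SFinite m] :
    MeasurePreserving (fun q : (A × B) × C => ((q.1.1, q.2), q.1.2)) ((a.prod b).prod m)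
      ((a.prod m).prod b) := by
  have h1 := measurePreserving_prodAssoc a b m
  have h2 : MeasurePreserving (Prod.map id Prod.swap) (a.prod (b.prod m)) (a.prod (m.prod b)) :=
    (MeasurePreserving.id a).prod Measure.measurePreserving_swap
  have h3 := (measurePreserving_prodAssoc a m b).symm
  exact h3.comp (h2.comp h1)

/-- The grains are independent marks of the points, so that the leaves form a Poisson process. -/
theorem IsDeadLeaves.isMarkedPoisson [IsProbabilityMeasure P] (h : IsDeadLeaves P μ x t X) :
    IsMarkedPoisson P ((volume : Measure Plane).prod μ) (leafConfig x t X) := by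
  have := h.isProbabilityMeasure
  have hmp := measurePreserving_swapMark (volume : Measure Plane) (volume : Measure ℝ) μ
  rw [← Measure.volume_eq_prod] at hmp
  have hxt := h.poisson.measurable
  refine ⟨fun i => ?_, fun B hB hf => ?_, fun B hB => ?_, ?_⟩
  · exact ((hxt i).fst.prodMk (h.grain_measurable i)).prodMk (hxt i).snd
  · rw [← hmp.measure_preimage hB.nullMeasurableSet] at hf ⊢
    exact h.poisson.measure_void_marked h.grain_measurable h.grain_law h.grain_iIndep
      h.points_indep_grains (hmp.measurable hB) hf
  · rw [← hmp.measure_preimage hB.nullMeasurableSet]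
    exact h.poisson.tsum_measure_marked h.grain_measurable h.grain_law h.points_indep_grains
      (hmp.measurable hB)
  · have hp := h.poisson
    rw [Measure.volume_eq_prod] at hp
    exact hp.ae_injective_snd

/-- Laws of grains for which a compact set is hit at a finite rate, a point is hit at a positive
rate, and the boundaries have zero mean area. -/
structure IsGoodGrainLaw (μ : Measure (Closeds Plane)) : Prop where
  finite : ∀ K : Set Plane, IsCompact K → ((volume : Measure Plane).prod μ) (hitSet K) ≠ ∞
  pos : ∀ p : Plane, ((volume : Measure Plane).prod μ) (hitSet {p}) ≠ 0
  boundary : ∀ p : Plane, ((volume : Measure Plane).prod μ) (boundarySet p) = 0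

/-- Configurations with distinct nonzero times and locally finitely many leaves. -/
structure IsRegularConfig (x : ℕ → Plane) (t : ℕ → ℝ) (X : ℕ → Closeds Plane) : Prop where
  injective : ∀ i j, i ≠ j → t i ≠ t j
  ne_zero : ∀ i, t i ≠ 0
  locallyFinite : LocallyFiniteLeaves x t X

theorem IsDeadLeaves.ae_isRegularConfig [IsProbabilityMeasure P] (h : IsDeadLeaves P μ x t X)
    (hμ : IsGoodGrainLaw μ) : ∀ᵐ ω ∂P, IsRegularConfig (fun i => x i ω) (fun i => t i ω)
      (fun i => X i ω) := by
  have := h.isProbabilityMeasure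
  have hP := h.isMarkedPoisson
  have h0 := hP.ae_forall_notMem (B := Set.univ ×ˢ {0}) (MeasurableSet.univ.prod
    (measurableSet_singleton _)) (by simp)
  have hlf : ∀ᵐ ω ∂P, ∀ N : ℕ, ∀ T : ℝ, {i | (leafConfig x t X i ω).1 ∈
      hitSet (Metric.closedBall 0 N) ∧ (leafConfig x t X i ω).2 ∈ Set.Ico T 0}.Finite :=
    ae_all_iff.mpr fun N => hP.ae_finite_window (measurableSet_hitSet (isCompact_closedBall _ _))
      (hμ.finite _ (isCompact_closedBall _ _)) 0
  filter_upwards [hP.injective, h0, hlf] with ω h1 h2 h3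
  refine ⟨h1, fun i hi => h2 i ⟨trivial, hi⟩, fun R T => ?_⟩
  obtain ⟨N, hN⟩ := exists_nat_ge R
  refine (h3 N T).subset fun i hi => ⟨?_, hi.2⟩
  exact hitSet_mono (Metric.closedBall_subset_closedBall hN) hi.1

/-- Translated leaves that cover `K n` and do not hit the previous sets. -/
def stepSet (K : ℕ → Set Plane) (n : ℕ) : Set (Plane × Closeds Plane) :=
  coverSet (K n) \ ⋃ l < n, hitSet (K l)

theorem measurableSet_stepSet {K : ℕ → Set Plane} (hK : ∀ n, IsCompact (K n)) (n : ℕ) :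
    MeasurableSet (stepSet K n) :=
  (measurableSet_coverSet (hK n)).diff
    (MeasurableSet.iUnion fun l => MeasurableSet.iUnion fun _ => measurableSet_hitSet (hK l))

/-- The event that defines `Qfun`, in terms of chains. -/
theorem exists_visible_iff_chain {x : ℕ → Plane} {t : ℕ → ℝ} {X : ℕ → Closeds Plane}
    (hreg : IsRegularConfig x t X) {K : ℕ → Set Plane} (hne : ∀ n, (K n).Nonempty) (n : ℕ) :
    (∃ i : Fin n → ℕ, StrictMono (fun j => t (i j)) ∧ (∀ j, t (i j) ≤ 0) ∧
      ∀ j : Fin n, K j ⊆ interior (visiblePart x t X (i j))) ↔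
    Chain (stepSet K) (fun n => ⋃ l ≤ n, hitSet (K l)) (fun i => ((x i, X i), t i)) n 0 := by
  rw [show stepSet K = fun n => coverSet (K n) \ ⋃ l < n, hitSet (K l) from rfl,
    chain_iff_exists (fun n => coverSet (K n)) (fun n => hitSet (K n))
    _ hreg.injective]
  refine exists_congr fun i => and_congr_right fun _ => ?_
  simp only [subset_interior_visiblePart hreg.locallyFinite (hne _)]
  constructor
  · rintro ⟨h1, h2⟩
    exact ⟨fun j => lt_of_le_of_ne (h1 j) (hreg.ne_zero _), fun j => (h2 j).2.1,
      fun j => (h2 j).2.2⟩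
  · rintro ⟨h1, h2, h3⟩
    exact ⟨fun j => (h1 j).le, fun j => ⟨(h1 j).le, h2 j, h3 j⟩⟩

/-- The probability that the sets `K 0, …, K (n - 1)` show in this order, each inside one visible
part. -/
theorem IsDeadLeaves.measure_exists_visible [IsProbabilityMeasure P] (h : IsDeadLeaves P μ x t X)
    (hμ : IsGoodGrainLaw μ) {K : ℕ → Set Plane} (hK : ∀ n, IsCompact (K n))
    (hne : ∀ n, (K n).Nonempty) (n : ℕ) :
    P {ω | ∃ i : Fin n → ℕ, StrictMono (fun j => t (i j) ω) ∧ (∀ j, t (i j) ω ≤ 0) ∧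
      ∀ j : Fin n, K j ⊆ interior (visiblePart (fun k => x k ω) (fun k => t k ω)
        (fun k => X k ω) (i j))} =
      ∏ j ∈ Finset.range n, ((volume : Measure Plane).prod μ) (stepSet K j) /
        ((volume : Measure Plane).prod μ) (hitSet (⋃ l ≤ j, K l)) := by
  have := h.isProbabilityMeasure
  have hU : ∀ n, (⋃ l ≤ n, hitSet (K l)) = hitSet (⋃ l ≤ n, K l) := fun n => by
    simp_rw [hitSet_iUnion]
  have hKU : ∀ n, IsCompact (⋃ l ≤ n, K l) := fun n =>
    (Set.finite_Iic n).isCompact_biUnion fun l _ => hK l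
  have hch := h.isMarkedPoisson.measure_chain (W := stepSet K)
    (U := fun n => ⋃ l ≤ n, hitSet (K l))
    (measurableSet_stepSet hK) (fun n => hU n ▸ measurableSet_hitSet (hKU n)) ?_ ?_ ?_ ?_ n 0
  · simp only [hU] at hch
    rw [← hch]
    refine measure_congr ?_
    filter_upwards [h.ae_isRegularConfig hμ] with ω hω
    refine propext ?_
    have := exists_visible_iff_chain hω hne n
    simp only [hU] at this
    exact this
  · intro n q hq
    exact Set.mem_biUnion (le_refl n) (coverSet_subset_hitSet (hne n) hq.1)
  · intro m n hmn
    exact Set.biUnion_subset_biUnion_left fun l hl => le_trans hl hmn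
  · intro n
    rw [hU]
    exact hμ.finite _ (hKU n)
  · intro n
    obtain ⟨p, hp⟩ := hne n
    refine fun h0 => hμ.pos p (measure_mono_null (hitSet_mono ?_) (hU n ▸ h0))
    exact Set.singleton_subset_iff.mpr (Set.mem_biUnion (le_refl n) hp)

end VisibleLaw

/-! ### Limits of ratios of integrals as the smallest size tends to zero -/

section Ratio

variable {r₁ : EReal}

theorem measurableSet_sizeRange (r₀ : ℝ) (r₁ : EReal) : MeasurableSet (sizeRange r₀ r₁) :=
  measurableSet_Ici.inter (measurable_coe_real_ereal measurableSet_Iic)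

theorem sizeRange_eq_union {r₀ s : ℝ} (h : r₀ ≤ s) (hs : (s : EReal) < r₁) :
    sizeRange r₀ r₁ = Set.Ico r₀ s ∪ sizeRange s r₁ := by
  ext r
  simp only [sizeRange, Set.mem_ofPred_eq, Set.mem_union, Set.mem_Ico]
  constructor
  · rintro ⟨h1, h2⟩
    rcases lt_or_ge r s with h | h
    · exact Or.inl ⟨h1, h⟩
    · exact Or.inr ⟨h, h2⟩
  · rintro (⟨h1, h2⟩ | ⟨h1, h2⟩)
    · exact ⟨h1, (EReal.coe_lt_coe_iff.mpr h2).le.trans hs.le⟩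
    · exact ⟨h.trans h1, h2⟩

theorem setLIntegral_sizeRange {r₀ s : ℝ} (h : r₀ ≤ s) (hs : (s : EReal) < r₁) (g : ℝ → ℝ≥0∞) :
    ∫⁻ r in sizeRange r₀ r₁, g r = (∫⁻ r in Set.Ico r₀ s, g r) + ∫⁻ r in sizeRange s r₁, g r := by
  rw [sizeRange_eq_union h hs, lintegral_union (measurableSet_sizeRange _ _)]
  exact Set.disjoint_left.mpr fun r h1 h2 => not_lt.mpr h2.1 h1.2

theorem eventually_le_smallSize (s : SmallSize r₁) : ∀ᶠ r₀ in smallSizeToZero r₁, r₀ ≤ s := by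
  have : ∀ᶠ a : ℝ in 𝓝 0, a ≤ s.1 := eventually_le_nhds s.2.1
  exact this.comap _

theorem tendsto_iSup_smallSize {g : SmallSize r₁ → ℝ≥0∞} (hg : Antitone g) :
    Tendsto g (smallSizeToZero r₁) (𝓝 (⨆ r₀, g r₀)) := by
  refine tendsto_order.mpr ⟨fun a ha => ?_, fun a ha => ?_⟩
  · obtain ⟨s, hs⟩ := lt_iSup_iff.mp ha
    filter_upwards [eventually_le_smallSize s] with r hr
    exact hs.trans_le (hg hr)
  · exact Eventually.of_forall fun r => (le_iSup g r).trans_lt ha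

/-- If `f ≤ g` and `f / g` has the limit `ℓ` at zero, then the ratio of the integrals of `f` and `g`
over `[r₀, r₁]` converges as `r₀ → 0`. The limit is the ratio of the integrals over `(0, r₁]` if
the integral of `g` is finite, and `ℓ` otherwise. -/
theorem exists_tendsto_lintegral_ratio (hne : Nonempty (SmallSize r₁)) {f g : ℝ → ℝ≥0∞}
    (hf : Measurable f) (hfg : ∀ r, 0 < r → f r ≤ g r)
    (hfin : ∀ r₀ : SmallSize r₁, ∫⁻ r in sizeRange r₀ r₁, g r ≠ ∞)
    (hpos : ∀ r₀ : SmallSize r₁, ∫⁻ r in sizeRange r₀ r₁, g r ≠ 0)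
    {ℓ : ℝ≥0∞} (hℓ : ℓ ≠ ∞)
    (hlim : ∀ ε : ℝ≥0∞, 0 < ε → ε ≠ ∞ → ∃ s : ℝ, 0 < s ∧ ∀ r, 0 < r → r < s →
      f r ≤ (ℓ + ε) * g r ∧ ℓ * g r ≤ f r + ε * g r) :
    ∃ ρ : ℝ≥0∞, Tendsto (fun r₀ : SmallSize r₁ => (∫⁻ r in sizeRange r₀ r₁, f r) /
      ∫⁻ r in sizeRange r₀ r₁, g r) (smallSizeToZero r₁) (𝓝 ρ) := by
  set F : SmallSize r₁ → ℝ≥0∞ := fun r₀ => ∫⁻ r in sizeRange r₀ r₁, f r with hF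
  set G : SmallSize r₁ → ℝ≥0∞ := fun r₀ => ∫⁻ r in sizeRange r₀ r₁, g r with hG
  have hsub : ∀ {r s : SmallSize r₁}, r ≤ s → sizeRange s r₁ ⊆ sizeRange r r₁ :=
    fun hrs u hu => ⟨le_trans hrs hu.1, hu.2⟩
  have hFanti : Antitone F := fun r s hrs => lintegral_mono_set (hsub hrs)
  have hGanti : Antitone G := fun r s hrs => lintegral_mono_set (hsub hrs)
  have hFG : ∀ r, F r ≤ G r := fun r₀ => setLIntegral_mono' (measurableSet_sizeRange _ _)
    fun r hr => hfg r (r₀.2.1.trans_le hr.1)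
  by_cases htop : (⨆ r₀, G r₀) = ∞
  · -- the part of the integrals away from zero is negligible
    refine ⟨ℓ, (ENNReal.tendsto_nhds hℓ).mpr fun ε hε => ?_⟩
    rcases eq_or_ne ε ∞ with rfl | hε'
    · simp
    have hε2 : 0 < ε / 2 := ENNReal.half_pos hε.ne'
    have hε2' : ε / 2 ≠ ∞ := (ENNReal.half_lt_self hε.ne' hε' |>.trans_le le_top).ne
    obtain ⟨s, hs0, hs⟩ := hlim (ε / 2) hε2 hε2'
    obtain ⟨u⟩ := hne
    have hs'0 : 0 < min s u.1 := lt_min hs0 u.2.1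
    have hs'1 : ((min s u.1 : ℝ) : EReal) < r₁ :=
      (EReal.coe_le_coe_iff.mpr (min_le_right s u.1)).trans_lt u.2.2
    set v : SmallSize r₁ := ⟨min s u.1, hs'0, hs'1⟩ with hv
    have hGlim : Tendsto G (smallSizeToZero r₁) (𝓝 ∞) := htop ▸ tendsto_iSup_smallSize hGanti
    have hbig : ∀ c : ℝ≥0∞, c ≠ ∞ → ∀ᶠ r in smallSizeToZero r₁, c ≤ ε / 2 * G r := by
      intro c hc
      have : Tendsto (fun r => ε / 2 * G r) (smallSizeToZero r₁) (𝓝 (ε / 2 * ∞)) :=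
        ENNReal.Tendsto.const_mul hGlim (Or.inl (by simp))
      rw [ENNReal.mul_top hε2.ne'] at this
      exact this.eventually_const_le hc.lt_top
    filter_upwards [eventually_le_smallSize v, hbig (G v) (hfin v),
      hbig (ℓ * G v) (ENNReal.mul_ne_top hℓ (hfin v))] with r hrv h1 h2
    have hG0 := hpos r
    have hGt := hfin r
    have hIco : ∀ a ∈ Set.Ico r.1 v.1, 0 < a ∧ a < s := fun a ha =>
      ⟨r.2.1.trans_le ha.1, ha.2.trans_le (min_le_left _ _)⟩
    have hFsplit : F r = (∫⁻ a in Set.Ico r.1 v.1, f a) + F v := setLIntegral_sizeRange hrv v.2.2 f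
    have hGsplit : G r = (∫⁻ a in Set.Ico r.1 v.1, g a) + G v := setLIntegral_sizeRange hrv v.2.2 g
    have hIle : ∫⁻ a in Set.Ico r.1 v.1, g a ≤ G r := hGsplit ▸ le_self_add
    constructor
    · rw [tsub_le_iff_right]
      have hle : ℓ * G r ≤ F r + ε * G r := by
        calc ℓ * G r = (∫⁻ a in Set.Ico r.1 v.1, ℓ * g a) + ℓ * G v := by
              rw [hGsplit, mul_add, lintegral_const_mul' _ _ hℓ]
          _ ≤ (∫⁻ a in Set.Ico r.1 v.1, (f a + ε / 2 * g a)) + ε / 2 * G r := by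
              gcongr ?_ + ?_
              exact setLIntegral_mono' measurableSet_Ico fun a ha =>
                (hs a (hIco a ha).1 (hIco a ha).2).2
          _ = (∫⁻ a in Set.Ico r.1 v.1, f a) + ε / 2 * (∫⁻ a in Set.Ico r.1 v.1, g a) +
              ε / 2 * G r := by rw [lintegral_add_left hf, lintegral_const_mul' _ _ hε2']
          _ ≤ F r + ε / 2 * G r + ε / 2 * G r := by
              gcongr
              exact hFsplit ▸ le_self_add
          _ = F r + ε * G r := by rw [add_assoc, ← add_mul, ENNReal.add_halves]
      have := ENNReal.div_le_div_right hle (G r)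
      rwa [ENNReal.add_div, ENNReal.mul_div_cancel_right hG0 hGt,
        ENNReal.mul_div_cancel_right hG0 hGt] at this
    · have hle : F r ≤ (ℓ + ε) * G r := by
        calc F r ≤ (∫⁻ a in Set.Ico r.1 v.1, (ℓ + ε / 2) * g a) + ε / 2 * G r := by
              rw [hFsplit]
              gcongr ?_ + ?_
              · exact setLIntegral_mono' measurableSet_Ico fun a ha =>
                  (hs a (hIco a ha).1 (hIco a ha).2).1
              · exact (hFG v).trans h1
          _ ≤ (ℓ + ε / 2) * G r + ε / 2 * G r := by
              rw [lintegral_const_mul' _ _ (ENNReal.add_ne_top.mpr ⟨hℓ, hε2'⟩)]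
              gcongr
          _ = (ℓ + ε) * G r := by rw [← add_mul, add_assoc, ENNReal.add_halves]
      exact ENNReal.div_le_of_le_mul hle
  · refine ⟨(⨆ r₀, F r₀) / ⨆ r₀, G r₀, ENNReal.Tendsto.div (tendsto_iSup_smallSize hFanti)
      (Or.inr ?_) (tendsto_iSup_smallSize hGanti) (Or.inl htop)⟩
    obtain ⟨u⟩ := hne
    exact ((pos_iff_ne_zero.mpr (hpos u)).trans_le (le_iSup G u)).ne'

end Ratio

/-! ### The rates of the scaled grains -/

section Rates

/-- The properties of the unscaled grain that hold almost surely: it lies between the disks of radii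
`a₁` and `a₂`, and its boundary is negligible. -/
structure IsGoodGrain (a₁ a₂ : ℝ) (F : Closeds Plane) : Prop where
  ball_subset : Metric.closedBall 0 a₁ ⊆ (F : Set Plane)
  subset_ball : (F : Set Plane) ⊆ Metric.closedBall 0 a₂
  volume_frontier : volume (frontier (F : Set Plane)) = 0

variable {a₁ a₂ r : ℝ} {F : Closeds Plane}

theorem coe_scaleSet (r : ℝ) (F : Closeds Plane) :
    (scaleSet r F : Set Plane) = r • (F : Set Plane) :=
  rfl

theorem volume_smul_plane (hr : 0 < r) (S : Set Plane) :
    volume (r • S) = ENNReal.ofReal (r ^ 2) * volume S := by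
  rw [Measure.addHaar_smul, finrank_euclideanSpace_fin, abs_of_nonneg (by positivity)]

theorem interior_scaleSet (hr : 0 < r) (F : Closeds Plane) :
    interior (scaleSet r F : Set Plane) = r • interior (F : Set Plane) :=
  interior_smul₀ hr.ne' _

theorem IsGoodGrain.scale (h : IsGoodGrain a₁ a₂ F) (hr : 0 < r) :
    IsGoodGrain (r * a₁) (r * a₂) (scaleSet r F) where
  ball_subset := by
    rw [coe_scaleSet]
    refine le_trans ?_ (Set.smul_set_mono h.ball_subset)
    rw [smul_closedBall' hr.ne', smul_zero, Real.norm_of_nonneg hr.le]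
  subset_ball := by
    rw [coe_scaleSet]
    refine (Set.smul_set_mono h.subset_ball).trans ?_
    rw [smul_closedBall' hr.ne', smul_zero, Real.norm_of_nonneg hr.le]
  volume_frontier := by
    rw [(scaleSet r F).isClosed.frontier_eq, interior_scaleSet hr, coe_scaleSet,
      ← Set.smul_set_sdiff₀ hr.ne', ← F.isClosed.frontier_eq, volume_smul_plane hr,
      h.volume_frontier, mul_zero]

theorem IsGoodGrain.closure_interior_subset (h : IsGoodGrain a₁ a₂ F) :
    closure (interior (F : Set Plane)) ⊆ Metric.closedBall 0 a₂ :=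
  (closure_minimal interior_subset F.isClosed).trans h.subset_ball

theorem IsGoodGrain.dist_le (h : IsGoodGrain a₁ a₂ F) {p q x : Plane}
    (hp : p - x ∈ closure (interior (F : Set Plane)))
    (hq : q - x ∈ closure (interior (F : Set Plane))) : dist p q ≤ 2 * a₂ := by
  have h1 := h.closure_interior_subset hp
  have h2 := h.closure_interior_subset hq
  rw [mem_closedBall_zero_iff] at h1 h2
  have h3 := norm_sub_le (p - x) (q - x)
  rw [sub_sub_sub_cancel_right] at h3
  rw [dist_eq_norm]
  linarith

theorem volume_preimage_sub (p : Plane) {S : Set Plane} (hS : MeasurableSet S) :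
    volume {x | p - x ∈ S} = volume S :=
  (volume.measurePreserving_sub_left p).measure_preimage hS.nullMeasurableSet

theorem volume_cover_singleton (hr : 0 < r) (F : Closeds Plane) (p : Plane) :
    volume {x | (x, scaleSet r F) ∈ coverSet {p}} =
      ENNReal.ofReal (r ^ 2) * volume (interior (F : Set Plane)) := by
  simp only [coverSet, Set.mem_singleton_iff, forall_eq, Set.mem_ofPred_eq]
  rw [volume_preimage_sub p isOpen_interior.measurableSet, interior_scaleSet hr,
    volume_smul_plane hr]

theorem IsGoodGrain.volume_hit_singleton (h : IsGoodGrain a₁ a₂ F) (hr : 0 < r) (p : Plane) :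
    volume {x | (x, scaleSet r F) ∈ hitSet {p}} =
      ENNReal.ofReal (r ^ 2) * volume (interior (F : Set Plane)) := by
  simp only [hitSet, Set.mem_singleton_iff, exists_eq_left, Set.mem_ofPred_eq]
  rw [volume_preimage_sub p isClosed_closure.measurableSet, ← volume_smul_plane hr,
    ← interior_scaleSet hr]
  refine le_antisymm ?_ (measure_mono subset_closure)
  have hsub : closure (interior (scaleSet r F : Set Plane)) ⊆
      interior (scaleSet r F : Set Plane) ∪ frontier (scaleSet r F : Set Plane) := by
    rw [(scaleSet r F).isClosed.frontier_eq, Set.union_sdiff_self]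
    exact (closure_minimal interior_subset (scaleSet r F).isClosed).trans Set.subset_union_right
  refine (measure_mono hsub).trans ((measure_union_le _ _).trans ?_)
  rw [(h.scale hr).volume_frontier, add_zero]

theorem IsGoodGrain.volume_boundary (h : IsGoodGrain a₁ a₂ F) (hr : 0 < r) (p : Plane) :
    volume {x | (x, scaleSet r F) ∈ boundarySet p} = 0 := by
  simp only [boundarySet, Set.mem_ofPred_eq]
  rw [volume_preimage_sub p isClosed_frontier.measurableSet, (h.scale hr).volume_frontier]

theorem IsGoodGrain.volume_hit_le (h : IsGoodGrain a₁ a₂ F) (ha₂ : 0 < a₂) (hr : 0 < r)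
    {K : Set Plane} {R : ℝ} (hR : 0 ≤ R) (hK : K ⊆ Metric.closedBall 0 R) :
    volume {x | (x, scaleSet r F) ∈ hitSet K} ≤
      ENNReal.ofReal ((R + r * a₂) ^ 2) * volume (Metric.ball (0 : Plane) 1) := by
  have hsub : {x | (x, scaleSet r F) ∈ hitSet K} ⊆ Metric.closedBall 0 (R + r * a₂) := by
    rintro x ⟨p, hp, hx⟩
    have h1 := (h.scale hr).closure_interior_subset hx
    have h2 := hK hp
    rw [mem_closedBall_zero_iff] at h1 h2 ⊢
    have h3 := norm_sub_le p (p - x)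
    rw [sub_sub_cancel] at h3
    linarith
  refine (measure_mono hsub).trans_eq ?_
  rw [Measure.addHaar_closedBall _ _ (by positivity), finrank_euclideanSpace_fin]

/-- The expected area of the set of positions at which a grain of size `r` is in `S`. -/
noncomputable def leafRate (μY : Measure (Closeds Plane)) (S : Set (Plane × Closeds Plane))
    (r : ℝ) : ℝ≥0∞ := ∫⁻ F, volume {x | (x, scaleSet r F) ∈ S} ∂μY

variable {μY : Measure (Closeds Plane)}

theorem measurable_volume_section {S : Set (Plane × Closeds Plane)} (hS : MeasurableSet S) :
    Measurable fun F : Closeds Plane => volume {x : Plane | (x, F) ∈ S} :=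
  measurable_measure_prodMk_right hS

theorem measurable_leafRate [SFinite μY] {S : Set (Plane × Closeds Plane)} (hS : MeasurableSet S) :
    Measurable (leafRate μY S) :=
  ((measurable_volume_section hS).comp measurable_scaleSet).lintegral_prod_right'

/-- The rate of the leaves in `S` as an integral over the sizes. -/
theorem volume_prod_scaledGrainLaw [IsProbabilityMeasure μY] {α r₀ : ℝ} {r₁ : EReal} (hr₀ : 0 < r₀)
    {S : Set (Plane × Closeds Plane)} (hS : MeasurableSet S) :
    ((volume : Measure Plane).prod (scaledGrainLaw α r₀ r₁ μY)) S =
      ENNReal.ofReal (∫ u in sizeRange r₀ r₁, u ^ (-α))⁻¹ *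
        ∫⁻ r in sizeRange r₀ r₁, ENNReal.ofReal (r ^ (-α)) * leafRate μY S r := by
  have hm := measurable_volume_section hS
  have hpow : Measurable fun r : ℝ => r ^ (-α) := by fun_prop
  have : SFinite (sizeLaw α r₀ r₁) := by
    unfold sizeLaw
    infer_instance
  have : SFinite (scaledGrainLaw α r₀ r₁ μY) := by
    unfold scaledGrainLaw
    infer_instance
  rw [Measure.prod_apply_symm hS]
  change ∫⁻ F, volume {x : Plane | (x, F) ∈ S} ∂_ = _
  have hm2 : Measurable fun a : ℝ × Closeds Plane =>
      volume {x : Plane | (x, scaleSet a.1 a.2) ∈ S} := hm.comp measurable_scaleSet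
  rw [scaledGrainLaw, lintegral_map hm measurable_scaleSet, lintegral_prod _ hm2.aemeasurable]
  change ∫⁻ r, leafRate μY S r ∂_ = _
  rw [sizeLaw,
    lintegral_withDensity_eq_lintegral_mul _ (by fun_prop) (measurable_leafRate hS),
    ← lintegral_const_mul' _ _ ENNReal.ofReal_ne_top]
  refine setLIntegral_congr_fun (measurableSet_sizeRange _ _) fun r _ => ?_
  have h0 : 0 ≤ ∫ u in sizeRange r₀ r₁, u ^ (-α) :=
    setIntegral_nonneg (measurableSet_sizeRange _ _) fun u hu =>
      Real.rpow_nonneg (hr₀.le.trans hu.1) _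
  simp only [Pi.mul_apply]
  rw [ENNReal.ofReal_mul (inv_nonneg.mpr h0), mul_assoc]

/-- The expected area of the interior of the unscaled grain. -/
noncomputable def meanArea (μY : Measure (Closeds Plane)) : ℝ≥0∞ :=
  ∫⁻ F, volume (interior (F : Set Plane)) ∂μY

theorem leafRate_cover_singleton (hr : 0 < r) (p : Plane) :
    leafRate μY (coverSet {p}) r = ENNReal.ofReal (r ^ 2) * meanArea μY := by
  simp_rw [leafRate, volume_cover_singleton hr]
  exact lintegral_const_mul' _ _ ENNReal.ofReal_ne_top

variable (hμY : ∀ᵐ F ∂μY, IsGoodGrain a₁ a₂ F)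
include hμY

theorem leafRate_hit_singleton (hr : 0 < r) (p : Plane) :
    leafRate μY (hitSet {p}) r = ENNReal.ofReal (r ^ 2) * meanArea μY := by
  rw [leafRate, meanArea, ← lintegral_const_mul' _ _ ENNReal.ofReal_ne_top]
  refine lintegral_congr_ae ?_
  filter_upwards [hμY] with F hF
  exact hF.volume_hit_singleton hr p

theorem leafRate_boundary (hr : 0 < r) (p : Plane) : leafRate μY (boundarySet p) r = 0 := by
  rw [leafRate, ← lintegral_zero (μ := μY)]
  refine lintegral_congr_ae ?_
  filter_upwards [hμY] with F hF
  exact hF.volume_boundary hr p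

theorem leafRate_hit_le [IsProbabilityMeasure μY] (ha₂ : 0 < a₂) (hr : 0 < r) {K : Set Plane}
    {R : ℝ} (hR : 0 ≤ R) (hK : K ⊆ Metric.closedBall 0 R) : leafRate μY (hitSet K) r ≤
      ENNReal.ofReal ((R + r * a₂) ^ 2) * volume (Metric.ball (0 : Plane) 1) := by
  calc leafRate μY (hitSet K) r ≤ ∫⁻ _, ENNReal.ofReal ((R + r * a₂) ^ 2) *
        volume (Metric.ball (0 : Plane) 1) ∂μY := by
        refine lintegral_mono_ae ?_
        filter_upwards [hμY] with F hF
        exact hF.volume_hit_le ha₂ hr hR hK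
    _ = _ := by simp

theorem meanArea_ne_zero [IsProbabilityMeasure μY] (ha₁ : 0 < a₁) : meanArea μY ≠ 0 := by
  have hle : volume (Metric.ball (0 : Plane) a₁) ≤ meanArea μY := by
    calc volume (Metric.ball (0 : Plane) a₁) = ∫⁻ _, volume (Metric.ball (0 : Plane) a₁) ∂μY := by
          simp
      _ ≤ meanArea μY := by
        refine lintegral_mono_ae ?_
        filter_upwards [hμY] with F hF
        exact measure_mono (interior_maximal
          (Metric.ball_subset_closedBall.trans hF.ball_subset) Metric.isOpen_ball)
  exact ((Metric.measure_ball_pos volume 0 ha₁).trans_le hle).ne'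

/-- Distinct points are hit by disjoint sets of small grains. -/
theorem exists_card_mul_le_leafRate (ha₂ : 0 < a₂) {U : Set Plane} (T : Finset Plane)
    (hT : (T : Set Plane) ⊆ U) : ∃ s : ℝ, 0 < s ∧ ∀ r, 0 < r → r < s →
      T.card * (ENNReal.ofReal (r ^ 2) * meanArea μY) ≤ leafRate μY (hitSet U) r := by
  have hsep : ∀ᶠ d : ℝ in 𝓝[>] 0, ∀ p ∈ T, ∀ q ∈ T, p ≠ q → d < dist p q := by
    refine (eventually_all_finset T).mpr fun p _ => (eventually_all_finset T).mpr fun q _ => ?_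
    by_cases hpq : p = q
    · simp [hpq]
    · filter_upwards [Ioo_mem_nhdsGT (dist_pos.mpr hpq)] with d hd _
      exact hd.2
  obtain ⟨d, hd, hd0⟩ := (hsep.and self_mem_nhdsWithin).exists
  replace hd0 : 0 < d := hd0
  refine ⟨d / (2 * a₂), by positivity, fun r hr hrs => ?_⟩
  rw [lt_div_iff₀ (by positivity)] at hrs
  rw [meanArea, ← lintegral_const_mul' _ _ ENNReal.ofReal_ne_top,
    ← lintegral_const_mul' _ _ (ENNReal.natCast_ne_top _)]
  refine lintegral_mono_ae ?_
  filter_upwards [hμY] with F hF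
  have hsum : T.card * (ENNReal.ofReal (r ^ 2) * volume (interior (F : Set Plane))) =
      volume (⋃ q ∈ T, {x | (x, scaleSet r F) ∈ coverSet {q}}) := by
    rw [measure_biUnion_finset]
    · simp_rw [volume_cover_singleton hr]
      rw [Finset.sum_const, nsmul_eq_mul]
    · intro p hp q hq hpq
      refine Set.disjoint_left.mpr fun x hxp hxq => ?_
      have h1 := (hF.scale hr).dist_le (subset_closure (hxp p rfl)) (subset_closure (hxq q rfl))
      have h2 := hd p hp q hq hpq
      linarith
    · exact fun q _ => measurable_prodMk_right (measurableSet_coverSet isCompact_singleton)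
  rw [hsum]
  refine measure_mono (Set.iUnion₂_subset fun q hq x hx => ?_)
  exact ⟨q, hT hq, subset_closure (hx q rfl)⟩

theorem leafRate_hit_finset_le (hr : 0 < r) (T : Finset Plane) :
    leafRate μY (hitSet (T : Set Plane)) r ≤
      T.card * (ENNReal.ofReal (r ^ 2) * meanArea μY) := by
  rw [meanArea, ← lintegral_const_mul' _ _ ENNReal.ofReal_ne_top,
    ← lintegral_const_mul' _ _ (ENNReal.natCast_ne_top _)]
  refine lintegral_mono_ae ?_
  filter_upwards [hμY] with F hF
  calc volume {x | (x, scaleSet r F) ∈ hitSet (T : Set Plane)}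
      ≤ volume (⋃ q ∈ T, {x | (x, scaleSet r F) ∈ hitSet {q}}) := by
        refine measure_mono ?_
        rintro x ⟨q, hq, hx⟩
        exact Set.mem_biUnion hq ⟨q, rfl, hx⟩
    _ ≤ ∑ q ∈ T, volume {x | (x, scaleSet r F) ∈ hitSet {q}} := measure_biUnion_finset_le _ _
    _ = _ := by
        simp_rw [hF.volume_hit_singleton hr]
        rw [Finset.sum_const, nsmul_eq_mul]

/-- The asymptotics of the rates for small grains: a grain that is small enough covers `K n` only if
`K n` is a single point, and then it hits no other point at a positive distance. The limit of the
ratio is therefore `1 / N` if `K 0 ∪ … ∪ K n` has `N < ∞` points and `K n` is a single point outside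
of the other sets, and `0` otherwise. -/
theorem exists_leafRate_ratio (ha₂ : 0 < a₂) {K : ℕ → Set Plane} (hK : ∀ n, IsCompact (K n))
    (hne : ∀ n, (K n).Nonempty) (n : ℕ) :
    ∃ ℓ : ℝ≥0∞, ℓ ≠ ∞ ∧ ∀ ε : ℝ≥0∞, 0 < ε → ε ≠ ∞ → ∃ s : ℝ, 0 < s ∧ ∀ r, 0 < r → r < s →
      leafRate μY (stepSet K n) r ≤ (ℓ + ε) * leafRate μY (hitSet (⋃ l ≤ n, K l)) r ∧
      ℓ * leafRate μY (hitSet (⋃ l ≤ n, K l)) r ≤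
        leafRate μY (stepSet K n) r + ε * leafRate μY (hitSet (⋃ l ≤ n, K l)) r := by
  by_cases hsub : (K n).Subsingleton
  swap
  · obtain ⟨p, hp, q, hq, hpq⟩ := Set.not_subsingleton_iff.mp hsub
    have hd := dist_pos.mpr hpq
    refine ⟨0, ENNReal.zero_ne_top, fun ε _ _ => ⟨dist p q / (2 * a₂), by positivity,
      fun r hr hrs => ?_⟩⟩
    rw [lt_div_iff₀ (by positivity)] at hrs
    have h0 : leafRate μY (stepSet K n) r = 0 := by
      rw [leafRate, ← lintegral_zero (μ := μY)]
      refine lintegral_congr_ae ?_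
      filter_upwards [hμY] with F hF
      convert measure_empty (μ := (volume : Measure Plane))
      rw [Set.eq_empty_iff_forall_notMem]
      intro x hx
      have := (hF.scale hr).dist_le (subset_closure (hx.1 p hp)) (subset_closure (hx.1 q hq))
      linarith
    simp [h0]
  obtain ⟨p, hp⟩ := hne n
  have hKp : K n = {p} := hsub.eq_singleton_of_mem hp
  by_cases hpV : p ∈ ⋃ l < n, K l
  · have h0 : stepSet K n = ∅ := by
      rw [Set.eq_empty_iff_forall_notMem]
      rintro q ⟨h1, h2⟩
      obtain ⟨l, hl, hpl⟩ := Set.mem_iUnion₂.mp hpV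
      exact h2 (Set.mem_biUnion hl ⟨p, hpl, subset_closure (h1 p hp)⟩)
    refine ⟨0, ENNReal.zero_ne_top, fun ε _ _ => ⟨1, one_pos, fun r _ _ => ?_⟩⟩
    simp [h0, leafRate]
  have hVc : IsClosed (⋃ l < n, K l) :=
    ((Set.finite_Iio n).isCompact_biUnion fun l _ => hK l).isClosed
  obtain ⟨d, hd0, hd⟩ := Metric.isOpen_iff.mp hVc.isOpen_compl p hpV
  have hf : ∀ r, 0 < r → r < d / (2 * a₂) →
      leafRate μY (stepSet K n) r = ENNReal.ofReal (r ^ 2) * meanArea μY := by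
    intro r hr hrs
    rw [lt_div_iff₀ (by positivity)] at hrs
    rw [← leafRate_cover_singleton hr p, leafRate, leafRate]
    refine lintegral_congr_ae ?_
    filter_upwards [hμY] with F hF
    congr 1
    ext x
    rw [Set.mem_ofPred_eq, Set.mem_ofPred_eq, stepSet, hKp]
    refine ⟨fun h => h.1, fun h => ⟨h, fun hV => ?_⟩⟩
    obtain ⟨l, hl, q, hq, hqx⟩ := Set.mem_iUnion₂.mp hV
    have h1 := (hF.scale hr).dist_le hqx (subset_closure (h p rfl))
    exact hd (Metric.mem_ball.mpr (by linarith)) (Set.mem_biUnion hl hq)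
  by_cases hfin : (⋃ l ≤ n, K l).Finite
  · set T := hfin.toFinset with hT
    have hTU : (T : Set Plane) = ⋃ l ≤ n, K l := hfin.coe_toFinset
    obtain ⟨s, hs0, hs⟩ := exists_card_mul_le_leafRate hμY ha₂ T hTU.subset
    have hT0 : (T.card : ℝ≥0∞) ≠ 0 := by
      have : p ∈ T := hfin.mem_toFinset.mpr (Set.mem_biUnion (le_refl n) hp)
      exact_mod_cast (Finset.card_pos.mpr ⟨p, this⟩).ne'
    refine ⟨(T.card : ℝ≥0∞)⁻¹, ENNReal.inv_ne_top.mpr hT0, fun ε _ _ =>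
      ⟨min s (d / (2 * a₂)), by positivity, fun r hr hrs => ?_⟩⟩
    have hg : leafRate μY (hitSet (⋃ l ≤ n, K l)) r =
        T.card * (ENNReal.ofReal (r ^ 2) * meanArea μY) :=
      le_antisymm (hTU ▸ leafRate_hit_finset_le hμY hr T) (hs r hr (hrs.trans_le (min_le_left _ _)))
    have heq : (T.card : ℝ≥0∞)⁻¹ * leafRate μY (hitSet (⋃ l ≤ n, K l)) r =
        leafRate μY (stepSet K n) r := by
      rw [hg, hf r hr (hrs.trans_le (min_le_right _ _)), ← mul_assoc,
        ENNReal.inv_mul_cancel hT0 (ENNReal.natCast_ne_top _), one_mul]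
    rw [add_mul, heq]
    exact ⟨le_self_add, le_self_add⟩
  · refine ⟨0, ENNReal.zero_ne_top, fun ε hε hε' => ?_⟩
    obtain ⟨N, hN⟩ := ENNReal.exists_inv_nat_lt hε.ne'
    obtain ⟨T, hTU, hTN⟩ := Set.Infinite.exists_subset_card_eq hfin N
    obtain ⟨s, hs0, hs⟩ := exists_card_mul_le_leafRate hμY ha₂ T hTU
    have hN0 : (N : ℝ≥0∞) ≠ 0 := by
      rintro h0
      rw [h0, ENNReal.inv_zero] at hN
      exact not_top_lt hN
    refine ⟨min s (d / (2 * a₂)), by positivity, fun r hr hrs => ⟨?_, by simp⟩⟩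
    have h1 := hs r hr (hrs.trans_le (min_le_left _ _))
    rw [hTN, ← hf r hr (hrs.trans_le (min_le_right _ _))] at h1
    calc leafRate μY (stepSet K n) r = (N : ℝ≥0∞)⁻¹ * (N * leafRate μY (stepSet K n) r) := by
          rw [← mul_assoc, ENNReal.inv_mul_cancel hN0 (ENNReal.natCast_ne_top _), one_mul]
      _ ≤ (0 + ε) * leafRate μY (hitSet (⋃ l ≤ n, K l)) r := by
          rw [zero_add]
          gcongr

end Rates

/-! ### Convergence of the probabilities `Qfun` -/

section Convergence

variable {α : ℝ} {r₁ : EReal}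

theorem smallSizeToZero_neBot (hr₁ : 0 < r₁) : (smallSizeToZero r₁).NeBot := by
  refine comap_neBot_iff.mpr fun s hs => ?_
  obtain ⟨ε, hε, hs⟩ := Metric.mem_nhds_iff.mp hs
  obtain ⟨b, hb0, hb⟩ := EReal.lt_iff_exists_real_btwn.mp hr₁
  have hb0' : 0 < b := by exact_mod_cast hb0
  have hmin : 0 < min b (ε / 2) := lt_min hb0' (half_pos hε)
  refine ⟨⟨min b (ε / 2), hmin,
    (EReal.coe_le_coe_iff.mpr (min_le_left _ _)).trans_lt hb⟩, hs ?_⟩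
  rw [mem_ball_zero_iff, Real.norm_of_nonneg hmin.le]
  exact (min_le_right _ _).trans_lt (half_lt_self hε)

theorem volume_sizeRange_ne_zero (r₀ : SmallSize r₁) : volume (sizeRange r₀ r₁) ≠ 0 := by
  obtain ⟨b, hb0, hb⟩ := EReal.lt_iff_exists_real_btwn.mp r₀.2.2
  have hb0' : r₀.1 < b := by exact_mod_cast hb0
  have hsub : Set.Ioo r₀.1 b ⊆ sizeRange r₀ r₁ := fun r hr =>
    ⟨hr.1.le, (EReal.coe_le_coe_iff.mpr hr.2.le).trans hb.le⟩
  refine ((pos_iff_ne_zero.mpr ?_).trans_le (measure_mono hsub)).ne'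
  simpa using hb0'

theorem integrableOn_rpow_sizeRange {β : ℝ} (hβ : β < -1 ∨ r₁ ≠ ⊤) (r₀ : SmallSize r₁) :
    IntegrableOn (fun r : ℝ => r ^ β) (sizeRange r₀ r₁) := by
  have h0 := r₀.2.1
  rcases hβ with hβ | hr₁
  · refine (integrableOn_Ioi_rpow_of_lt hβ (half_pos h0)).mono_set fun r hr => ?_
    exact (half_lt_self h0).trans_le hr.1
  · have hbot : r₁ ≠ ⊥ := (bot_le.trans_lt r₀.2.2).ne'
    lift r₁ to ℝ using ⟨hr₁, hbot⟩
    have hIcc : sizeRange r₀ (r₁ : EReal) = Set.Icc r₀.1 r₁ := by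
      ext r
      simp [sizeRange]
    rw [hIcc]
    refine ContinuousOn.integrableOn_Icc fun r hr => ?_
    exact (Real.continuousAt_rpow_const _ _ (Or.inl (h0.trans_le hr.1).ne')).continuousWithinAt

/-- The normalizing constant of the law of the sizes is positive. -/
theorem integral_sizeRange_pos (hα : 1 < α) (r₀ : SmallSize r₁) :
    0 < ∫ u in sizeRange r₀ r₁, u ^ (-α) := by
  have hpos : ∀ u ∈ sizeRange r₀ r₁, 0 < u ^ (-α) := fun u hu =>
    Real.rpow_pos_of_pos (r₀.2.1.trans_le hu.1) _
  rw [setIntegral_pos_iff_support_of_nonneg_ae]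
  · refine pos_iff_ne_zero.mpr fun h => volume_sizeRange_ne_zero r₀ (measure_mono_null ?_ h)
    exact fun u hu => ⟨(hpos u hu).ne', hu⟩
  · filter_upwards [ae_restrict_mem (measurableSet_sizeRange _ _)] with u hu
    exact (hpos u hu).le
  · exact integrableOn_rpow_sizeRange (Or.inl (by linarith)) r₀

variable {μY : Measure (Closeds Plane)} [IsProbabilityMeasure μY] {a₁ a₂ : ℝ}

/-- The second moment of the size is finite. -/
theorem lintegral_leafRate_hit_ne_top (hαr₁ : α ≤ 3 → r₁ ≠ ⊤)
    (hμY : ∀ᵐ F ∂μY, IsGoodGrain a₁ a₂ F) (ha₂ : 0 < a₂) {K : Set Plane} (hK : IsCompact K)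
    (r₀ : SmallSize r₁) :
    ∫⁻ r in sizeRange r₀ r₁, ENNReal.ofReal (r ^ (-α)) * leafRate μY (hitSet K) r ≠ ∞ := by
  obtain ⟨R, hR0, hKR⟩ : ∃ R : ℝ, 0 ≤ R ∧ K ⊆ Metric.closedBall 0 R := by
    obtain ⟨R, hR⟩ := hK.isBounded.subset_closedBall 0
    exact ⟨max R 0, le_max_right _ _, hR.trans (Metric.closedBall_subset_closedBall
      (le_max_left _ _))⟩
  have h0 := r₀.2.1
  set c := ENNReal.ofReal ((R / r₀ + a₂) ^ 2) * volume (Metric.ball (0 : Plane) 1) with hc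
  have hctop : c ≠ ∞ := ENNReal.mul_ne_top ENNReal.ofReal_ne_top measure_ball_lt_top.ne
  have hle : ∫⁻ r in sizeRange r₀ r₁, ENNReal.ofReal (r ^ (-α)) * leafRate μY (hitSet K) r ≤
      ∫⁻ r in sizeRange r₀ r₁, c * ENNReal.ofReal (r ^ (2 - α)) := by
    refine setLIntegral_mono' (measurableSet_sizeRange _ _) fun r hr => ?_
    have hr0 : 0 < r := h0.trans_le hr.1
    have h1 : R + r * a₂ ≤ (R / r₀ + a₂) * r := by
      have : R ≤ R / r₀ * r := by
        rw [div_mul_eq_mul_div, le_div_iff₀ h0]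
        exact mul_le_mul_of_nonneg_left hr.1 hR0
      linarith
    have h2 : r ^ (2 - α) = r ^ (-α) * r ^ 2 := by
      rw [← Real.rpow_natCast r 2, ← Real.rpow_add hr0]
      congr 1
      push_cast
      ring
    calc ENNReal.ofReal (r ^ (-α)) * leafRate μY (hitSet K) r
        ≤ ENNReal.ofReal (r ^ (-α)) * (ENNReal.ofReal (((R / r₀ + a₂) * r) ^ 2) *
          volume (Metric.ball (0 : Plane) 1)) := by
          gcongr
          refine (leafRate_hit_le hμY ha₂ hr0 hR0 hKR).trans ?_
          gcongr
      _ = c * ENNReal.ofReal (r ^ (2 - α)) := by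
          rw [h2, mul_pow, ENNReal.ofReal_mul (by positivity), ENNReal.ofReal_mul (by positivity),
            hc]
          ring
  have hint : IntegrableOn (fun r : ℝ => r ^ (2 - α)) (sizeRange r₀ r₁) := by
    refine integrableOn_rpow_sizeRange ?_ r₀
    rcases le_or_gt α 3 with h | h
    · exact Or.inr (hαr₁ h)
    · exact Or.inl (by linarith)
  refine ne_top_of_le_ne_top ?_ hle
  rw [lintegral_const_mul' _ _ hctop]
  exact ENNReal.mul_ne_top hctop hint.lintegral_lt_top.ne

theorem lintegral_leafRate_hit_ne_zero (hμY : ∀ᵐ F ∂μY, IsGoodGrain a₁ a₂ F) (ha₁ : 0 < a₁)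
    {K : Set Plane} (hne : K.Nonempty) (hK : IsCompact K) (r₀ : SmallSize r₁) :
    ∫⁻ r in sizeRange r₀ r₁, ENNReal.ofReal (r ^ (-α)) * leafRate μY (hitSet K) r ≠ 0 := by
  obtain ⟨p, hp⟩ := hne
  have hm : Measurable fun r : ℝ => ENNReal.ofReal (r ^ (-α)) * leafRate μY (hitSet K) r :=
    Measurable.mul (by fun_prop) (measurable_leafRate (measurableSet_hitSet hK))
  intro h
  rw [setLIntegral_eq_zero_iff (measurableSet_sizeRange _ _) hm] at h
  refine volume_sizeRange_ne_zero r₀ (measure_eq_zero_iff_ae_notMem.mpr ?_)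
  filter_upwards [h] with r hr hmem
  have hr0 : 0 < r := r₀.2.1.trans_le hmem.1
  have h1 : leafRate μY (hitSet {p}) r ≤ leafRate μY (hitSet K) r :=
    lintegral_mono fun F => measure_mono fun x hx =>
      hitSet_mono (Set.singleton_subset_iff.mpr hp) hx
  rw [leafRate_hit_singleton hμY hr0] at h1
  have h2 : leafRate μY (hitSet K) r ≠ 0 := by
    refine ((pos_iff_ne_zero.mpr ?_).trans_le h1).ne'
    exact mul_ne_zero (ENNReal.ofReal_pos.mpr (by positivity)).ne' (meanArea_ne_zero hμY ha₁)
  exact mul_ne_zero (ENNReal.ofReal_pos.mpr (Real.rpow_pos_of_pos hr0 _)).ne' h2 (hr hmem)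

theorem isGoodGrainLaw_scaledGrainLaw (hα : 1 < α) (hαr₁ : α ≤ 3 → r₁ ≠ ⊤)
    (hμY : ∀ᵐ F ∂μY, IsGoodGrain a₁ a₂ F) (ha₁ : 0 < a₁) (ha₂ : 0 < a₂) (r₀ : SmallSize r₁) :
    IsGoodGrainLaw (scaledGrainLaw α r₀ r₁ μY) where
  finite K hK := by
    rw [volume_prod_scaledGrainLaw r₀.2.1 (measurableSet_hitSet hK)]
    exact ENNReal.mul_ne_top ENNReal.ofReal_ne_top
      (lintegral_leafRate_hit_ne_top hαr₁ hμY ha₂ hK r₀)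
  pos p := by
    rw [volume_prod_scaledGrainLaw r₀.2.1 (measurableSet_hitSet isCompact_singleton)]
    exact mul_ne_zero (ENNReal.ofReal_pos.mpr (inv_pos.mpr (integral_sizeRange_pos hα r₀))).ne'
      (lintegral_leafRate_hit_ne_zero hμY ha₁ (Set.singleton_nonempty p) isCompact_singleton r₀)
  boundary p := by
    rw [volume_prod_scaledGrainLaw r₀.2.1 (measurableSet_boundarySet p)]
    refine mul_eq_zero_of_right _ ?_
    rw [← lintegral_zero (μ := volume.restrict (sizeRange r₀ r₁))]
    refine setLIntegral_congr_fun (measurableSet_sizeRange _ _) fun r hr => ?_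
    simp only [leafRate_boundary hμY (r₀.2.1.trans_le hr.1), mul_zero]

theorem exists_tendsto_measure_ratio (hα : 1 < α) (hr₁ : 0 < r₁) (hαr₁ : α ≤ 3 → r₁ ≠ ⊤)
    (hμY : ∀ᵐ F ∂μY, IsGoodGrain a₁ a₂ F) (ha₁ : 0 < a₁) (ha₂ : 0 < a₂) {K : ℕ → Set Plane}
    (hK : ∀ n, IsCompact (K n)) (hne : ∀ n, (K n).Nonempty) (n : ℕ) :
    ∃ ρ : ℝ, Tendsto (fun r₀ : SmallSize r₁ =>
      (((volume : Measure Plane).prod (scaledGrainLaw α r₀ r₁ μY)) (stepSet K n) /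
        ((volume : Measure Plane).prod (scaledGrainLaw α r₀ r₁ μY))
          (hitSet (⋃ l ≤ n, K l))).toReal) (smallSizeToZero r₁) (𝓝 ρ) := by
  have hbot := smallSizeToZero_neBot hr₁
  have hUc : IsCompact (⋃ l ≤ n, K l) := (Set.finite_Iic n).isCompact_biUnion fun l _ => hK l
  have hnU : K n ⊆ ⋃ l ≤ n, K l := fun q hq => Set.mem_biUnion (le_refl n) hq
  have hUne : (⋃ l ≤ n, K l).Nonempty := (hne n).mono hnU
  have hUm := measurableSet_hitSet hUc
  have hSm := measurableSet_stepSet hK n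
  have hSU : stepSet K n ⊆ hitSet (⋃ l ≤ n, K l) := fun q hq =>
    hitSet_mono hnU (coverSet_subset_hitSet (hne n) hq.1)
  have hle : ∀ r, leafRate μY (stepSet K n) r ≤ leafRate μY (hitSet (⋃ l ≤ n, K l)) r :=
    fun r => lintegral_mono fun F => measure_mono fun x hx => hSU hx
  obtain ⟨ℓ, hℓ, hlim⟩ := exists_leafRate_ratio hμY ha₂ hK hne n
  obtain ⟨ρ, hρ⟩ := exists_tendsto_lintegral_ratio (nonempty_of_neBot (smallSizeToZero r₁))
    (f := fun r => ENNReal.ofReal (r ^ (-α)) * leafRate μY (stepSet K n) r)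
    (g := fun r => ENNReal.ofReal (r ^ (-α)) * leafRate μY (hitSet (⋃ l ≤ n, K l)) r)
    (Measurable.mul (by fun_prop) (measurable_leafRate hSm))
    (fun r _ => mul_le_mul_right (hle r) _)
    (lintegral_leafRate_hit_ne_top hαr₁ hμY ha₂ hUc)
    (lintegral_leafRate_hit_ne_zero hμY ha₁ hUne hUc) hℓ (by
      intro ε hε hε'
      obtain ⟨s, hs0, hs⟩ := hlim ε hε hε'
      refine ⟨s, hs0, fun r hr hrs => ?_⟩
      obtain ⟨h1, h2⟩ := hs r hr hrs
      rw [mul_left_comm, mul_left_comm ℓ, mul_left_comm ε, ← mul_add]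
      exact ⟨mul_le_mul_right h1 _, mul_le_mul_right h2 _⟩)
  have hρ1 : ρ ≤ 1 := by
    refine le_of_tendsto' hρ fun r₀ => ENNReal.div_le_of_le_mul ?_
    rw [one_mul]
    exact lintegral_mono fun r => mul_le_mul_right (hle r) _
  refine ⟨ρ.toReal, ?_⟩
  have := (ENNReal.tendsto_toReal (ne_top_of_le_ne_top ENNReal.one_ne_top hρ1)).comp hρ
  refine this.congr fun r₀ => ?_
  rw [volume_prod_scaledGrainLaw r₀.2.1 hSm, volume_prod_scaledGrainLaw r₀.2.1 hUm,
    ENNReal.mul_div_mul_left _ _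
      (ENNReal.ofReal_pos.mpr (inv_pos.mpr (integral_sizeRange_pos hα r₀))).ne'
      ENNReal.ofReal_ne_top]
  rfl

/-- The probabilities `Qfun` of all models with smallest size `r₀` have a common limit. -/
theorem exists_tendsto_Qfun (hα : 1 < α) (hr₁ : 0 < r₁) (hαr₁ : α ≤ 3 → r₁ ≠ ⊤)
    (hμY : ∀ᵐ F ∂μY, IsGoodGrain a₁ a₂ F) (ha₁ : 0 < a₁) (ha₂ : 0 < a₂) (n : ℕ)
    (K : Fin n → Set Plane) (hK : ∀ j, IsCompact (K j)) (hne : ∀ j, (K j).Nonempty) :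
    ∃ q : ℝ, ∀ (Ω : SmallSize r₁ → Type*) [∀ r₀, MeasurableSpace (Ω r₀)]
      (P : ∀ r₀, Measure (Ω r₀)) [∀ r₀, IsProbabilityMeasure (P r₀)]
      (x : ∀ r₀, ℕ → Ω r₀ → Plane) (t : ∀ r₀, ℕ → Ω r₀ → ℝ)
      (X : ∀ r₀, ℕ → Ω r₀ → Closeds Plane),
      (∀ r₀, IsDeadLeaves (P r₀) (scaledGrainLaw α r₀ r₁ μY) (x r₀) (t r₀) (X r₀)) →
      Tendsto (fun r₀ => Qfun (P r₀) (x r₀) (t r₀) (X r₀) K) (smallSizeToZero r₁) (𝓝 q) := by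
  -- the sequence of compact sets is continued arbitrarily
  set K' : ℕ → Set Plane := fun l => if h : l < n then K ⟨l, h⟩ else {0} with hK'
  have hKK' : ∀ j : Fin n, K' j = K j := fun j => by simp [hK']
  have hK'c : ∀ l, IsCompact (K' l) := fun l => by
    by_cases h : l < n
    · simpa [hK', h] using hK _
    · simp [hK', h]
  have hK'ne : ∀ l, (K' l).Nonempty := fun l => by
    by_cases h : l < n
    · simpa [hK', h] using hne _
    · simp [hK', h]
  choose ρ hρ using exists_tendsto_measure_ratio hα hr₁ hαr₁ hμY ha₁ ha₂ hK'c hK'ne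
  refine ⟨∏ j ∈ Finset.range n, ρ j, ?_⟩
  intro Ω _ P _ x t X hmod
  refine (tendsto_finsetProd (Finset.range n) fun j _ => hρ j).congr fun r₀ => ?_
  have h := (hmod r₀).measure_exists_visible
    (isGoodGrainLaw_scaledGrainLaw hα hαr₁ hμY ha₁ ha₂ r₀) hK'c hK'ne n
  simp only [hKK'] at h
  rw [Qfun, measureReal_def, h, ENNReal.toReal_prod]

end Convergence

/-! ### The Kolmogorov extension theorem -/

section Kolmogorov

variable {ι : Type*} {E : ι → Type*}

/-- Compact cylinders with nonempty finite intersections have a nonempty intersection: the points of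
the finite intersections converge, along an ultrafilter, in each relevant coordinate. -/
theorem nonempty_iInter_cylinder [∀ i, TopologicalSpace (E i)] [∀ i, T2Space (E i)]
    (s : ℕ → Finset ι) (K : ∀ n, Set (∀ i : s n, E i)) (hK : ∀ n, IsCompact (K n))
    (hne : ∀ n, (⋂ k ≤ n, cylinder (s k) (K k)).Nonempty) :
    (⋂ k, cylinder (s k) (K k)).Nonempty := by
  classical
  choose f hf using hne
  have hlim : ∀ k, ∃ y ∈ K k, Tendsto (fun n => (s k).restrict (f n)) (hyperfilter ℕ) (𝓝 y) := by
    intro k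
    refine (hK k).ultrafilter_le_nhds ((hyperfilter ℕ).map fun n => (s k).restrict (f n)) ?_
    refine le_principal_iff.mpr ?_
    have h : ∀ᶠ n in (hyperfilter ℕ : Filter ℕ), k ≤ n :=
      Nat.hyperfilter_le_atTop (eventually_ge_atTop k)
    exact h.mono fun n hn => Set.mem_iInter₂.mp (hf n) k hn
  choose y hyK hy using hlim
  have hcoord : ∀ k, ∀ i : s k, Tendsto (fun n => f n i) (hyperfilter ℕ) (𝓝 (y k i)) :=
    fun k i => (tendsto_pi_nhds.mp (hy k)) i
  let g : ∀ i, E i := fun i =>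
    if h : ∃ a, Tendsto (fun n => f n i) (hyperfilter ℕ) (𝓝 a) then h.choose else f 0 i
  refine ⟨g, Set.mem_iInter.mpr fun k => ?_⟩
  have hg : (s k).restrict g = y k := by
    funext i
    have h : ∃ a, Tendsto (fun n => f n i) (hyperfilter ℕ) (𝓝 a) := ⟨_, hcoord k i⟩
    have hgi : g i = h.choose := dif_pos h
    exact hgi.trans (tendsto_nhds_unique h.choose_spec (hcoord k i))
  rw [mem_cylinder, hg]
  exact hyK k

variable [∀ i, TopologicalSpace (E i)] [∀ i, MeasurableSpace (E i)] [∀ i, BorelSpace (E i)]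
  [∀ i, PolishSpace (E i)] {P : ∀ J : Finset ι, Measure (∀ j : J, E j)}

theorem tendsto_projectiveFamilyContent_zero [∀ J, IsFiniteMeasure (P J)]
    (hP : IsProjectiveMeasureFamily P) {A : ℕ → Set (∀ i, E i)}
    (hA : ∀ n, A n ∈ measurableCylinders E) (hanti : Antitone A) (hinter : ⋂ n, A n = ∅) :
    Tendsto (fun n => projectiveFamilyContent hP (A n)) atTop (𝓝 0) := by
  choose s S hS hAS using fun n => (mem_measurableCylinders (A n)).mp (hA n)
  refine ENNReal.tendsto_atTop_zero.mpr fun ε hε => ?_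
  obtain ⟨δ, hδ0, hδ⟩ := ENNReal.exists_pos_sum_of_countable' hε.ne' ℕ
  choose K hKS hKc hKcl hK using fun n =>
    (hS n).exists_isCompact_isClosed_sdiff_lt (measure_ne_top (P (s n)) _) (hδ0 n).ne'
  obtain ⟨N, hN⟩ : ∃ N, ⋂ k ≤ N, cylinder (s k) (K k) = ∅ := by
    by_contra! hne
    obtain ⟨f, hf⟩ := nonempty_iInter_cylinder s K hKc hne
    refine Set.notMem_empty f (hinter ▸ Set.mem_iInter.mpr fun n => ?_)
    rw [hAS n]
    exact hKS n (Set.mem_iInter.mp hf n)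
  have hD : ∀ n, cylinder (s n) (S n \ K n) ∈ measurableCylinders E := fun n =>
    cylinder_mem_measurableCylinders _ _ ((hS n).diff (hKcl n).measurableSet)
  have hsub : A N ⊆ ⋃ k ≤ N, cylinder (s k) (S k \ K k) := by
    intro f hf
    have hfN : f ∉ ⋂ k ≤ N, cylinder (s k) (K k) := hN ▸ Set.notMem_empty f
    simp only [Set.mem_iInter, not_forall] at hfN
    obtain ⟨k, hk, hfk⟩ := hfN
    have hfS : f ∈ cylinder (s k) (S k) := hAS k ▸ hanti hk hf
    exact Set.mem_biUnion hk ⟨hfS, hfk⟩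
  have hU : (⋃ k ≤ N, cylinder (s k) (S k \ K k)) ∈ measurableCylinders E := by
    have := isSetRing_measurableCylinders.biUnion_mem (Finset.range (N + 1)) fun k _ => hD k
    simpa only [Finset.mem_range_succ_iff] using this
  refine ⟨N, fun n hn => ?_⟩
  calc projectiveFamilyContent hP (A n) ≤ projectiveFamilyContent hP (A N) :=
        projectiveFamilyContent_mono hP (hA n) (hA N) (hanti hn)
    _ ≤ projectiveFamilyContent hP (⋃ k ≤ N, cylinder (s k) (S k \ K k)) :=
        projectiveFamilyContent_mono hP (hA N) hU hsub
    _ ≤ ∑ k ∈ Finset.range (N + 1), projectiveFamilyContent hP (cylinder (s k) (S k \ K k)) :=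
        projectiveFamilyContent_iUnion_le hP hD N
    _ ≤ ∑ k ∈ Finset.range (N + 1), δ k := by
        refine Finset.sum_le_sum fun k _ => ?_
        rw [projectiveFamilyContent_cylinder hP ((hS k).diff (hKcl k).measurableSet)]
        exact (hK k).le
    _ ≤ ε := (ENNReal.sum_le_tsum _).trans hδ.le

/-- A projective family of finite measures on Polish spaces has a projective limit. -/
theorem exists_isProjectiveLimit [∀ J, IsFiniteMeasure (P J)] (hP : IsProjectiveMeasureFamily P) :
    ∃ μ : Measure (∀ i, E i), IsProjectiveLimit μ P := by
  have hsub : (projectiveFamilyContent hP).IsSigmaSubadditive :=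
    isSigmaSubadditive_of_addContent_iUnion_eq_tsum isSetRing_measurableCylinders
      fun f hf hfU hdisj => addContent_iUnion_eq_sum_of_tendsto_zero isSetRing_measurableCylinders
        _ (fun _ _ => projectiveFamilyContent_ne_top hP)
        (fun _ hA hanti hinter => tendsto_projectiveFamilyContent_zero hP hA hanti hinter)
        hf hfU hdisj
  refine ⟨(projectiveFamilyContent hP).measure isSetSemiring_measurableCylinders
    generateFrom_measurableCylinders.ge hsub, fun I => ?_⟩
  ext T hT
  rw [Measure.map_apply (Finset.measurable_restrict I) hT, AddContent.measure_eq, ← cylinder,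
    projectiveFamilyContent_cylinder hP hT]
  · exact generateFrom_measurableCylinders.symm
  · exact cylinder_mem_measurableCylinders _ _ hT

end Kolmogorov

/-! ### The visible leaf at a point -/

section Owner

variable {x : ℕ → Plane} {t : ℕ → ℝ} {X : ℕ → Closeds Plane} {p : Plane}

/-- The point `p` is on the boundary of no leaf, and some leaf has hit it before the time `0`. -/
structure IsGenericAt (x : ℕ → Plane) (t : ℕ → ℝ) (X : ℕ → Closeds Plane) (p : Plane) : Prop where
  boundary : ∀ i, (x i, X i) ∉ boundarySet p
  exists_hit : ∃ i, (x i, X i) ∈ hitSet {p} ∧ t i < 0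

theorem mem_hitSet_singleton {q : Plane × Closeds Plane} :
    q ∈ hitSet {p} ↔ p - q.1 ∈ closure (interior (q.2 : Set Plane)) := by
  simp [hitSet]

theorem IsGenericAt.mem_interior (h : IsGenericAt x t X p) {i : ℕ}
    (hi : p - x i ∈ (X i : Set Plane)) : p - x i ∈ interior (X i : Set Plane) := by
  by_contra hint
  refine h.boundary i ?_
  change p - x i ∈ frontier (X i : Set Plane)
  rw [(X i).isClosed.frontier_eq]
  exact ⟨hi, hint⟩

theorem IsGenericAt.notMem_closure_visiblePart (h : IsGenericAt x t X p)
    (hreg : IsRegularConfig x t X) {i j : ℕ} (hi : p ∈ interior (visiblePart x t X i))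
    (hij : j ≠ i) : p ∉ closure (visiblePart x t X j) := by
  obtain ⟨hti, hpi, hlater⟩ := (mem_interior_visiblePart hreg.locallyFinite i p).mp hi
  have hc : ∀ k, Continuous fun y : Plane => y - x k := fun k => by fun_prop
  rcases lt_or_gt_of_ne (hreg.injective j i hij) with hlt | hlt
  · -- the open set `x i + int X i` contains `p` and hides the leaf `j`
    intro hcl
    obtain ⟨y, hy, hyV⟩ := mem_closure_iff.mp hcl _ (isOpen_interior.preimage (hc i)) hpi
    exact hyV.2.2 i hlt (lt_of_le_of_ne hti (hreg.ne_zero i)) (mem_vadd_iff_sub_mem.mpr hy)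
  · by_cases htj : t j ≤ 0
    · intro hcl
      have hsub : visiblePart x t X j ⊆ (fun y => y - x j) ⁻¹' (X j : Set Plane) :=
        fun y hy => mem_vadd_iff_sub_mem.mp hy.2.1
      have hpj : p - x j ∈ (X j : Set Plane) :=
        closure_minimal hsub ((X j).isClosed.preimage (hc j)) hcl
      exact hlater j hlt (lt_of_le_of_ne htj (hreg.ne_zero j)) (subset_closure (h.mem_interior hpj))
    · have hempty : visiblePart x t X j = ∅ := by
        rw [Set.eq_empty_iff_forall_notMem]
        exact fun y hy => htj hy.1
      simp [hempty]

theorem IsGenericAt.eq_of_mem_interior (h : IsGenericAt x t X p) (hreg : IsRegularConfig x t X)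
    {i j : ℕ} (hi : p ∈ interior (visiblePart x t X i)) (hj : p ∈ interior (visiblePart x t X j)) :
    j = i := by
  by_contra hij
  exact h.notMem_closure_visiblePart hreg hi hij (subset_closure (interior_subset hj))

theorem IsGenericAt.coloredTess_eq (h : IsGenericAt x t X p) (hreg : IsRegularConfig x t X)
    {i : ℕ} (hi : p ∈ interior (visiblePart x t X i)) (c : ℕ → Plane → ℝ) :
    coloredTess (visiblePart x t X) c p = c i p := by
  have hfr : p ∉ tessBoundary (visiblePart x t X) := by
    rw [tessBoundary, Set.mem_iUnion]
    rintro ⟨j, hj⟩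
    by_cases hij : j = i
    · subst hij
      exact hj.2 hi
    · exact h.notMem_closure_visiblePart hreg hi hij hj.1
  have hset : {j | p ∈ interior (visiblePart x t X j)} = {i} := by
    ext j
    refine ⟨fun hj => h.eq_of_mem_interior hreg hi hj, ?_⟩
    rintro rfl
    exact hi
  rw [coloredTess, if_neg hfr, hset, csInf_singleton]

/-- The last leaf that hits a generic point is the visible one. -/
theorem IsGenericAt.exists_mem_interior (h : IsGenericAt x t X p) (hreg : IsRegularConfig x t X) :
    ∃ i, p ∈ interior (visiblePart x t X i) := by
  obtain ⟨i₀, hi₀, ht₀⟩ := h.exists_hit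
  have hfin : {j | (x j, X j) ∈ hitSet {p} ∧ t j ∈ Set.Ico (t i₀) 0}.Finite :=
    (hreg.locallyFinite ‖p‖ (t i₀)).subset fun j hj => ⟨hitSet_mono (by simp) hj.1, hj.2⟩
  obtain ⟨i, ⟨hi, hti⟩, hmax⟩ := Set.exists_max_image _ t hfin ⟨i₀, hi₀, le_refl _, ht₀⟩
  refine ⟨i, (mem_interior_visiblePart hreg.locallyFinite i p).mpr ⟨hti.2.le, ?_, ?_⟩⟩
  · exact h.mem_interior
      (closure_minimal interior_subset (X i).isClosed (mem_hitSet_singleton.mp hi))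
  · intro j hij hj hpj
    exact absurd (hmax j ⟨mem_hitSet_singleton.mpr hpj, hti.1.trans hij.le, hj⟩) (not_le.mpr hij)

end Owner

/-! ### The order pattern of the visible leaves -/

section Pattern

/-- The partitions of a finite set of points into nonempty blocks that are numbered `0, …, k - 1`:
the block of number `l` is the preimage of `l`. -/
abbrev OrderedPartition (J : Finset Plane) : Type :=
  Σ k : Fin (J.card + 1), {g : J → Fin k // Function.Surjective g}

variable {J : Finset Plane}

/-- The blocks of an ordered partition, as sets of points. -/
def OrderedPartition.block (π : OrderedPartition J) (l : Fin π.1) : Set Plane :=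
  Subtype.val '' (π.2.1 ⁻¹' {l})

theorem OrderedPartition.block_nonempty (π : OrderedPartition J) (l : Fin π.1) :
    (π.block l).Nonempty := by
  obtain ⟨p, hp⟩ := π.2.2 l
  exact ⟨p, p, hp, rfl⟩

theorem OrderedPartition.isCompact_block (π : OrderedPartition J) (l : Fin π.1) :
    IsCompact (π.block l) :=
  ((Set.toFinite (π.2.1 ⁻¹' {l})).image _).isCompact

theorem OrderedPartition.mem_block (π : OrderedPartition J) (p : J) : p.1 ∈ π.block (π.2.1 p) :=
  ⟨p, rfl, rfl⟩

/-- The configurations whose leaves `i 0, i 1, …` fall in this order before the time `0`, cover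
the sets `K 0, K 1, …`, and are followed by no leaf that hits these sets. -/
def patternSet {n : ℕ} (K : Fin n → Set Plane) (i : Fin n → ℕ) :
    Set (ℕ → (Plane × ℝ) × Closeds Plane) :=
  {z | (∀ l m, l < m → (z (i l)).1.2 < (z (i m)).1.2) ∧ (∀ l, (z (i l)).1.2 < 0) ∧
    (∀ l, ((z (i l)).1.1, (z (i l)).2) ∈ coverSet (K l)) ∧
    ∀ l j, (z (i l)).1.2 < (z j).1.2 → (z j).1.2 < 0 → ((z j).1.1, (z j).2) ∉ hitSet (K l)}

theorem measurableSet_forall {E ι : Type*} [MeasurableSpace E] [Countable ι] {p : ι → E → Prop}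
    (h : ∀ i, MeasurableSet {z | p i z}) : MeasurableSet {z | ∀ i, p i z} := by
  have : {z | ∀ i, p i z} = ⋂ i, {z | p i z} := by
    ext z
    simp
  rw [this]
  exact MeasurableSet.iInter h

theorem measurableSet_patternSet {n : ℕ} {K : Fin n → Set Plane} (hK : ∀ l, IsCompact (K l))
    (i : Fin n → ℕ) : MeasurableSet (patternSet K i) := by
  have ht : ∀ j, Measurable fun z : ℕ → (Plane × ℝ) × Closeds Plane => (z j).1.2 := fun j =>
    (measurable_pi_apply j).fst.snd
  have hl : ∀ j, Measurable fun z : ℕ → (Plane × ℝ) × Closeds Plane => ((z j).1.1, (z j).2) :=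
    fun j => (measurable_pi_apply j).fst.fst.prodMk (measurable_pi_apply j).snd
  refine MeasurableSet.inter ?_ (MeasurableSet.inter ?_ (MeasurableSet.inter ?_ ?_))
  · refine measurableSet_forall fun l => measurableSet_forall fun m => MeasurableSet.imp
      (MeasurableSet.const _) (measurableSet_lt (ht _) (ht _))
  · exact measurableSet_forall fun l => measurableSet_lt (ht _) measurable_const
  · exact measurableSet_forall fun l => hl _ (measurableSet_coverSet (hK l))
  · exact measurableSet_forall fun l => measurableSet_forall fun j =>
      (measurableSet_lt (ht _) (ht _)).imp ((measurableSet_lt (ht _) measurable_const).imp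
        (hl _ (measurableSet_hitSet (hK l))).compl)

variable {x : ℕ → Plane} {t : ℕ → ℝ} {X : ℕ → Closeds Plane}

theorem mem_patternSet_iff (hreg : IsRegularConfig x t X) {n : ℕ} {K : Fin n → Set Plane}
    (hne : ∀ l, (K l).Nonempty) (i : Fin n → ℕ) :
    (fun j => ((x j, t j), X j)) ∈ patternSet K i ↔ StrictMono (fun l => t (i l)) ∧
      (∀ l, t (i l) ≤ 0) ∧ ∀ l, K l ⊆ interior (visiblePart x t X (i l)) := by
  simp only [subset_interior_visiblePart hreg.locallyFinite (hne _)]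
  constructor
  · rintro ⟨h1, h2, h3, h4⟩
    exact ⟨fun l m hlm => h1 l m hlm, fun l => (h2 l).le, fun l => ⟨(h2 l).le, h3 l, h4 l⟩⟩
  · rintro ⟨h1, h2, h3⟩
    exact ⟨fun l m hlm => h1 hlm, fun l => lt_of_le_of_ne (h2 l) (hreg.ne_zero _),
      fun l => (h3 l).2.1, fun l => (h3 l).2.2⟩

/-- The visible leaves at the points of `J`, in the order of their times. -/
theorem exists_mem_patternSet (hreg : IsRegularConfig x t X) (hJ : ∀ p ∈ J, IsGenericAt x t X p) :
    ∃ (π : OrderedPartition J) (i : Fin π.1 → ℕ),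
      (fun j => ((x j, t j), X j)) ∈ patternSet π.block i := by
  classical
  choose o ho using fun p : J => (hJ p p.2).exists_mem_interior hreg
  set T : Finset ℝ := Finset.univ.image fun p : J => t (o p) with hT
  have hTJ : T.card < J.card + 1 := by
    refine Nat.lt_succ_of_le (Finset.card_image_le.trans ?_)
    rw [Finset.card_univ, Fintype.card_coe]
  have hoT : ∀ p, t (o p) ∈ T := fun p => Finset.mem_image_of_mem _ (Finset.mem_univ p)
  let e : Fin T.card ≃o T := T.orderIsoOfFin rfl
  have hpre : ∀ l : Fin T.card, ∃ p : J, t (o p) = e l := fun l => by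
    obtain ⟨p, -, hp⟩ := Finset.mem_image.mp (e l).2
    exact ⟨p, hp⟩
  choose s hs using hpre
  have hg : ∀ p : J, (e (e.symm ⟨t (o p), hoT p⟩) : ℝ) = t (o p) := fun p => by simp
  refine ⟨⟨⟨T.card, hTJ⟩, fun p => e.symm ⟨t (o p), hoT p⟩, fun l => ⟨s l, ?_⟩⟩,
    fun l => o (s l), ?_⟩
  · rw [OrderIso.symm_apply_eq]
    exact Subtype.ext (hs l)
  · rw [mem_patternSet_iff hreg (OrderedPartition.block_nonempty _)]
    refine ⟨fun l m hlm => ?_, fun l => ?_, fun l => ?_⟩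
    · simp only [hs]
      exact e.strictMono hlm
    · exact (interior_subset (ho (s l))).1
    · rintro _ ⟨p, hp, rfl⟩
      have hp' : e.symm ⟨t (o p), hoT p⟩ = l := hp
      have hop : o (s l) = o p := by
        by_contra hne
        refine hreg.injective _ _ hne ?_
        rw [hs, ← hp', hg]
      rw [hop]
      exact ho p

/-- A configuration determines the ordered partition and the visible leaves: the visible leaf at a
point is unique, and the numbering of the blocks is forced by the order of the times. -/
theorem eq_of_mem_patternSet (hreg : IsRegularConfig x t X) (hJ : ∀ p ∈ J, IsGenericAt x t X p)
    {a b : Σ π : OrderedPartition J, (Fin π.1 → ℕ)}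
    (ha : (fun j => ((x j, t j), X j)) ∈ patternSet a.1.block a.2)
    (hb : (fun j => ((x j, t j), X j)) ∈ patternSet b.1.block b.2) : a = b := by
  rw [mem_patternSet_iff hreg (OrderedPartition.block_nonempty _)] at ha hb
  obtain ⟨⟨k, g, hg⟩, i⟩ := a
  obtain ⟨⟨k', g', hg'⟩, i'⟩ := b
  obtain ⟨hm, -, hV⟩ := ha
  obtain ⟨hm', -, hV'⟩ := hb
  have htinj : Function.Injective t := fun i j hij => by
    by_contra hne
    exact hreg.injective i j hne hij
  have hio : ∀ p : J, i (g p) = i' (g' p) := fun p =>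
    (hJ p p.2).eq_of_mem_interior hreg (hV' (g' p) ⟨p, rfl, rfl⟩) (hV (g p) ⟨p, rfl, rfl⟩)
  have hrange : Set.range (fun l => t (i l)) = Set.range fun l => t (i' l) := by
    ext u
    constructor
    · rintro ⟨l, rfl⟩
      obtain ⟨p, rfl⟩ := hg l
      exact ⟨g' p, by simp only [hio]⟩
    · rintro ⟨l, rfl⟩
      obtain ⟨p, rfl⟩ := hg' l
      exact ⟨g p, by simp only [hio]⟩
  have hk : k = k' := by
    have h1 := Set.ncard_range_of_injective hm.injective
    have h2 := Set.ncard_range_of_injective hm'.injective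
    rw [hrange, h2] at h1
    simpa [Fin.ext_iff] using h1.symm
  subst hk
  have hti := (hm.range_inj hm').mp hrange
  have hii : i = i' := funext fun l => htinj (congrFun hti l)
  subst hii
  have hgg : g = g' := funext fun p => hm.injective (congrArg t (hio p))
  subst hgg
  rfl

end Pattern

/-! ### The law of the colored process -/

section ColoredLaw

variable {Ω : Type*} [MeasurableSpace Ω] {P : Measure Ω}
  {μ : Measure (Closeds Plane)} {γ : Measure (Plane → ℝ)}
  {x : ℕ → Ω → Plane} {t : ℕ → Ω → ℝ} {X : ℕ → Ω → Closeds Plane} {C : ℕ → Ω → Plane → ℝ}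

theorem IsDeadLeaves.ae_isGenericAt [IsProbabilityMeasure P]
    (h : IsDeadLeaves P μ x t X) (hμ : IsGoodGrainLaw μ) (p : Plane) :
    ∀ᵐ ω ∂P, IsGenericAt (fun i => x i ω) (fun i => t i ω) (fun i => X i ω) p := by
  have := h.isProbabilityMeasure
  have hP := h.isMarkedPoisson
  have h1 := hP.ae_forall_notMem (B := boundarySet p ×ˢ Set.univ)
    ((measurableSet_boundarySet p).prod MeasurableSet.univ) (by
      rw [Measure.prod_prod, hμ.boundary, zero_mul])
  have h2 := hP.ae_exists_lt (measurableSet_hitSet isCompact_singleton)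
    (hμ.finite {p} isCompact_singleton) (hμ.pos p) 0
  filter_upwards [h1, h2] with ω h1 h2
  exact ⟨fun i hi => h1 i ⟨hi, trivial⟩, h2⟩

/-- The joint law of the values at the points of `J` of independent fields of law `γ`, one for each
block of an ordered partition of `J`. -/
noncomputable def patternLaw (γ : Measure (Plane → ℝ)) {J : Finset Plane}
    (π : OrderedPartition J) : Measure (J → ℝ) :=
  (Measure.pi fun _ : Fin π.1 => γ).map fun c p => c (π.2.1 p) p

variable {J : Finset Plane}

theorem measurable_patternEval (π : OrderedPartition J) :
    Measurable fun (c : Fin π.1 → Plane → ℝ) (p : J) => c (π.2.1 p) p :=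
  measurable_pi_lambda _ fun p => (measurable_pi_apply p.1).comp (measurable_pi_apply (π.2.1 p))

instance [IsProbabilityMeasure γ] (π : OrderedPartition J) :
    IsProbabilityMeasure (patternLaw γ π) :=
  Measure.isProbabilityMeasure_map (measurable_patternEval π).aemeasurable

theorem IsColoredDeadLeaves.map_colors (h : IsColoredDeadLeaves P μ γ x t X C)
    (π : OrderedPartition J) {i : Fin π.1 → ℕ} (hi : Function.Injective i) :
    P.map (fun ω (p : J) => C (i (π.2.1 p)) ω p) = patternLaw γ π := by
  have hCi : ∀ l, Measurable (C (i l)) := fun l => h.color_measurable _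
  have hlaw := (h.color_iIndep.precomp hi).map_fun_eq_pi_map fun l => (hCi l).aemeasurable
  simp only [h.color_law] at hlaw
  rw [patternLaw, ← hlaw, Measure.map_map (measurable_patternEval π) (measurable_pi_lambda _ hCi)]
  rfl

/-- Given the order pattern of the visible leaves, the colors have the law `patternLaw`: the fields
of the visible leaves are independent of the leaves. -/
theorem IsColoredDeadLeaves.measure_pattern_inter (h : IsColoredDeadLeaves P μ γ x t X C)
    (π : OrderedPartition J) (i : Fin π.1 → ℕ) {B : Set (J → ℝ)} (hB : MeasurableSet B) :
    P ({ω | (fun j => ((x j ω, t j ω), X j ω)) ∈ patternSet π.block i} ∩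
      {ω | (fun p : J => C (i (π.2.1 p)) ω p) ∈ B}) =
    P {ω | (fun j => ((x j ω, t j ω), X j ω)) ∈ patternSet π.block i} * patternLaw γ π B := by
  by_cases hi : Function.Injective i
  · have hm : Measurable fun (c : ℕ → Plane → ℝ) (p : J) => c (i (π.2.1 p)) p :=
      measurable_pi_lambda _ fun p =>
        (measurable_pi_apply p.1).comp (measurable_pi_apply (i (π.2.1 p)))
    have hmC : Measurable fun ω (p : J) => C (i (π.2.1 p)) ω p :=
      hm.comp (measurable_pi_lambda _ h.color_measurable)
    rw [← h.map_colors π hi, Measure.map_apply hmC hB]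
    exact h.leaves_indep_colors.measure_inter_preimage_eq_mul _ _
      (measurableSet_patternSet π.isCompact_block i) (hm hB)
  · -- the times of the chosen leaves are distinct, so that `i` is injective on the event
    have hempty : {ω | (fun j => ((x j ω, t j ω), X j ω)) ∈ patternSet π.block i} = ∅ := by
      rw [Set.eq_empty_iff_forall_notMem]
      intro ω hω
      have hmono : StrictMono fun l => t (i l) ω := fun l m hlm => hω.1 l m hlm
      exact hi fun l m hlm => hmono.injective (by simp only [hlm])
    rw [hempty, Set.empty_inter, measure_empty, zero_mul]

/-- The event that the visible leaves at the points of `J` are the leaves `a.2 0, a.2 1, …`, which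
show at the blocks of the ordered partition `a.1`. -/
def patternEvent (x : ℕ → Ω → Plane) (t : ℕ → Ω → ℝ) (X : ℕ → Ω → Closeds Plane)
    (a : Σ π : OrderedPartition J, (Fin π.1 → ℕ)) : Set Ω :=
  {ω | (fun j => ((x j ω, t j ω), X j ω)) ∈ patternSet a.1.block a.2}

theorem IsDeadLeaves.measurableSet_patternEvent (h : IsDeadLeaves P μ x t X)
    (a : Σ π : OrderedPartition J, (Fin π.1 → ℕ)) : MeasurableSet (patternEvent x t X a) := by
  have hZ : Measurable fun ω (j : ℕ) => ((x j ω, t j ω), X j ω) :=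
    measurable_pi_lambda _ fun j => (h.poisson.measurable j).prodMk (h.grain_measurable j)
  exact hZ (measurableSet_patternSet a.1.isCompact_block a.2)

variable [IsProbabilityMeasure P]

theorem IsDeadLeaves.ae_generic (h : IsDeadLeaves P μ x t X) (hμ : IsGoodGrainLaw μ)
    (J : Finset Plane) : ∀ᵐ ω ∂P,
      IsRegularConfig (fun i => x i ω) (fun i => t i ω) (fun i => X i ω) ∧
      ∀ p ∈ J, IsGenericAt (fun i => x i ω) (fun i => t i ω) (fun i => X i ω) p :=
  (h.ae_isRegularConfig hμ).and ((ae_ball_iff J.countable_toSet).mpr fun p _ =>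
    h.ae_isGenericAt hμ p)

theorem IsDeadLeaves.pairwise_aedisjoint_patternEvent (h : IsDeadLeaves P μ x t X)
    (hμ : IsGoodGrainLaw μ) : Pairwise fun a b : Σ π : OrderedPartition J, (Fin π.1 → ℕ) =>
      AEDisjoint P (patternEvent x t X a) (patternEvent x t X b) := by
  intro a b hab
  refine measure_eq_zero_iff_ae_notMem.mpr ?_
  filter_upwards [h.ae_generic hμ J] with ω hω hmem
  exact hab (eq_of_mem_patternSet hω.1 hω.2 hmem.1 hmem.2)

theorem IsDeadLeaves.iUnion_patternEvent (h : IsDeadLeaves P μ x t X) (hμ : IsGoodGrainLaw μ) :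
    (⋃ a : Σ π : OrderedPartition J, (Fin π.1 → ℕ), patternEvent x t X a) =ᵐ[P] Set.univ := by
  filter_upwards [h.ae_generic hμ J] with ω hω
  refine propext ⟨fun _ => trivial, fun _ => ?_⟩
  obtain ⟨π, i, hi⟩ := exists_mem_patternSet hω.1 hω.2
  exact Set.mem_iUnion.mpr ⟨⟨π, i⟩, hi⟩

theorem IsDeadLeaves.ae_coloredDeadLeaves_eq (h : IsDeadLeaves P μ x t X) (hμ : IsGoodGrainLaw μ)
    (a : Σ π : OrderedPartition J, (Fin π.1 → ℕ)) :
    ∀ᵐ ω ∂P, ω ∈ patternEvent x t X a →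
      (fun p : J => coloredDeadLeaves x t X C p ω) = fun p : J => C (a.2 (a.1.2.1 p)) ω p := by
  filter_upwards [h.ae_generic hμ J] with ω hω hmem
  funext p
  have hV := ((mem_patternSet_iff hω.1 a.1.block_nonempty a.2).mp hmem).2.2
  exact (hω.2 p p.2).coloredTess_eq hω.1 (hV _ (a.1.mem_block p)) _

theorem IsColoredDeadLeaves.aemeasurable_coloredDeadLeaves
    (h : IsColoredDeadLeaves P μ γ x t X C) (hμ : IsGoodGrainLaw μ) (J : Finset Plane) :
    AEMeasurable (fun ω (p : J) => coloredDeadLeaves x t X C p ω) P := by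
  have hdl := h.toIsDeadLeaves
  rw [← Measure.restrict_univ (μ := P),
    ← Measure.restrict_congr_set (hdl.iUnion_patternEvent hμ (J := J)), aemeasurable_iUnion_iff]
  intro a
  refine ⟨fun ω (p : J) => C (a.2 (a.1.2.1 p)) ω p, measurable_pi_lambda _ fun p =>
    (measurable_pi_apply p.1).comp (h.color_measurable _), ?_⟩
  exact (ae_restrict_iff' (hdl.measurableSet_patternEvent a)).mpr (hdl.ae_coloredDeadLeaves_eq hμ a)

theorem IsDeadLeaves.measure_iUnion_patternEvent (h : IsDeadLeaves P μ x t X)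
    (hμ : IsGoodGrainLaw μ) (π : OrderedPartition J) :
    P (⋃ i : Fin π.1 → ℕ, patternEvent x t X ⟨π, i⟩) = ENNReal.ofReal (Qfun P x t X π.block) := by
  rw [Qfun, ofReal_measureReal]
  refine measure_congr ?_
  filter_upwards [h.ae_isRegularConfig hμ] with ω hω
  refine propext ?_
  refine Set.mem_iUnion.trans (exists_congr fun i => ?_)
  exact mem_patternSet_iff hω π.block_nonempty i

/-- The law of the values of the colored process at finitely many points is a mixture of the laws
`patternLaw`, and the weights are probabilities `Qfun` for finite sets. -/
theorem IsColoredDeadLeaves.map_coloredDeadLeaves_apply (h : IsColoredDeadLeaves P μ γ x t X C)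
    (hμ : IsGoodGrainLaw μ) (J : Finset Plane) {B : Set (J → ℝ)} (hB : MeasurableSet B) :
    P.map (fun ω (p : J) => coloredDeadLeaves x t X C p ω) B =
      ∑ π : OrderedPartition J, ENNReal.ofReal (Qfun P x t X π.block) * patternLaw γ π B := by
  have hdl := h.toIsDeadLeaves
  have hv := h.aemeasurable_coloredDeadLeaves hμ J
  have hdisj := hdl.pairwise_aedisjoint_patternEvent hμ (J := J)
  have hG : ∀ a, NullMeasurableSet (patternEvent (J := J) x t X a) P := fun a =>
    (hdl.measurableSet_patternEvent a).nullMeasurableSet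
  rw [Measure.map_apply_of_aemeasurable hv hB]
  set S := (fun ω (p : J) => coloredDeadLeaves x t X C p ω) ⁻¹' B with hS
  have hSm : NullMeasurableSet S P := hv.nullMeasurableSet_preimage hB
  calc P S = P (⋃ a : Σ π : OrderedPartition J, (Fin π.1 → ℕ), patternEvent x t X a ∩ S) := by
        rw [← Set.iUnion_inter]
        refine measure_congr ?_
        have := (hdl.iUnion_patternEvent hμ (J := J)).inter (ae_eq_refl S)
        rw [Set.univ_inter] at this
        exact this.symm
    _ = ∑' a : Σ π : OrderedPartition J, (Fin π.1 → ℕ), P (patternEvent x t X a ∩ S) :=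
        measure_iUnion₀ (fun a b hab => (hdisj hab).mono Set.inter_subset_left
          Set.inter_subset_left) fun a => (hG a).inter hSm
    _ = ∑' a : Σ π : OrderedPartition J, (Fin π.1 → ℕ),
          P (patternEvent x t X a) * patternLaw γ a.1 B := by
        refine tsum_congr fun a => ?_
        refine Eq.trans (measure_congr ?_) (h.measure_pattern_inter a.1 a.2 hB)
        filter_upwards [hdl.ae_coloredDeadLeaves_eq (C := C) hμ a] with ω hω
        refine propext (and_congr_right fun hmem => ?_)
        change (fun p : J => coloredDeadLeaves x t X C p ω) ∈ B ↔ _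
        rw [hω hmem]
        rfl
    _ = ∑ π : OrderedPartition J, ENNReal.ofReal (Qfun P x t X π.block) * patternLaw γ π B := by
        rw [ENNReal.tsum_sigma', tsum_fintype]
        refine Finset.sum_congr rfl fun π _ => ?_
        change ∑' i : Fin π.1 → ℕ, P (patternEvent x t X ⟨π, i⟩) * patternLaw γ π B = _
        rw [ENNReal.tsum_mul_right, ← hdl.measure_iUnion_patternEvent hμ π,
          measure_iUnion₀ _ fun i => hG ⟨π, i⟩]
        intro i j hij
        exact hdisj fun h => hij (by simpa using h)

end ColoredLaw

/-! ### The limit process -/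

section LimitProcess

/-- A setwise limit of projective families of probability measures is such a family. -/
theorem isProjectiveMeasureFamily_of_tendsto {ι κ : Type*} {E : κ → Type*}
    [∀ i, MeasurableSpace (E i)] {l : Filter ι} [l.NeBot]
    {ν : ι → ∀ J : Finset κ, Measure (∀ j : J, E j)} {L : ∀ J : Finset κ, Measure (∀ j : J, E j)}
    [∀ i J, IsProbabilityMeasure (ν i J)] (hν : ∀ i, IsProjectiveMeasureFamily (ν i))
    (hlim : ∀ J B, MeasurableSet B → Tendsto (fun i => ν i J B) l (𝓝 (L J B))) :
    (∀ J, IsProbabilityMeasure (L J)) ∧ IsProjectiveMeasureFamily L := by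
  refine ⟨fun J => ⟨?_⟩, fun I J hJI => ?_⟩
  · refine tendsto_nhds_unique (hlim J _ MeasurableSet.univ) ?_
    simp only [measure_univ]
    exact tendsto_const_nhds
  · ext B hB
    have hm : Measurable (Finset.restrict₂ (π := E) hJI) := Finset.measurable_restrict₂ hJI
    rw [Measure.map_apply hm hB]
    refine tendsto_nhds_unique (hlim J B hB) ((hlim I _ (hm hB)).congr fun i => ?_)
    rw [hν i I J hJI, Measure.map_apply hm hB]

theorem tendstoInDistribution_of_tendsto_measure {ι : Type*} {Ω : ι → Type*} {Ω' E : Type*}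
    [∀ i, MeasurableSpace (Ω i)] [MeasurableSpace Ω'] [TopologicalSpace E]
    [HasOuterApproxClosed E] [MeasurableSpace E] [BorelSpace E]
    {P : ∀ i, Measure (Ω i)} [∀ i, IsProbabilityMeasure (P i)] {P' : Measure Ω'}
    [IsProbabilityMeasure P'] {v : ∀ i, Ω i → E} {Z : Ω' → E} {l : Filter ι}
    [l.IsCountablyGenerated] [l.NeBot] (hv : ∀ i, AEMeasurable (v i) (P i))
    (hZ : AEMeasurable Z P')
    (hlim : ∀ B, MeasurableSet B → Tendsto (fun i => (P i).map (v i) B) l (𝓝 (P'.map Z B))) :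
    TendstoInDistribution v l Z P P' where
  forall_aemeasurable := hv
  aemeasurable_limit := hZ
  tendsto := tendsto_of_forall_isOpen_le_liminf' fun G hG =>
    (hlim G hG.measurableSet).liminf_eq.symm.le

theorem isProjectiveMeasureFamily_map {Ω κ E : Type*} [MeasurableSpace Ω] [MeasurableSpace E]
    {P : Measure Ω} {v : κ → Ω → E}
    (hv : ∀ J : Finset κ, AEMeasurable (fun ω (j : J) => v j ω) P) :
    IsProjectiveMeasureFamily (α := fun _ : κ => E)
      fun J : Finset κ => P.map fun ω (j : J) => v j ω := by
  intro I J hJI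
  rw [AEMeasurable.map_map_of_aemeasurable
    (Finset.measurable_restrict₂ (X := fun _ : κ => E) hJI).aemeasurable (hv I)]
  rfl

variable {α : ℝ} {r₁ : EReal} {μY : Measure (Closeds Plane)} [IsProbabilityMeasure μY] {a₁ a₂ : ℝ}

/-- The finite-dimensional laws of the limit process: a projective family of probability measures to
which the laws of all colored models converge on every measurable set. The limit of a law is the
mixture of the laws `patternLaw` whose weights are the limits of the probabilities `Qfun`. Total
mass one and projectivity are inherited from any family of models; without such a family there is
nothing to converge, and the family of the point masses at `0` will do. -/
theorem exists_limitLaw (hα : 1 < α) (hr₁ : 0 < r₁) (hαr₁ : α ≤ 3 → r₁ ≠ ⊤)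
    (hμY : ∀ᵐ F ∂μY, IsGoodGrain a₁ a₂ F) (ha₁ : 0 < a₁) (ha₂ : 0 < a₂)
    (γ : Measure (Plane → ℝ)) [IsProbabilityMeasure γ] :
    ∃ L : ∀ J : Finset Plane, Measure (J → ℝ), (∀ J, IsProbabilityMeasure (L J)) ∧
      IsProjectiveMeasureFamily (α := fun _ : Plane => ℝ) L ∧
      ∀ (Ω : SmallSize r₁ → Type*) [∀ r₀, MeasurableSpace (Ω r₀)] (P : ∀ r₀, Measure (Ω r₀))
        [∀ r₀, IsProbabilityMeasure (P r₀)]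
        (x : ∀ r₀, ℕ → Ω r₀ → Plane) (t : ∀ r₀, ℕ → Ω r₀ → ℝ)
        (X : ∀ r₀, ℕ → Ω r₀ → Closeds Plane) (C : ∀ r₀, ℕ → Ω r₀ → Plane → ℝ),
        (∀ r₀, IsColoredDeadLeaves (P r₀) (scaledGrainLaw α r₀ r₁ μY) γ
          (x r₀) (t r₀) (X r₀) (C r₀)) →
        ∀ (J : Finset Plane) (B : Set (J → ℝ)), MeasurableSet B →
          Tendsto (fun r₀ => (P r₀).map
            (fun ω (p : J) => coloredDeadLeaves (x r₀) (t r₀) (X r₀) (C r₀) p ω) B)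
            (smallSizeToZero r₁) (𝓝 (L J B)) := by
  have hbot := smallSizeToZero_neBot hr₁
  have hgood := isGoodGrainLaw_scaledGrainLaw (r₁ := r₁) hα hαr₁ hμY ha₁ ha₂
  choose q hq using fun (J : Finset Plane) (π : OrderedPartition J) =>
    exists_tendsto_Qfun hα hr₁ hαr₁ hμY ha₁ ha₂ _ π.block π.isCompact_block π.block_nonempty
  set L : ∀ J : Finset Plane, Measure (J → ℝ) := fun J =>
    ∑ π : OrderedPartition J, ENNReal.ofReal (q J π) • patternLaw γ π with hL
  by_cases hlim : ∀ (Ω : SmallSize r₁ → Type _) [∀ r₀, MeasurableSpace (Ω r₀)]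
      (P : ∀ r₀, Measure (Ω r₀)) [∀ r₀, IsProbabilityMeasure (P r₀)]
      (x : ∀ r₀, ℕ → Ω r₀ → Plane) (t : ∀ r₀, ℕ → Ω r₀ → ℝ)
      (X : ∀ r₀, ℕ → Ω r₀ → Closeds Plane) (C : ∀ r₀, ℕ → Ω r₀ → Plane → ℝ),
      ¬ ∀ r₀, IsColoredDeadLeaves (P r₀) (scaledGrainLaw α r₀ r₁ μY) γ
        (x r₀) (t r₀) (X r₀) (C r₀)
  · have hm : ∀ J : Finset Plane, Measurable fun (_ : Unit) (_ : J) => (0 : ℝ) :=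
      fun J => measurable_const
    refine ⟨fun J => (Measure.dirac ()).map fun _ _ => 0,
      fun J => Measure.isProbabilityMeasure_map (hm J).aemeasurable,
      isProjectiveMeasureFamily_map (v := fun (_ : Plane) (_ : Unit) => (0 : ℝ))
        fun J => (hm J).aemeasurable, ?_⟩
    intro Ω _ P _ x t X C h
    exact absurd h (hlim Ω P x t X C)
  have hconv : ∀ (Ω : SmallSize r₁ → Type _) [∀ r₀, MeasurableSpace (Ω r₀)]
      (P : ∀ r₀, Measure (Ω r₀)) [∀ r₀, IsProbabilityMeasure (P r₀)]
      (x : ∀ r₀, ℕ → Ω r₀ → Plane) (t : ∀ r₀, ℕ → Ω r₀ → ℝ)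
      (X : ∀ r₀, ℕ → Ω r₀ → Closeds Plane) (C : ∀ r₀, ℕ → Ω r₀ → Plane → ℝ),
      (∀ r₀, IsColoredDeadLeaves (P r₀) (scaledGrainLaw α r₀ r₁ μY) γ
        (x r₀) (t r₀) (X r₀) (C r₀)) →
      ∀ (J : Finset Plane) (B : Set (J → ℝ)), MeasurableSet B →
        Tendsto (fun r₀ => (P r₀).map
          (fun ω (p : J) => coloredDeadLeaves (x r₀) (t r₀) (X r₀) (C r₀) p ω) B)
          (smallSizeToZero r₁) (𝓝 (L J B)) := by
    intro Ω _ P _ x t X C h J B hB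
    simp only [fun r₀ => (h r₀).map_coloredDeadLeaves_apply (hgood r₀) J hB, hL,
      Measure.coe_finsetSum, Finset.sum_apply, Measure.smul_apply, smul_eq_mul]
    refine tendsto_finsetSum _ fun π _ => ENNReal.Tendsto.mul_const ?_
      (Or.inr (measure_ne_top _ _))
    exact ENNReal.tendsto_ofReal (hq J π Ω P x t X fun r₀ => (h r₀).toIsDeadLeaves)
  push Not at hlim
  obtain ⟨Ω, _, P, _, x, t, X, C, h⟩ := hlim
  have hae : ∀ r₀ (J : Finset Plane), AEMeasurable
      (fun ω (p : J) => coloredDeadLeaves (x r₀) (t r₀) (X r₀) (C r₀) p ω) (P r₀) :=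
    fun r₀ J => (h r₀).aemeasurable_coloredDeadLeaves (hgood r₀) J
  have hprob : ∀ r₀ (J : Finset Plane), IsProbabilityMeasure ((P r₀).map
      fun ω (p : J) => coloredDeadLeaves (x r₀) (t r₀) (X r₀) (C r₀) p ω) :=
    fun r₀ J => Measure.isProbabilityMeasure_map (hae r₀ J)
  obtain ⟨h1, h2⟩ := isProjectiveMeasureFamily_of_tendsto (E := fun _ : Plane => ℝ)
    (fun r₀ => isProjectiveMeasureFamily_map (hae r₀)) (hconv Ω P x t X C h)
  exact ⟨L, h1, h2, hconv⟩

theorem exists_limitProcess (hα : 1 < α) (hr₁ : 0 < r₁) (hαr₁ : α ≤ 3 → r₁ ≠ ⊤)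
    (hμY : ∀ᵐ F ∂μY, IsGoodGrain a₁ a₂ F) (ha₁ : 0 < a₁) (ha₂ : 0 < a₂)
    (γ : Measure (Plane → ℝ)) [IsProbabilityMeasure γ] :
    ∃ (Ω' : Type) (_ : MeasurableSpace Ω') (P' : Measure Ω') (_ : IsProbabilityMeasure P')
        (I₀ : Plane → Ω' → ℝ), (∀ p, Measurable (I₀ p)) ∧
      ∀ (Ω : SmallSize r₁ → Type*) [∀ r₀, MeasurableSpace (Ω r₀)] (P : ∀ r₀, Measure (Ω r₀))
        [∀ r₀, IsProbabilityMeasure (P r₀)]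
        (x : ∀ r₀, ℕ → Ω r₀ → Plane) (t : ∀ r₀, ℕ → Ω r₀ → ℝ)
        (X : ∀ r₀, ℕ → Ω r₀ → Closeds Plane) (C : ∀ r₀, ℕ → Ω r₀ → Plane → ℝ),
        (∀ r₀, IsColoredDeadLeaves (P r₀) (scaledGrainLaw α r₀ r₁ μY) γ
          (x r₀) (t r₀) (X r₀) (C r₀)) →
        ∀ (n : ℕ) (p : Fin n → Plane),
          TendstoInDistribution
            (fun r₀ ω j => coloredDeadLeaves (x r₀) (t r₀) (X r₀) (C r₀) (p j) ω)
            (smallSizeToZero r₁) (fun ω' j => I₀ (p j) ω') P P' := by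
  classical
  have hbot := smallSizeToZero_neBot hr₁
  have hgen : (smallSizeToZero r₁).IsCountablyGenerated := by
    unfold smallSizeToZero
    infer_instance
  obtain ⟨L, hL, hproj, hlim⟩ := exists_limitLaw hα hr₁ hαr₁ hμY ha₁ ha₂ γ
  obtain ⟨P', hP'⟩ := exists_isProjectiveLimit (E := fun _ : Plane => ℝ) hproj
  have := hP'.isProbabilityMeasure
  refine ⟨Plane → ℝ, inferInstance, P', inferInstance, fun p f => f p,
    fun p => measurable_pi_apply p, ?_⟩
  intro Ω _ P _ x t X C h n p
  have hgood := isGoodGrainLaw_scaledGrainLaw (r₁ := r₁) hα hαr₁ hμY ha₁ ha₂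
  set J : Finset Plane := Finset.univ.image p with hJ
  have hmem : ∀ j, p j ∈ J := fun j => Finset.mem_image_of_mem _ (Finset.mem_univ j)
  have hdist : TendstoInDistribution
      (fun r₀ ω (y : J) => coloredDeadLeaves (x r₀) (t r₀) (X r₀) (C r₀) y ω)
      (smallSizeToZero r₁) (J.restrict : (Plane → ℝ) → J → ℝ) P P' := by
    refine tendstoInDistribution_of_tendsto_measure
      (fun r₀ => (h r₀).aemeasurable_coloredDeadLeaves (hgood r₀) J)
      (Finset.measurable_restrict J).aemeasurable fun B hB => ?_
    rw [hP' J]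
    exact hlim Ω P x t X C h J B hB
  exact hdist.continuous_comp (g := fun (w : J → ℝ) (j : Fin n) => w ⟨p j, hmem j⟩) (by fun_prop)

end LimitProcess

end DeadLeaves

open DeadLeaves
theorem mainTheorem2 (α : ℝ) (hα : 1 < α) (r₁ : EReal) (hr₁ : 0 < r₁)
    (hαr₁ : α ≤ 3 → r₁ ≠ ⊤)
    (μY : Measure (Closeds Plane)) [IsProbabilityMeasure μY]
    (hY : ∃ a₁ a₂ : ℝ, 0 < a₁ ∧ a₁ < a₂ ∧ ∀ᵐ F : Closeds Plane ∂μY,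
      Metric.closedBall 0 a₁ ⊆ (F : Set Plane) ∧ (F : Set Plane) ⊆ Metric.closedBall 0 a₂)
    (hbd : ∀ᵐ F : Closeds Plane ∂μY, volume (frontier (F : Set Plane)) = 0)
    (γ : Measure (Plane → ℝ)) [IsProbabilityMeasure γ] :
    (∃ (Ω' : Type) (_ : MeasurableSpace Ω') (P' : Measure Ω') (_ : IsProbabilityMeasure P')
        (I₀ : Plane → Ω' → ℝ), (∀ p, Measurable (I₀ p)) ∧
      ∀ (Ω : SmallSize r₁ → Type*) [∀ r₀, MeasurableSpace (Ω r₀)] (P : ∀ r₀, Measure (Ω r₀))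
        [∀ r₀, IsProbabilityMeasure (P r₀)]
        (x : ∀ r₀, ℕ → Ω r₀ → Plane) (t : ∀ r₀, ℕ → Ω r₀ → ℝ)
        (X : ∀ r₀, ℕ → Ω r₀ → Closeds Plane) (C : ∀ r₀, ℕ → Ω r₀ → Plane → ℝ),
        (∀ r₀, IsColoredDeadLeaves (P r₀) (scaledGrainLaw α r₀ r₁ μY) γ
          (x r₀) (t r₀) (X r₀) (C r₀)) →
        ∀ (n : ℕ) (p : Fin n → Plane),
          TendstoInDistribution
            (fun r₀ ω j => coloredDeadLeaves (x r₀) (t r₀) (X r₀) (C r₀) (p j) ω)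
            (smallSizeToZero r₁) (fun ω' j => I₀ (p j) ω') P P') ∧
    (∀ (n : ℕ) (K : Fin n → Set Plane), (∀ j, IsCompact (K j)) → (∀ j, (K j).Nonempty) →
      ∃ q : ℝ,
      ∀ (Ω : SmallSize r₁ → Type*) [∀ r₀, MeasurableSpace (Ω r₀)] (P : ∀ r₀, Measure (Ω r₀))
        [∀ r₀, IsProbabilityMeasure (P r₀)]
        (x : ∀ r₀, ℕ → Ω r₀ → Plane) (t : ∀ r₀, ℕ → Ω r₀ → ℝ)
        (X : ∀ r₀, ℕ → Ω r₀ → Closeds Plane),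
        (∀ r₀, IsDeadLeaves (P r₀) (scaledGrainLaw α r₀ r₁ μY) (x r₀) (t r₀) (X r₀)) →
        Tendsto (fun r₀ => Qfun (P r₀) (x r₀) (t r₀) (X r₀) K) (smallSizeToZero r₁) (𝓝 q)) := by
  obtain ⟨a₁, a₂, ha₁, ha, hYa⟩ := hY
  have ha₂ := ha₁.trans ha
  have hμY : ∀ᵐ F ∂μY, IsGoodGrain a₁ a₂ F := by
    filter_upwards [hYa, hbd] with F h1 h2
    exact ⟨h1.1, h1.2, h2⟩
  exact ⟨exists_limitProcess hα hr₁ hαr₁ hμY ha₁ ha₂ γ,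
    exists_tendsto_Qfun hα hr₁ hαr₁ hμY ha₁ ha₂⟩
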